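/- Let $d\in\{1,2,3\}$ and let $\mathscr D\subset\mathbb R^d$ be a bounded domain with smooth boundary and outward unit normal $n$. Let $\gamma,\alpha,\sigma,\kappa,\mu,\lambda>0$, let $e\in\mathbb R^3$ be a unit vector, and for $u:\mathscr D\to\mathbb R^3$ put $$H(u)=\sigma\Delta u-\kappa\mu u-\kappa|u|^2u-\lambda e(e\cdot u),$$ $$\mathcal E(u)=\frac{\sigma}{2}\|\nabla u\|_{L^2}^2+\frac{\kappa\mu}{2}\|u\|_{L^2}^2+\frac{\kappa}{4}\|u\|_{L^4}^4+\frac{\lambda}{2}\int_{\mathscr D}(e\cdot u)^2\,dx .$$ Let $u_0\in H^2(\mathscr D;\mathbb R^3)$. For $T>0$, a strong solution on $[0,T]$ of the Landau–Lifshitz–Bloch equation without current ($\nu=0$) is a function $u\in H^1(0,T;L^2(\mathscr D;\mathbb R^3))\cap L^\infty(0,T;H^2(\mathscr D;\mathbb R^3))$, taken in its representative in $C([0,T];L^2)$, such that $u(0)=u_0$ and, for almost every $t\in(0,T)$, $\partial u(t)/\partial n=0$ on $\partial\mathscr D$ and $$\langle\partial_tu(t),\chi\rangle=-\gamma\langle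 u(t)\times H(u(t)),\chi\rangle+\alpha\langle H(u(t)),\chi\rangle\qquad\text{for all }\chi\in L^2(\mathscr D;\mathbb R^3).$$ (i) If $u$ is a strong solution on $[0,T]$, then for every $t\in[0,T]$ one has $u(t)\in L^\infty\cap H^1$, the energy $\mathcal E(u(t))$ is finite, and $$\|u(t)\|_{L^\infty}\le e^{-\alpha\kappa\mu t}\|u_0\|_{L^\infty},\qquad \mathcal E(u(t))\le e^{-2\alpha\kappa\mu t}\,\mathcal E(u_0).$$ (ii) If $u:[0,\infty)\to L^2(\mathscr D;\mathbb R^3)$ is a strong solution on $[0,T]$ for every $T>0$, then $\|u(t)\|_{L^\infty}\to0$ (that is, $u(t)\to0$ uniformly in space), $\mathcal E(u(t))\to0$ and $\|u(t)\|_{H^1}\to0$ as $t\to\infty$. -/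

import Mathlib

open MeasureTheory Filter Topology Set
open scoped ContDiff

namespace LLB

noncomputable section

/-- The ambient space `ℝ^d` with its Euclidean norm. -/
abbrev Sp (d : ℕ) : Type := EuclideanSpace ℝ (Fin d)

/-- The target space `ℝ³` of magnetisation vectors. -/
abbrev V3 : Type := EuclideanSpace ℝ (Fin 3)

/-- The vector product of `ℝ³`. -/
def cross (a b : V3) : V3 := WithLp.toLp 2 (crossProduct a.ofLp b.ofLp)

/-- The `i`-th classical partial derivative. -/
def partialDeriv {d : ℕ} {F : Type*} [NormedAddCommGroup F] [NormedSpace ℝ F]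
    (i : Fin d) (f : Sp d → F) (x : Sp d) : F :=
  fderiv ℝ f x (EuclideanSpace.single i 1)

/-! ### Smooth domains -/

/-- `ψ` is a smooth defining function of `D`: `D = {ψ < 0}` and `∇ψ ≠ 0` on `∂D`. At a boundary
point, `∇ψ` is then a positive multiple of the outward unit normal `n`. -/
structure IsDefiningFunction {d : ℕ} (D : Set (Sp d)) (ψ : Sp d → ℝ) : Prop where
  contDiff : ContDiff ℝ ∞ ψ
  eq_sublevel : D = {x | ψ x < 0}
  fderiv_ne_zero : ∀ x ∈ frontier D, fderiv ℝ ψ x ≠ 0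

/-- A bounded domain (open, connected, non-empty) with smooth boundary. -/
structure IsSmoothBoundedDomain {d : ℕ} (D : Set (Sp d)) : Prop where
  isOpen : IsOpen D
  isConnected : IsConnected D
  isBounded : Bornology.IsBounded D
  smooth_boundary : ∃ ψ : Sp d → ℝ, IsDefiningFunction D ψ

/-! ### Weak derivatives and Sobolev spaces on `D` -/

section Sobolev

variable {d : ℕ} {F : Type*} [NormedAddCommGroup F] [NormedSpace ℝ F]

/-- Test functions: elements of `C_c^∞(D; F)`, extended by zero. -/
structure IsTestFunction (D : Set (Sp d)) (φ : Sp d → F) : Prop where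
  contDiff : ContDiff ℝ ∞ φ
  hasCompactSupport : HasCompactSupport φ
  tsupport_subset : tsupport φ ⊆ D

/-- `g` is the `i`-th weak partial derivative of `f` on `D`. -/
structure HasWeakDeriv (D : Set (Sp d)) (i : Fin d) (f g : Sp d → F) : Prop where
  locallyIntegrable : LocallyIntegrableOn f D volume
  locallyIntegrable_deriv : LocallyIntegrableOn g D volume
  integral_eq : ∀ φ : Sp d → ℝ, IsTestFunction D φ →
    (∫ x in D, partialDeriv i φ x • f x) = - (∫ x in D, φ x • g x)

open Classical in
/-- The `i`-th weak partial derivative of `f` on `D` (unique up to null sets; zero if there is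
none). -/
def weakDeriv (D : Set (Sp d)) (i : Fin d) (f : Sp d → F) : Sp d → F :=
  if h : ∃ g, HasWeakDeriv D i f g then h.choose else 0

/-- `f ∈ H¹(D; F)`. -/
structure MemH1 (D : Set (Sp d)) (f : Sp d → F) : Prop where
  memLp : MemLp f 2 (volume.restrict D)
  exists_deriv : ∀ i : Fin d, ∃ g, HasWeakDeriv D i f g
  memLp_deriv : ∀ i : Fin d, MemLp (weakDeriv D i f) 2 (volume.restrict D)

/-- `f ∈ H²(D; F)`. -/
structure MemH2 (D : Set (Sp d)) (f : Sp d → F) : Prop where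
  memH1 : MemH1 D f
  memH1_deriv : ∀ i : Fin d, MemH1 D (weakDeriv D i f)

/-- The norm of `H¹(D; F)`, with values in `[0, ∞]`; meaningful for `f ∈ H¹`. -/
def h1Norm (D : Set (Sp d)) (f : Sp d → F) : ENNReal :=
  (eLpNorm f 2 (volume.restrict D) ^ 2
    + ∑ i : Fin d, eLpNorm (weakDeriv D i f) 2 (volume.restrict D) ^ 2) ^ (1 / 2 : ℝ)

/-- The norm of `H²(D; F)`, with values in `[0, ∞]`; meaningful for `f ∈ H²`. -/
def h2Norm (D : Set (Sp d)) (f : Sp d → F) : ENNReal :=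
  (eLpNorm f 2 (volume.restrict D) ^ 2
    + ∑ i : Fin d, eLpNorm (weakDeriv D i f) 2 (volume.restrict D) ^ 2
    + ∑ i : Fin d, ∑ j : Fin d,
        eLpNorm (weakDeriv D j (weakDeriv D i f)) 2 (volume.restrict D) ^ 2) ^ (1 / 2 : ℝ)

/-- The Laplacian `Δ f = ∑ᵢ ∂ᵢ ∂ᵢ f`. -/
def laplacian (D : Set (Sp d)) (f : Sp d → F) (x : Sp d) : F :=
  ∑ i : Fin d, weakDeriv D i (weakDeriv D i f) x

/-- `f ∈ H¹₀(D; F)`, the closure of `C_c^∞(D; F)` in `H¹(D; F)`. On a smooth bounded domain these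
are the functions of `H¹` whose trace on `∂D` vanishes. -/
def MemH10 (D : Set (Sp d)) (f : Sp d → F) : Prop :=
  MemH1 D f ∧ ∃ φ : ℕ → Sp d → F, (∀ n, IsTestFunction D (φ n)) ∧
    Tendsto (fun n => eLpNorm (fun x => φ n x - f x) 2 (volume.restrict D)) atTop (𝓝 0) ∧
    ∀ i : Fin d, Tendsto (fun n =>
      eLpNorm (fun x => partialDeriv i (φ n) x - weakDeriv D i f x) 2 (volume.restrict D))
      atTop (𝓝 0)

/-- The homogeneous Neumann condition `∂f/∂n = 0` on `∂D`, for `f ∈ H²(D; F)`: the function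
`∇ψ · ∇f`, where `ψ` is a defining function of `D` (so that `∇ψ = |∇ψ| n` on `∂D`), has
vanishing trace. -/
def NeumannZero (D : Set (Sp d)) (f : Sp d → F) : Prop :=
  ∃ ψ : Sp d → ℝ, IsDefiningFunction D ψ ∧
    MemH10 D (fun x => ∑ i : Fin d, partialDeriv i ψ x • weakDeriv D i f x)

end Sobolev

/-! ### Functions of time with values in a Banach space -/

/-- `u ∈ H¹(0,T; X)` with weak time derivative `u'`. -/
structure HasH1TimeDeriv {X : Type*} [NormedAddCommGroup X] [NormedSpace ℝ X]
    (T : ℝ) (u u' : ℝ → X) : Prop where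
  memLp : MemLp u 2 (volume.restrict (Ioo 0 T))
  memLp_deriv : MemLp u' 2 (volume.restrict (Ioo 0 T))
  integral_eq : ∀ φ : ℝ → ℝ, ContDiff ℝ ∞ φ → HasCompactSupport φ → tsupport φ ⊆ Ioo 0 T →
    (∫ t in Ioo 0 T, deriv φ t • u t) = - (∫ t in Ioo 0 T, φ t • u' t)

/-- The space `𝕃² = L²(D; ℝ³)`. -/
abbrev L2 {d : ℕ} (D : Set (Sp d)) : Type := Lp V3 2 (volume.restrict D)

/-- `u ∈ L^∞(0,T; H²)`. For a function that is measurable into `L²`, measurability into the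
separable Hilbert space `H²` is automatic. -/
structure MemLinftyH2 {d : ℕ} (D : Set (Sp d)) (T : ℝ) (u : ℝ → L2 D) : Prop where
  aestronglyMeasurable : AEStronglyMeasurable u (volume.restrict (Ioo 0 T))
  memH2 : ∀ᵐ t ∂(volume.restrict (Ioo 0 T)), MemH2 D (u t)
  bounded : ∃ M : NNReal, ∀ᵐ t ∂(volume.restrict (Ioo 0 T)), h2Norm D (u t) ≤ M

/-! ### The Landau-Lifshitz-Bloch equation with spin torques -/

/-- The coefficients of the equation. -/
structure Coeffs where
  /-- gyromagnetic ratio -/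
  γ : ℝ
  /-- damping -/
  α : ℝ
  /-- adiabatic torque -/
  β₁ : ℝ
  /-- non-adiabatic torque -/
  β₂ : ℝ
  /-- exchange -/
  σ : ℝ
  /-- longitudinal susceptibility -/
  κ : ℝ
  /-- equilibrium magnetisation -/
  μ : ℝ
  /-- anisotropy -/
  lam : ℝ
  /-- anisotropy axis -/
  e : V3

/-- The standing assumptions on the coefficients. -/
structure Coeffs.Admissible (c : Coeffs) : Prop where
  γ_pos : 0 < c.γ
  α_pos : 0 < c.α
  σ_pos : 0 < c.σ
  κ_pos : 0 < c.κ
  μ_pos : 0 < c.μ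
  lam_pos : 0 < c.lam
  e_unit : ‖c.e‖ = 1

/-- The effective field `H = σ Δu - κμ u - κ |u|² u - λ e (e · u)`. -/
def effField {d : ℕ} (D : Set (Sp d)) (c : Coeffs) (u : Sp d → V3) (x : Sp d) : V3 :=
  c.σ • laplacian D u x - (c.κ * c.μ) • u x - (c.κ * ‖u x‖ ^ 2) • u x
    - (c.lam * inner ℝ c.e (u x)) • c.e

/-- The transport term `(ν · ∇) u = ∑ᵢ νᵢ ∂ᵢ u`. -/
def transport {d : ℕ} (D : Set (Sp d)) (ν : Sp d → Sp d) (u : Sp d → V3) (x : Sp d) : V3 :=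
  ∑ i : Fin d, ν x i • weakDeriv D i u x

/-- The pointwise density of the micromagnetic energy. -/
def energyDensity {d : ℕ} (D : Set (Sp d)) (c : Coeffs) (u : Sp d → V3) (x : Sp d) : ℝ :=
  c.σ / 2 * ∑ i : Fin d, ‖weakDeriv D i u x‖ ^ 2 + c.κ * c.μ / 2 * ‖u x‖ ^ 2
    + c.κ / 4 * ‖u x‖ ^ 4 + c.lam / 2 * (inner ℝ c.e (u x)) ^ 2

/-- The micromagnetic energy functional. -/
def energy {d : ℕ} (D : Set (Sp d)) (c : Coeffs) (u : Sp d → V3) : ℝ :=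
  ∫ x in D, energyDensity D c u x

/-- `u` is a strong solution on `[0,T]`, with current density `ν` and initial datum `u₀`, of
`∂ₜu = -γ u × H + α H + β₁ (ν·∇)u + β₂ u × (ν·∇)u` in `D`, `∂u/∂n = 0` on `∂D`:
`u ∈ H¹(0,T; L²) ∩ L^∞(0,T; H²)` (in its representative in `C([0,T]; L²)`), `u(0) = u₀`, and the
equation holds for almost every time when tested with any `χ ∈ L²`. -/
structure IsStrongSolution {d : ℕ} (D : Set (Sp d)) (T : ℝ) (c : Coeffs)
    (ν : ℝ → Sp d → Sp d) (u₀ : L2 D) (u : ℝ → L2 D) : Prop where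
  continuousOn : ContinuousOn u (Icc 0 T)
  initial : u 0 = u₀
  memLinftyH2 : MemLinftyH2 D T u
  neumann : ∀ᵐ t ∂(volume.restrict (Ioo 0 T)), NeumannZero D (u t)
  equation : ∃ u' : ℝ → L2 D, HasH1TimeDeriv T u u' ∧
    ∀ᵐ t ∂(volume.restrict (Ioo 0 T)), ∀ χ : L2 D,
      (∫ x in D, inner ℝ (u' t x) (χ x)) =
        - c.γ * (∫ x in D, inner ℝ (cross (u t x) (effField D c (u t) x)) (χ x))
        + c.α * (∫ x in D, inner ℝ (effField D c (u t) x) (χ x))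
        + c.β₁ * (∫ x in D, inner ℝ (transport D (ν t) (u t) x) (χ x))
        + c.β₂ * (∫ x in D, inner ℝ (cross (u t x) (transport D (ν t) (u t) x)) (χ x))

end

end LLB

/-! Energy decay. The functional `energy` is convex on bounded functions of H¹, and at an H²
function with vanishing normal derivative its gradient in L² is `-effField`. Testing the equation
with H itself kills the precession term, since u × H is orthogonal to H, and formally gives dE/dt =
-α‖H‖². Each part of the energy is homogeneous of degree two or four, so 2E ≤ ⟨-H, u⟩. Combined with
κμ‖u‖² ≤ 2E and Cauchy–Schwarz this yields ‖H‖² ≥ 2κμE (`mul_energy_le_norm_sq`), hence the rate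
2ακμ.

Maximum principle. Put w = exp(ακμt) u and k = ‖u₀‖_∞, and consider the integral of the convex
function `truncEnergy k`, which vanishes exactly on the ball of radius k. Its gradient at w is a
nonnegative multiple of u, so the precession term drops out again. The Laplacian contributes with a
good sign by Green's formula and monotonicity of the gradient, and the damping -κμu compensates the
growth of the exponential. The integral starts at zero and cannot grow, so it stays zero.

Both arguments differentiate a convex functional along a curve that is regular only at almost every
time. `le_exp_mul_of_subgradient` handles this: tangent inequalities at a dense set of times give
absolute continuity, and at almost every time they force the derivative to be ⟨gradient, velocity⟩.

Three analytic facts support this. Green's formula (`green`) is proved without traces: the Neumann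
condition says that ∇ψ · ∇u lies in H¹₀, Hardy's inequality then puts (∇ψ · ∇u)/ψ in L², and this
makes the boundary layer of a cutoff negligible. Boundedness of H² Neumann functions
(`IsSmoothBoundedDomain.exists_norm_le`) comes from Stampacchia's method and the embedding of
W^{1,1} into L^{3/2}, where d ≤ 3 enters. Finally, on an H²-bounded set of Neumann functions the
gradient is Hölder continuous in the L² norm, so the energy is continuous on its L² closure
(`continuousOn_energy`). That closure contains u(t) for every t, which is how all times are reached.
-/

open MeasureTheory Filter Topology Set
open scoped ContDiff

set_option linter.unusedSectionVars false

namespace LLB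

/-! ### Calculus of weak derivatives. -/

section WeakDerivatives

variable {d : ℕ} {F : Type*} [NormedAddCommGroup F] [NormedSpace ℝ F]
  {F' : Type*} [NormedAddCommGroup F'] [NormedSpace ℝ F'] {D : Set (Sp d)} {i : Fin d}

lemma IsTestFunction.zero_of_notMem {φ : Sp d → F} (hφ : IsTestFunction D φ) {x : Sp d}
    (hx : x ∉ D) : φ x = 0 :=
  image_eq_zero_of_notMem_tsupport fun h => hx (hφ.tsupport_subset h)

lemma IsTestFunction.partialDeriv {φ : Sp d → F} (hφ : IsTestFunction D φ) (i : Fin d) :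
    IsTestFunction D (partialDeriv i φ) where
  contDiff := (hφ.contDiff.fderiv_right (m := ∞) (by simp)).clm_apply contDiff_const
  hasCompactSupport := hφ.hasCompactSupport.fderiv_apply (𝕜 := ℝ) _
  tsupport_subset := (tsupport_fderiv_apply_subset ℝ _).trans hφ.tsupport_subset

lemma IsTestFunction.mul {φ χ : Sp d → ℝ} (hφ : IsTestFunction D φ) (hχ : ContDiff ℝ ∞ χ) :
    IsTestFunction D (fun x => φ x * χ x) where
  contDiff := hφ.contDiff.mul hχ
  hasCompactSupport := hφ.hasCompactSupport.mul_right
  tsupport_subset := (tsupport_mul_subset_left).trans hφ.tsupport_subset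

lemma IsTestFunction.continuous {φ : Sp d → F} (hφ : IsTestFunction D φ) : Continuous φ :=
  hφ.contDiff.continuous

lemma partialDeriv_mul {φ χ : Sp d → ℝ} {x : Sp d} (hφ : DifferentiableAt ℝ φ x)
    (hχ : DifferentiableAt ℝ χ x) (i : Fin d) :
    partialDeriv i (fun y => φ y * χ y) x = partialDeriv i φ x * χ x + φ x * partialDeriv i χ x := by
  simp only [partialDeriv, fderiv_fun_mul hφ hχ]
  simp [add_comm, mul_comm]

/-- A continuous function with compact support in `D` times a locally integrable one. -/
lemma integrable_smul_of_tsupport_subset {χ : Sp d → ℝ} (hχ : Continuous χ)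
    (hc : HasCompactSupport χ) (hs : tsupport χ ⊆ D) {f : Sp d → F}
    (hf : LocallyIntegrableOn f D volume) : Integrable (fun x => χ x • f x) volume := by
  have h1 : IntegrableOn (fun x => χ x • f x) (tsupport χ) volume :=
    (hf.integrableOn_compact_subset hs hc).continuousOn_smul hχ.continuousOn hc
  rw [← integrableOn_univ]
  exact h1.of_forall_sdiff_eq_zero MeasurableSet.univ fun x hx => by
    simp [image_eq_zero_of_notMem_tsupport hx.2]

lemma IsTestFunction.integrable_smul {χ : Sp d → ℝ} (hχ : IsTestFunction D χ) {f : Sp d → F}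
    (hf : LocallyIntegrableOn f D volume) : Integrable (fun x => χ x • f x) volume :=
  integrable_smul_of_tsupport_subset hχ.continuous hχ.hasCompactSupport hχ.tsupport_subset hf

lemma IsTestFunction.setIntegral_smul {χ : Sp d → ℝ} (hχ : IsTestFunction D χ) (f : Sp d → F) :
    ∫ x in D, χ x • f x = ∫ x, χ x • f x :=
  setIntegral_eq_integral_of_forall_compl_eq_zero fun x hx => by simp [hχ.zero_of_notMem hx]

lemma _root_.MeasureTheory.MemLp.locallyIntegrableOn_of_restrict {f : Sp d → F} {p : ENNReal}
    (hp : 1 ≤ p) (hf : MemLp f p (volume.restrict D)) : LocallyIntegrableOn f D volume := by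
  intro x _
  refine ⟨D ∩ Metric.ball x 1, inter_mem_nhdsWithin _ (Metric.ball_mem_nhds x one_pos), ?_⟩
  have h1 : MemLp f p (volume.restrict (D ∩ Metric.ball x 1)) :=
    hf.mono_measure (Measure.restrict_mono inter_subset_left le_rfl)
  have : IsFiniteMeasure (volume.restrict (D ∩ Metric.ball x 1)) :=
    ⟨by simpa using (measure_mono inter_subset_right).trans_lt measure_ball_lt_top⟩
  exact h1.integrable hp

lemma _root_.MeasureTheory.LocallyIntegrableOn.congr_ae_restrict
    {f g : Sp d → F} (hf : LocallyIntegrableOn f D volume)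
    (h : f =ᵐ[volume.restrict D] g) : LocallyIntegrableOn g D volume := by
  intro x hx
  obtain ⟨s, hs, hfs⟩ := hf x hx
  refine ⟨s ∩ D, inter_mem hs self_mem_nhdsWithin, ?_⟩
  have : IntegrableOn f (s ∩ D) volume := hfs.mono_set inter_subset_left
  exact this.congr_fun_ae (ae_restrict_of_ae_restrict_of_subset inter_subset_right h)

lemma HasWeakDeriv.congr {f g f₁ g₁ : Sp d → F} (h : HasWeakDeriv D i f g)
    (hf : f =ᵐ[volume.restrict D] f₁) (hg : g =ᵐ[volume.restrict D] g₁) :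
    HasWeakDeriv D i f₁ g₁ where
  locallyIntegrable := h.1.congr_ae_restrict hf
  locallyIntegrable_deriv := h.2.congr_ae_restrict hg
  integral_eq φ hφ := by
    have e1 : ∫ x in D, LLB.partialDeriv i φ x • f x = ∫ x in D, LLB.partialDeriv i φ x • f₁ x :=
      integral_congr_ae (hf.mono fun x hx => by simp only [hx])
    have e2 : ∫ x in D, φ x • g x = ∫ x in D, φ x • g₁ x :=
      integral_congr_ae (hg.mono fun x hx => by simp only [hx])
    rw [← e1, ← e2]
    exact h.3 φ hφ

lemma HasWeakDeriv.integral_eq' {f g : Sp d → F} (h : HasWeakDeriv D i f g) {φ : Sp d → ℝ}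
    (hφ : IsTestFunction D φ) : ∫ x, LLB.partialDeriv i φ x • f x = - ∫ x, φ x • g x := by
  rw [← (hφ.partialDeriv i).setIntegral_smul, ← hφ.setIntegral_smul]
  exact h.3 φ hφ

lemma HasWeakDeriv.of_integral_eq {f g : Sp d → F} (hf : LocallyIntegrableOn f D volume)
    (hg : LocallyIntegrableOn g D volume)
    (h : ∀ φ : Sp d → ℝ, IsTestFunction D φ →
      ∫ x, LLB.partialDeriv i φ x • f x = - ∫ x, φ x • g x) : HasWeakDeriv D i f g where
  locallyIntegrable := hf
  locallyIntegrable_deriv := hg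
  integral_eq φ hφ := by
    rw [(hφ.partialDeriv i).setIntegral_smul, hφ.setIntegral_smul]
    exact h φ hφ

/-- The fundamental lemma of the calculus of variations, applied to the difference. It identifies
the derivative selected by choice in `weakDeriv` with any derivative obtained by other means. -/
lemma HasWeakDeriv.unique [CompleteSpace F] (hD : IsOpen D) {f g g₁ : Sp d → F}
    (h : HasWeakDeriv D i f g)
    (h₁ : HasWeakDeriv D i f g₁) : g =ᵐ[volume.restrict D] g₁ := by
  have key := hD.ae_eq_zero_of_integral_contDiff_smul_eq_zero (μ := volume)
    (f := fun x => g x - g₁ x) (h.2.sub h₁.2) fun φ h1 h2 h3 => by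
      have hφ : IsTestFunction D φ := ⟨h1, h2, h3⟩
      simp only [smul_sub]
      rw [integral_sub (hφ.integrable_smul h.2) (hφ.integrable_smul h₁.2), sub_eq_zero]
      exact neg_injective ((h.integral_eq' hφ).symm.trans (h₁.integral_eq' hφ))
  rw [EventuallyEq, ae_restrict_iff' hD.measurableSet]
  filter_upwards [key] with x hx hxD using sub_eq_zero.1 (hx hxD)

lemma HasWeakDeriv.add {f g f₁ g₁ : Sp d → F} (h : HasWeakDeriv D i f g)
    (h₁ : HasWeakDeriv D i f₁ g₁) :
    HasWeakDeriv D i (fun x => f x + f₁ x) (fun x => g x + g₁ x) :=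
  .of_integral_eq (h.1.add h₁.1) (h.2.add h₁.2) fun φ hφ => by
    simp only [smul_add]
    rw [integral_add ((hφ.partialDeriv i).integrable_smul h.1)
      ((hφ.partialDeriv i).integrable_smul h₁.1), integral_add (hφ.integrable_smul h.2)
      (hφ.integrable_smul h₁.2), h.integral_eq' hφ, h₁.integral_eq' hφ]
    abel

lemma _root_.MeasureTheory.LocallyIntegrableOn.clm_comp {f : Sp d → F}
    (hf : LocallyIntegrableOn f D volume) (A : F →L[ℝ] F') :
    LocallyIntegrableOn (fun x => A (f x)) D volume := fun x hx => by
  obtain ⟨s, hs, hfs⟩ := hf x hx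
  exact ⟨s, hs, A.integrable_comp hfs⟩

lemma HasWeakDeriv.clm_comp [CompleteSpace F] [CompleteSpace F'] {f g : Sp d → F}
    (h : HasWeakDeriv D i f g) (A : F →L[ℝ] F') :
    HasWeakDeriv D i (fun x => A (f x)) (fun x => A (g x)) :=
  .of_integral_eq (h.1.clm_comp A) (h.2.clm_comp A) fun φ hφ => by
    simp only [← map_smul]
    rw [A.integral_comp_comm ((hφ.partialDeriv i).integrable_smul h.1),
      A.integral_comp_comm (hφ.integrable_smul h.2), h.integral_eq' hφ, map_neg]

lemma HasWeakDeriv.const_smul [CompleteSpace F] {f g : Sp d → F} (h : HasWeakDeriv D i f g)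
    (a : ℝ) : HasWeakDeriv D i (fun x => a • f x) (fun x => a • g x) := by
  simpa using h.clm_comp (a • ContinuousLinearMap.id ℝ F)

lemma HasWeakDeriv.prodMk [CompleteSpace F] [CompleteSpace F'] {f g : Sp d → F} {f₁ g₁ : Sp d → F'}
    (h : HasWeakDeriv D i f g) (h₁ : HasWeakDeriv D i f₁ g₁) :
    HasWeakDeriv D i (fun x => (f x, f₁ x)) (fun x => (g x, g₁ x)) := by
  simpa using (h.clm_comp (ContinuousLinearMap.inl ℝ F F')).add
    (h₁.clm_comp (ContinuousLinearMap.inr ℝ F F'))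

lemma hasWeakDeriv_weakDeriv {f : Sp d → F} (h : ∃ g, HasWeakDeriv D i f g) :
    HasWeakDeriv D i f (weakDeriv D i f) := by
  rw [weakDeriv, dif_pos h]
  exact h.choose_spec

/-- Multiplication by a test function and extension by zero. -/
lemma HasWeakDeriv.smul_test {f g : Sp d → F} (h : HasWeakDeriv D i f g) {χ : Sp d → ℝ}
    (hχ : IsTestFunction D χ) :
    HasWeakDeriv univ i (fun x => χ x • f x) (fun x => LLB.partialDeriv i χ x • f x + χ x • g x) := by
  have i1 := hχ.integrable_smul h.1
  have i2 := (hχ.partialDeriv i).integrable_smul h.1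
  have i3 := hχ.integrable_smul h.2
  refine .of_integral_eq (i1.locallyIntegrable.locallyIntegrableOn _)
    ((i2.add i3).locallyIntegrable.locallyIntegrableOn _) fun φ hφ => ?_
  -- Here `φ` is a test function on the whole space, but its product with `χ` has compact support in
  -- `D` and may be used in the weak identity for `f`.
  have hprod : IsTestFunction D (fun x => χ x * φ x) := hχ.mul hφ.contDiff
  have key := h.integral_eq' hprod
  have e1 : ∀ x, LLB.partialDeriv i (fun x => χ x * φ x) x • f x =
      φ x • (LLB.partialDeriv i χ x • f x) + LLB.partialDeriv i φ x • (χ x • f x) := fun x => by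
    rw [partialDeriv_mul (hχ.contDiff.differentiable (by simp) x)
      (hφ.contDiff.differentiable (by simp) x)]
    module
  have j1 : Integrable (fun x => φ x • (LLB.partialDeriv i χ x • f x)) volume :=
    hφ.integrable_smul (i2.locallyIntegrable.locallyIntegrableOn _)
  have j2 : Integrable (fun x => LLB.partialDeriv i φ x • (χ x • f x)) volume :=
    (hφ.partialDeriv i).integrable_smul (i1.locallyIntegrable.locallyIntegrableOn _)
  have j3 : Integrable (fun x => φ x • (χ x • g x)) volume :=
    hφ.integrable_smul (i3.locallyIntegrable.locallyIntegrableOn _)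
  simp only [e1] at key
  rw [integral_add j1 j2] at key
  simp only [smul_add]
  rw [integral_add j1 j3]
  have e2 : ∫ x, (χ x * φ x) • g x = ∫ x, φ x • χ x • g x := by
    congr 1; ext x; module
  rw [e2] at key
  rw [neg_add, ← key]
  abel

/-- Weak derivatives are stable under convergence in `L²`. -/
lemma HasWeakDeriv.of_tendsto {f g : ℕ → Lp F 2 (volume.restrict D)}
    {f₀ g₀ : Lp F 2 (volume.restrict D)} (hf : Tendsto f atTop (𝓝 f₀)) (hg : Tendsto g atTop (𝓝 g₀))
    (h : ∀ n, HasWeakDeriv D i (f n) (g n)) : HasWeakDeriv D i f₀ g₀ := by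
  have hloc (u : Lp F 2 (volume.restrict D)) : LocallyIntegrableOn u D volume :=
    (Lp.memLp u).locallyIntegrableOn_of_restrict (by norm_num)
  have lim : ∀ χ : Sp d → ℝ, IsTestFunction D χ →
      ∀ (u : ℕ → Lp F 2 (volume.restrict D)) (u₀ : Lp F 2 (volume.restrict D)),
      Tendsto u atTop (𝓝 u₀) →
      Tendsto (fun n => ∫ x in D, χ x • u n x) atTop (𝓝 (∫ x in D, χ x • u₀ x)) := by
    intro χ hχ u u₀ hu
    have hχ2 : MemLp χ 2 (volume.restrict D) :=
      (hχ.continuous.memLp_of_hasCompactSupport hχ.hasCompactSupport).restrict D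
    have hint (v : Lp F 2 (volume.restrict D)) :
        Integrable (fun x => χ x • v x) (volume.restrict D) :=
      (hχ.integrable_smul (hloc v)).integrableOn
    rw [tendsto_iff_norm_sub_tendsto_zero]
    have hb : Tendsto (fun n => (eLpNorm χ 2 (volume.restrict D)).toReal * ‖u n - u₀‖) atTop
        (𝓝 0) := by
      simpa using (tendsto_iff_norm_sub_tendsto_zero.1 hu).const_mul
        (eLpNorm χ 2 (volume.restrict D)).toReal
    refine squeeze_zero (fun _ => norm_nonneg _) (fun n => ?_) hb
    rw [← integral_sub (hint _) (hint _)]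
    have e : ∫ x in D, (χ x • u n x - χ x • u₀ x) = ∫ x in D, χ x • (u n - u₀ : Lp F 2 _) x :=
      integral_congr_ae ((Lp.coeFn_sub (u n) u₀).mono fun x hx => by
        simp only [hx, Pi.sub_apply, smul_sub])
    rw [e]
    refine (norm_integral_le_lintegral_norm _).trans ?_
    rw [Lp.norm_def, ← ENNReal.toReal_mul]
    refine ENNReal.toReal_mono (ENNReal.mul_ne_top hχ2.2.ne (Lp.memLp _).2.ne) ?_
    have := eLpNorm_smul_le_mul_eLpNorm (p := 2) (q := 2) (r := 1)
      (Lp.memLp (u n - u₀)).1 hχ2.1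
    rw [eLpNorm_one_eq_lintegral_enorm] at this
    simpa only [← ofReal_norm, Pi.smul_apply'] using this
  refine ⟨hloc _, hloc _, fun φ hφ => ?_⟩
  refine tendsto_nhds_unique (lim _ (hφ.partialDeriv i) f f₀ hf) ?_
  simp only [fun n => (h n).3 φ hφ]
  exact (lim φ hφ g g₀ hg).neg

end WeakDerivatives

end LLB

open MeasureTheory Filter Topology Set
open scoped ContDiff
set_option linter.unusedSectionVars false

namespace LLB

noncomputable section

/-! ### Mollification in space. -/

section Mollification

open scoped Convolution

variable {d : ℕ} {F : Type*} [NormedAddCommGroup F] [NormedSpace ℝ F] {D : Set (Sp d)} {i : Fin d}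

/-- A sequence of bump functions concentrating at the origin. -/
def bump (d n : ℕ) : ContDiffBump (0 : Sp d) where
  rIn := 1 / (2 * (n + 1))
  rOut := 1 / (n + 1)
  rIn_pos := by positivity
  rIn_lt_rOut := by
    apply one_div_lt_one_div_of_lt (by positivity)
    have : (0 : ℝ) ≤ n := Nat.cast_nonneg n
    linarith

/-- Regularisation by convolution with a bump function. -/
def moll (n : ℕ) (f : Sp d → F) : Sp d → F :=
  (bump d n).normed volume ⋆[ContinuousLinearMap.lsmul ℝ ℝ, volume] f

lemma moll_apply (n : ℕ) (f : Sp d → F) (x : Sp d) :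
    moll n f x = ∫ t, (bump d n).normed volume (x - t) • f t := by
  rw [moll, convolution_eq_swap]
  rfl

lemma contDiff_moll [CompleteSpace F] {f : Sp d → F} (hf : LocallyIntegrable f volume) (n : ℕ) :
    ContDiff ℝ ∞ (moll n f) :=
  (bump d n).hasCompactSupport_normed.contDiff_convolution_left _ (bump d n).contDiff_normed hf

lemma integrable_moll {f : Sp d → F} (hf : Integrable f volume) (n : ℕ) :
    Integrable (moll n f) volume :=
  (bump d n).integrable_normed.integrable_convolution _ hf

lemma ae_tendsto_moll [CompleteSpace F] {f : Sp d → F} (hf : LocallyIntegrable f volume) :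
    ∀ᵐ x, Tendsto (fun n => moll n f x) atTop (𝓝 (f x)) := by
  refine ContDiffBump.ae_convolution_tendsto_right_of_locallyIntegrable (K := 2)
    tendsto_one_div_add_atTop_nhds_zero_nat (Eventually.of_forall fun n => le_of_eq ?_) hf
  simp only [bump]
  field_simp

lemma norm_moll_le (n : ℕ) (f : Sp d → F) (x : Sp d) : ‖moll n f x‖ ≤ moll n (fun y => ‖f y‖) x := by
  rw [moll_apply, moll_apply]
  refine (norm_integral_le_integral_norm _).trans (le_of_eq ?_)
  congr 1; ext t
  rw [norm_smul, Real.norm_of_nonneg ((bump d n).nonneg_normed _), smul_eq_mul]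

lemma integral_moll [CompleteSpace F] {f : Sp d → F} (hf : Integrable f volume) (n : ℕ) :
    ∫ x, moll n f x = ∫ x, f x := by
  rw [moll, integral_convolution _ (bump d n).integrable_normed hf]
  simp [(bump d n).integral_normed]

lemma integral_norm_moll_le {f : Sp d → F} (hf : Integrable f volume) (n : ℕ) :
    ∫ x, ‖moll n f x‖ ≤ ∫ x, ‖f x‖ := by
  rw [← integral_moll hf.norm n]
  exact integral_mono (integrable_moll hf n).norm (integrable_moll hf.norm n) (norm_moll_le n f)

/-- Almost everywhere convergence is upgraded to L¹ convergence as in Scheffé's lemma. The function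
`c n` is nonnegative and tends to 2‖f‖ almost everywhere. Since mollification preserves the integral
of ‖f‖, the L¹ distance equals the integral of 2‖f‖ - `c n`, whose positive part is dominated by
2‖f‖. -/
lemma tendsto_integral_norm_moll_sub [CompleteSpace F] {f : Sp d → F} (hf : Integrable f volume) :
    Tendsto (fun n => ∫ x, ‖moll n f x - f x‖) atTop (𝓝 0) := by
  have hi (n : ℕ) := integrable_moll hf n
  have hi' (n : ℕ) := integrable_moll hf.norm n
  set c : ℕ → Sp d → ℝ := fun n x => moll n (fun y => ‖f y‖) x + ‖f x‖ - ‖moll n f x - f x‖ with hc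
  have hc0 : ∀ n x, 0 ≤ c n x := fun n x => by
    have h1 := norm_sub_le (moll n f x) (f x)
    have h2 := norm_moll_le n f x
    simp only [hc]; linarith
  have hci (n : ℕ) : Integrable (c n) volume := ((hi' n).add hf.norm).sub ((hi n).sub hf).norm
  have hlim : Tendsto (fun n => ∫ x, max (2 * ‖f x‖ - c n x) 0) atTop (𝓝 (∫ _ : Sp d, (0 : ℝ))) := by
    refine tendsto_integral_of_dominated_convergence (fun x => 2 * ‖f x‖) (fun n => ?_)
      (hf.norm.const_mul 2) (fun n => ?_) ?_
    · exact (((hf.norm.const_mul 2).sub (hci n)).sup (integrable_zero _ _ _)).1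
    · refine Eventually.of_forall fun x => ?_
      rw [Real.norm_of_nonneg (le_max_right _ _)]
      exact max_le (by linarith [hc0 n x]) (by positivity)
    · filter_upwards [ae_tendsto_moll hf.locallyIntegrable, ae_tendsto_moll hf.norm.locallyIntegrable]
        with x h1 h2
      have h3 : Tendsto (fun n => c n x) atTop (𝓝 (‖f x‖ + ‖f x‖ - ‖f x - f x‖)) :=
        (h2.add_const _).sub (h1.sub_const _).norm
      have h4 := ((tendsto_const_nhds (x := 2 * ‖f x‖)).sub h3).max (tendsto_const_nhds (x := (0 : ℝ)))
      have h5 : max (2 * ‖f x‖ - (‖f x‖ + ‖f x‖ - ‖f x - f x‖)) 0 = 0 := by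
        rw [sub_self, norm_zero]; apply max_eq_right; linarith
      rwa [h5] at h4
  rw [integral_zero] at hlim
  refine squeeze_zero (fun n => integral_nonneg fun _ => norm_nonneg _) (fun n => ?_) hlim
  have e : ∫ x, ‖moll n f x - f x‖ = ∫ x, (2 * ‖f x‖ - c n x) := by
    have e1 : ∫ x, ‖moll n f x - f x‖ = ∫ x, (moll n (fun y => ‖f y‖) x + ‖f x‖ - c n x) := by
      congr 1; ext x; simp only [hc]; ring
    have hadd : Integrable (fun x => moll n (fun y => ‖f y‖) x + ‖f x‖) volume :=
      (hi' n).add hf.norm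
    rw [e1, integral_sub hadd (hci n), integral_add (hi' n) hf.norm,
      integral_moll hf.norm n, integral_sub (hf.norm.const_mul 2) (hci n), integral_const_mul]
    ring
  rw [e]
  exact integral_mono ((hf.norm.const_mul 2).sub (hci n))
    (((hf.norm.const_mul 2).sub (hci n)).sup (integrable_zero _ _ _)) fun x => le_max_left _ _

/-- The classical derivative falls on the kernel; the weak identity tested with the reflected kernel
t ↦ ρ(x - t) moves it to `f`. -/
lemma partialDeriv_moll [CompleteSpace F] {f g : Sp d → F} (h : HasWeakDeriv univ i f g) (n : ℕ)
    (x : Sp d) : partialDeriv i (moll n f) x = moll n g x := by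
  set ρ := (bump d n).normed volume with hρ
  have hρc : HasCompactSupport ρ := (bump d n).hasCompactSupport_normed
  have hρd : ContDiff ℝ ∞ ρ := (bump d n).contDiff_normed
  have hf : LocallyIntegrable f volume := locallyIntegrableOn_univ.1 h.1
  have hderiv := hρc.hasFDerivAt_convolution_left (ContinuousLinearMap.lsmul ℝ ℝ)
    (hρd.of_le (by simp)) hf x
  have hex : ConvolutionExistsAt (fderiv ℝ ρ) f x
      ((ContinuousLinearMap.lsmul ℝ ℝ).precompL (Sp d)) volume :=
    (hρc.fderiv ℝ).convolutionExists_left _ (hρd.continuous_fderiv (by simp)) hf x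
  have htest : IsTestFunction (univ : Set (Sp d)) (fun t => ρ (x - t)) :=
    ⟨hρd.comp (contDiff_const.sub contDiff_id),
      hρc.comp_homeomorph (Homeomorph.subLeft x), subset_univ _⟩
  have key := h.integral_eq' htest
  have e1 : ∀ t, partialDeriv i (fun t => ρ (x - t)) t = - partialDeriv i ρ (x - t) := fun t => by
    simp only [partialDeriv]
    have h1 : HasFDerivAt (fun t => x - t) (-ContinuousLinearMap.id ℝ (Sp d)) t := by
      simpa using (hasFDerivAt_id t).const_sub x
    have h2 := ((hρd.differentiable (by simp)) (x - t)).hasFDerivAt.comp t h1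
    rw [show (fun t => ρ (x - t)) = ρ ∘ fun t => x - t from rfl, h2.fderiv]
    simp
  simp only [e1, neg_smul, integral_neg, neg_inj] at key
  rw [moll_apply, ← key]
  simp only [partialDeriv]
  rw [show moll n f = ρ ⋆[ContinuousLinearMap.lsmul ℝ ℝ, volume] f from rfl, hderiv.fderiv,
    convolution_eq_swap]
  rw [ContinuousLinearMap.integral_apply]
  · rfl
  · rw [ConvolutionExistsAt] at hex
    have := hex.comp_sub_left x
    simpa using this

/-- A smooth function with compact support in `D`, equal to one near the support of `φ`. -/
lemma IsTestFunction.exists_eventually_eq_one (hD : IsOpen D) {φ : Sp d → ℝ}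
    (hφ : IsTestFunction D φ) :
    ∃ χ : Sp d → ℝ, IsTestFunction D χ ∧ ∀ x ∈ tsupport φ, χ =ᶠ[𝓝 x] 1 := by
  obtain ⟨K, hK, h1, h2⟩ := exists_compact_between hφ.hasCompactSupport hD hφ.tsupport_subset
  obtain ⟨L, hL, h3, h4⟩ := exists_compact_between hφ.hasCompactSupport isOpen_interior h1
  obtain ⟨χ, hχ, -, hs, h5⟩ := exists_contMDiff_support_eq_eq_one_iff (n := ⊤)
    (modelWithCornersSelf ℝ (Sp d)) isOpen_interior hL.isClosed h4
  have hts : tsupport χ ⊆ K := by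
    rw [tsupport, hs]
    exact closure_minimal interior_subset hK.isClosed
  exact ⟨χ, ⟨hχ.contDiff, hK.of_isClosed_subset (isClosed_tsupport _) hts, hts.trans h2⟩,
    fun x hx => by
      filter_upwards [mem_interior_iff_mem_nhds.1 (h3 hx)] with y hy using (h5 y).1 hy⟩

end Mollification

/-! ### Chain rule for weak derivatives. -/

section ChainRule

variable {d : ℕ} {F : Type*} [NormedAddCommGroup F] [NormedSpace ℝ F] [CompleteSpace F]
  {F' : Type*} [NormedAddCommGroup F'] [NormedSpace ℝ F'] [CompleteSpace F']
  {D : Set (Sp d)} {i : Fin d}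

lemma _root_.MeasureTheory.LocallyIntegrableOn.mono_norm {f : Sp d → F}
    {g : Sp d → ℝ} (hg : LocallyIntegrableOn g D volume)
    (hf : AEStronglyMeasurable f (volume.restrict D))
    (h : ∀ᵐ x ∂(volume.restrict D), ‖f x‖ ≤ g x) : LocallyIntegrableOn f D volume := by
  intro x hx
  obtain ⟨s, hs, hgs⟩ := hg x hx
  refine ⟨s ∩ D, inter_mem hs self_mem_nhdsWithin, ?_⟩
  have h1 : IntegrableOn g (s ∩ D) volume := hgs.mono_set inter_subset_left
  exact h1.mono' (hf.mono_measure (Measure.restrict_mono inter_subset_right le_rfl))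
    (ae_restrict_of_ae_restrict_of_subset inter_subset_right h)

lemma HasWeakDeriv.aestronglyMeasurable {f g : Sp d → F} (h : HasWeakDeriv D i f g) :
    AEStronglyMeasurable f (volume.restrict D) ∧ AEStronglyMeasurable g (volume.restrict D) :=
  ⟨h.1.aestronglyMeasurable, h.2.aestronglyMeasurable⟩

/-- The chain rule for weak derivatives. -/
lemma HasWeakDeriv.comp (hD : IsOpen D) {f g : Sp d → F} (h : HasWeakDeriv D i f g) {G : F → F'}
    (hG : ContDiff ℝ 1 G) {C : ℝ} (hC : ∀ y, ‖fderiv ℝ G y‖ ≤ C) :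
    HasWeakDeriv D i (fun x => G (f x)) (fun x => fderiv ℝ G (f x) (g x)) := by
  have hC0 : 0 ≤ C := (norm_nonneg _).trans (hC 0)
  have hlip : ∀ a b, ‖G a - G b‖ ≤ C * ‖a - b‖ := fun a b =>
    convex_univ.norm_image_sub_le_of_norm_fderiv_le
      (fun y _ => (hG.differentiable one_ne_zero) y) (fun y _ => hC y) (mem_univ b) (mem_univ a)
  have hDG : Continuous (fderiv ℝ G) := hG.continuous_fderiv one_ne_zero
  have happ : Continuous fun p : F × F => fderiv ℝ G p.1 p.2 :=
    (hDG.comp continuous_fst).clm_apply continuous_snd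
  obtain ⟨m1, m2⟩ := h.aestronglyMeasurable
  have l1 : LocallyIntegrableOn (fun x => G (f x)) D volume := by
    refine LocallyIntegrableOn.mono_norm (g := fun x => ‖G 0‖ + C * ‖f x‖)
      ((locallyIntegrable_const _).locallyIntegrableOn _ |>.add
        (h.1.norm.smul C)) (hG.continuous.comp_aestronglyMeasurable m1)
      (Eventually.of_forall fun x => ?_)
    have h1 := hlip (f x) 0
    have h2 := norm_add_le (G (f x) - G 0) (G 0)
    simp only [sub_add_cancel, sub_zero] at h1 h2
    linarith
  have l2 : LocallyIntegrableOn (fun x => fderiv ℝ G (f x) (g x)) D volume :=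
    LocallyIntegrableOn.mono_norm (g := fun x => C * ‖g x‖) (h.2.norm.smul C)
      (happ.comp_aestronglyMeasurable (m1.prodMk m2))
      (Eventually.of_forall fun x => (ContinuousLinearMap.le_opNorm _ _).trans
        (mul_le_mul_of_nonneg_right (hC _) (norm_nonneg _)))
  refine .of_integral_eq l1 l2 fun φ hφ => ?_
  -- Localisation: `χ • f` is defined and integrable on the whole space, so it can be mollified, and
  -- on the support of `φ` it has the same values and derivative as `f`.
  obtain ⟨χ, hχ, hχ1⟩ := hφ.exists_eventually_eq_one hD
  set f₁ : Sp d → F := fun x => χ x • f x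
  set g₁ : Sp d → F := fun x => partialDeriv i χ x • f x + χ x • g x
  have hw : HasWeakDeriv univ i f₁ g₁ := h.smul_test hχ
  have if₁ : Integrable f₁ volume := hχ.integrable_smul h.1
  have ig₁ : Integrable g₁ volume :=
    ((hχ.partialDeriv i).integrable_smul h.1).add (hχ.integrable_smul h.2)
  have hf₁ : ∀ x ∈ tsupport φ, f₁ x = f x := fun x hx => by
    have := (hχ1 x hx).self_of_nhds
    simp only [f₁, this, Pi.one_apply, one_smul]
  have hg₁ : ∀ x ∈ tsupport φ, g₁ x = g x := fun x hx => by
    have h1 := (hχ1 x hx).self_of_nhds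
    have h2 : partialDeriv i χ x = 0 := by
      rw [partialDeriv, (hχ1 x hx).fderiv_eq]
      simp
    simp only [g₁, h1, h2, Pi.one_apply, one_smul, zero_smul, zero_add]
  have sm (n : ℕ) : ContDiff ℝ ∞ (moll n f₁) := contDiff_moll if₁.locallyIntegrable n
  obtain ⟨B, hB⟩ : ∃ B, ∀ x, ‖φ x‖ ≤ B :=
    hφ.hasCompactSupport.exists_bound_of_continuous hφ.continuous
  obtain ⟨B', hB'⟩ : ∃ B, ∀ x, ‖partialDeriv i φ x‖ ≤ B :=
    (hφ.partialDeriv i).hasCompactSupport.exists_bound_of_continuous (hφ.partialDeriv i).continuous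
  have hB0 : 0 ≤ B := (norm_nonneg _).trans (hB 0)
  have hB'0 : 0 ≤ B' := (norm_nonneg _).trans (hB' 0)
  -- the identity for the regularised functions
  have step (n : ℕ) : ∫ x, partialDeriv i φ x • G (moll n f₁ x) =
      - ∫ x, φ x • fderiv ℝ G (moll n f₁ x) (moll n g₁ x) := by
    have c1 : Continuous fun x => G (moll n f₁ x) := hG.continuous.comp (sm n).continuous
    have hder : ∀ x, fderiv ℝ (fun x => G (moll n f₁ x)) x (EuclideanSpace.single i 1) =
        fderiv ℝ G (moll n f₁ x) (moll n g₁ x) := fun x => by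
      have h1 := ((hG.differentiable one_ne_zero) (moll n f₁ x)).hasFDerivAt.comp x
        ((sm n).differentiable (by simp) x).hasFDerivAt
      rw [← partialDeriv_moll hw n x, show (fun x => G (moll n f₁ x)) = G ∘ moll n f₁ from rfl,
        h1.fderiv]
      rfl
    have c2 : Continuous fun x => fderiv ℝ G (moll n f₁ x) (moll n g₁ x) :=
      happ.comp ((sm n).continuous.prodMk (contDiff_moll ig₁.locallyIntegrable n).continuous)
    have := integral_smul_fderiv_eq_neg_fderiv_smul_of_integrable (μ := volume) (f := φ)
      (g := fun x => G (moll n f₁ x)) (v := EuclideanSpace.single i (1 : ℝ))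
      (((hφ.partialDeriv i).continuous.smul c1).integrable_of_hasCompactSupport
        (hφ.partialDeriv i).hasCompactSupport.smul_right)
      (by simp only [hder]
          exact (hφ.continuous.smul c2).integrable_of_hasCompactSupport
            hφ.hasCompactSupport.smul_right)
      ((hφ.continuous.smul c1).integrable_of_hasCompactSupport hφ.hasCompactSupport.smul_right)
      (fun x _ => hφ.contDiff.differentiable (by simp) x)
      (fun x _ => (hG.differentiable one_ne_zero _).comp x ((sm n).differentiable (by simp) x))
    simp only [hder] at this
    rw [this, neg_neg]
    rfl
  have t1 := tendsto_integral_norm_moll_sub if₁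
  have t2 := tendsto_integral_norm_moll_sub ig₁
  have iL : Integrable (fun x => partialDeriv i φ x • G (f x)) volume :=
    (hφ.partialDeriv i).integrable_smul l1
  have iR : Integrable (fun x => φ x • fderiv ℝ G (f x) (g x)) volume := hφ.integrable_smul l2
  have iLn (n : ℕ) : Integrable (fun x => partialDeriv i φ x • G (moll n f₁ x)) volume :=
    ((hφ.partialDeriv i).continuous.smul
      (hG.continuous.comp (sm n).continuous)).integrable_of_hasCompactSupport
        (hφ.partialDeriv i).hasCompactSupport.smul_right
  have limL : Tendsto (fun n => ∫ x, partialDeriv i φ x • G (moll n f₁ x)) atTop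
      (𝓝 (∫ x, partialDeriv i φ x • G (f x))) := by
    rw [tendsto_iff_norm_sub_tendsto_zero]
    refine squeeze_zero (fun _ => norm_nonneg _) (fun n => ?_)
      (by simpa using t1.const_mul (B' * C))
    rw [← integral_sub (iLn n) iL, ← integral_const_mul]
    refine norm_integral_le_of_norm_le (((integrable_moll if₁ n).sub if₁).norm.const_mul _)
      (Eventually.of_forall fun x => ?_)
    by_cases hx : x ∈ tsupport φ
    · rw [← smul_sub, norm_smul, mul_assoc, ← hf₁ x hx]
      exact mul_le_mul (hB' x) (hlip _ _) (norm_nonneg _) hB'0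
    · have : partialDeriv i φ x = 0 :=
        image_eq_zero_of_notMem_tsupport fun h => hx (tsupport_fderiv_apply_subset ℝ _ h)
      simp only [this, zero_smul, sub_zero, norm_zero]
      positivity
  have limR1 : Tendsto (fun n => ∫ x, φ x • fderiv ℝ G (moll n f₁ x) (g₁ x)) atTop
      (𝓝 (∫ x, φ x • fderiv ℝ G (f x) (g x))) := by
    refine tendsto_integral_of_dominated_convergence (fun x => B * (C * ‖g₁ x‖)) (fun n => ?_)
      ((ig₁.norm.const_mul C).const_mul B) (fun n => Eventually.of_forall fun x => ?_) ?_
    · exact hφ.continuous.aestronglyMeasurable.smul (happ.comp_aestronglyMeasurable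
        ((sm n).continuous.aestronglyMeasurable.prodMk ig₁.1))
    · rw [norm_smul]
      refine mul_le_mul (hB x) ?_ (norm_nonneg _) hB0
      exact (ContinuousLinearMap.le_opNorm _ _).trans
        (mul_le_mul_of_nonneg_right (hC _) (norm_nonneg _))
    · filter_upwards [ae_tendsto_moll if₁.locallyIntegrable] with x hx
      by_cases hxs : x ∈ tsupport φ
      · rw [← hf₁ x hxs, ← hg₁ x hxs]
        exact ((happ.tendsto (f₁ x, g₁ x)).comp (hx.prodMk_nhds tendsto_const_nhds)).const_smul _
      · simp [image_eq_zero_of_notMem_tsupport hxs]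
  have iR1 (n : ℕ) : Integrable (fun x => φ x • fderiv ℝ G (moll n f₁ x) (g₁ x)) volume := by
    refine Integrable.mono' ((ig₁.norm.const_mul C).const_mul B)
      (hφ.continuous.aestronglyMeasurable.smul (happ.comp_aestronglyMeasurable
        ((sm n).continuous.aestronglyMeasurable.prodMk ig₁.1))) (Eventually.of_forall fun x => ?_)
    rw [norm_smul]
    refine mul_le_mul (hB x) ?_ (norm_nonneg _) hB0
    exact (ContinuousLinearMap.le_opNorm _ _).trans
      (mul_le_mul_of_nonneg_right (hC _) (norm_nonneg _))
  have iRn (n : ℕ) : Integrable (fun x => φ x • fderiv ℝ G (moll n f₁ x) (moll n g₁ x)) volume :=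
    (hφ.continuous.smul (happ.comp ((sm n).continuous.prodMk
      (contDiff_moll ig₁.locallyIntegrable n).continuous))).integrable_of_hasCompactSupport
        hφ.hasCompactSupport.smul_right
  -- The right side has two varying factors. Replacing the mollified `g₁` by `g₁` costs an L¹
  -- distance times the bound on the derivative of `G`; what remains is `limR1`, where dominated
  -- convergence applies.
  have limR2 : Tendsto (fun n => (∫ x, φ x • fderiv ℝ G (moll n f₁ x) (moll n g₁ x)) -
      ∫ x, φ x • fderiv ℝ G (moll n f₁ x) (g₁ x)) atTop (𝓝 0) := by
    refine squeeze_zero_norm (fun n => ?_) (by simpa using t2.const_mul (B * C))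
    rw [← integral_sub (iRn n) (iR1 n), ← integral_const_mul]
    refine norm_integral_le_of_norm_le (((integrable_moll ig₁ n).sub ig₁).norm.const_mul _)
      (Eventually.of_forall fun x => ?_)
    rw [← smul_sub, ← map_sub, norm_smul, mul_assoc]
    refine mul_le_mul (hB x) ?_ (norm_nonneg _) hB0
    exact (ContinuousLinearMap.le_opNorm _ _).trans
      (mul_le_mul_of_nonneg_right (hC _) (norm_nonneg _))
  refine tendsto_nhds_unique limL ?_
  simp only [step]
  simpa using (limR2.add limR1).neg

end ChainRule

end

end LLB

open MeasureTheory Filter Topology Set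
open scoped ContDiff
set_option linter.unusedSectionVars false

namespace LLB

/-! ### Product rule for weak derivatives. -/

section ProductRule

variable {d : ℕ} {D : Set (Sp d)} {i : Fin d}

/-- A smooth bounded truncation of the identity at height `k`. -/
lemma hasDerivAt_mul_sin_div {k : ℝ} (hk : k ≠ 0) (x : ℝ) :
    HasDerivAt (fun y => k * Real.sin (y / k)) (Real.cos (x / k)) x := by
  have := ((Real.hasDerivAt_sin (x / k)).comp x ((hasDerivAt_id x).div_const k)).const_mul k
  rwa [show k * (Real.cos (x / k) * (1 / k)) = Real.cos (x / k) by field_simp] at this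

lemma abs_mul_sin_div_le {k : ℝ} (hk : 0 < k) (x : ℝ) : |k * Real.sin (x / k)| ≤ |x| := by
  have := Real.abs_sin_le_abs (x := x / k)
  rw [abs_mul, abs_of_pos hk]
  calc k * |Real.sin (x / k)| ≤ k * |x / k| := by gcongr
    _ = |x| := by rw [abs_div, abs_of_pos hk]; field_simp

lemma abs_mul_sin_div_le' {k : ℝ} (hk : 0 < k) (x : ℝ) : |k * Real.sin (x / k)| ≤ k := by
  rw [abs_mul, abs_of_pos hk]
  exact mul_le_of_le_one_right hk.le (Real.abs_sin_le_one _)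

lemma tendsto_mul_sin_div (x : ℝ) :
    Tendsto (fun n : ℕ => ((n : ℝ) + 1) * Real.sin (x / (n + 1))) atTop (𝓝 x) := by
  have h1 : Tendsto (fun n : ℕ => x / ((n : ℝ) + 1)) atTop (𝓝 0) :=
    tendsto_const_nhds.div_atTop (tendsto_natCast_atTop_atTop.atTop_add tendsto_const_nhds)
  have h2 := (Real.continuous_sinc.tendsto 0).comp h1
  rw [Real.sinc_zero] at h2
  have h3 := h2.const_mul x
  rw [mul_one] at h3
  refine h3.congr fun n => ?_
  by_cases hx : x = 0
  · simp [hx]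
  have hn : (n : ℝ) + 1 ≠ 0 := by positivity
  simp only [Function.comp]
  rw [Real.sinc_of_ne_zero (by positivity)]
  field_simp

lemma tendsto_cos_div (x : ℝ) :
    Tendsto (fun n : ℕ => Real.cos (x / ((n : ℝ) + 1))) atTop (𝓝 1) := by
  have h1 : Tendsto (fun n : ℕ => x / ((n : ℝ) + 1)) atTop (𝓝 0) :=
    tendsto_const_nhds.div_atTop (tendsto_natCast_atTop_atTop.atTop_add tendsto_const_nhds)
  simpa [Function.comp_def] using (Real.continuous_cos.tendsto 0).comp h1

/-- The product rule for bounded truncations. -/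
lemma HasWeakDeriv.mul_truncated (hD : IsOpen D) {f f' g g' : Sp d → ℝ}
    (hf : HasWeakDeriv D i f f') (hg : HasWeakDeriv D i g g') {k : ℝ} (hk : 0 < k) :
    HasWeakDeriv D i (fun x => (k * Real.sin (f x / k)) * (k * Real.sin (g x / k)))
      (fun x => Real.cos (f x / k) * f' x * (k * Real.sin (g x / k))
        + (k * Real.sin (f x / k)) * (Real.cos (g x / k) * g' x)) := by
  -- Multiplication has unbounded derivative, so the chain rule is applied to the product of the
  -- truncations k sin(·/k), whose gradient is bounded by 2k.
  set G : ℝ × ℝ → ℝ := fun p => (k * Real.sin (p.1 / k)) * (k * Real.sin (p.2 / k)) with hG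
  have hd : ∀ p : ℝ × ℝ, HasFDerivAt G
      ((k * Real.sin (p.1 / k)) • (Real.cos (p.2 / k) • ContinuousLinearMap.snd ℝ ℝ ℝ) +
       (k * Real.sin (p.2 / k)) • (Real.cos (p.1 / k) • ContinuousLinearMap.fst ℝ ℝ ℝ)) p :=
    fun p => ((hasDerivAt_mul_sin_div hk.ne' p.1).comp_hasFDerivAt p hasFDerivAt_fst).mul
      ((hasDerivAt_mul_sin_div hk.ne' p.2).comp_hasFDerivAt p hasFDerivAt_snd)
  have hc : ContDiff ℝ 1 G :=
    (contDiff_const.mul (Real.contDiff_sin.comp (contDiff_fst.div_const k))).mul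
      (contDiff_const.mul (Real.contDiff_sin.comp (contDiff_snd.div_const k)))
  have hb : ∀ p, ‖fderiv ℝ G p‖ ≤ k + k := fun p => by
    rw [(hd p).fderiv]
    refine (norm_add_le _ _).trans (add_le_add ?_ ?_)
    · rw [norm_smul, norm_smul]
      calc _ ≤ k * (1 * 1) := mul_le_mul (abs_mul_sin_div_le' hk _) (mul_le_mul
            (Real.abs_cos_le_one _) (ContinuousLinearMap.norm_snd_le ℝ ℝ ℝ) (norm_nonneg _)
              zero_le_one) (by positivity) hk.le
        _ = k := by ring
    · rw [norm_smul, norm_smul]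
      calc _ ≤ k * (1 * 1) := mul_le_mul (abs_mul_sin_div_le' hk _) (mul_le_mul
            (Real.abs_cos_le_one _) (ContinuousLinearMap.norm_fst_le ℝ ℝ ℝ) (norm_nonneg _)
              zero_le_one) (by positivity) hk.le
        _ = k := by ring
  convert (hf.prodMk hg).comp hD hc hb using 2 with x
  rw [(hd _).fderiv]
  simp
  ring

/-- The product rule for weak derivatives. -/
lemma HasWeakDeriv.mul (hD : IsOpen D) {f f' g g' : Sp d → ℝ}
    (hf : HasWeakDeriv D i f f') (hg : HasWeakDeriv D i g g')
    (h1 : LocallyIntegrableOn (fun x => f x * g x) D volume)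
    (h2 : LocallyIntegrableOn (fun x => f' x * g x) D volume)
    (h3 : LocallyIntegrableOn (fun x => f x * g' x) D volume) :
    HasWeakDeriv D i (fun x => f x * g x) (fun x => f' x * g x + f x * g' x) := by
  -- As k = n + 1 grows, the truncations converge to the identity and their derivatives to one. They
  -- never exceed |s| and one in modulus, so the three local integrability hypotheses supply the
  -- dominating functions.
  have H (n : ℕ) := hf.mul_truncated hD hg (k := (n : ℝ) + 1) (by positivity)
  refine ⟨h1, h2.add h3, fun φ hφ => ?_⟩
  have hpos (n : ℕ) : (0 : ℝ) < n + 1 := by positivity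
  have L1 : Tendsto (fun n : ℕ => ∫ x in D, partialDeriv i φ x •
      ((((n : ℝ) + 1) * Real.sin (f x / (n + 1))) * (((n : ℝ) + 1) * Real.sin (g x / (n + 1)))))
      atTop (𝓝 (∫ x in D, partialDeriv i φ x • (f x * g x))) := by
    refine tendsto_integral_of_dominated_convergence
      (fun x => ‖partialDeriv i φ x • (f x * g x)‖) (fun n => ?_)
      (((hφ.partialDeriv i).integrable_smul h1).restrict).norm
      (fun n => Eventually.of_forall fun x => ?_) (Eventually.of_forall fun x => ?_)
    · exact (((hφ.partialDeriv i).integrable_smul (H n).1).restrict).1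
    · have ha := abs_mul_sin_div_le (hpos n) (f x)
      have hb := abs_mul_sin_div_le (hpos n) (g x)
      generalize ((n : ℝ) + 1) * Real.sin (f x / (n + 1)) = a at ha ⊢
      generalize ((n : ℝ) + 1) * Real.sin (g x / (n + 1)) = b at hb ⊢
      rw [norm_smul, norm_smul, Real.norm_eq_abs (a * b), Real.norm_eq_abs (f x * g x), abs_mul,
        abs_mul]
      gcongr
    · exact ((tendsto_mul_sin_div _).mul (tendsto_mul_sin_div _)).const_smul _
  have L2 : Tendsto (fun n : ℕ => ∫ x in D, φ x •
      (Real.cos (f x / (n + 1)) * f' x * (((n : ℝ) + 1) * Real.sin (g x / (n + 1)))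
        + (((n : ℝ) + 1) * Real.sin (f x / (n + 1))) * (Real.cos (g x / (n + 1)) * g' x)))
      atTop (𝓝 (∫ x in D, φ x • (f' x * g x + f x * g' x))) := by
    refine tendsto_integral_of_dominated_convergence
      (fun x => ‖φ x • (f' x * g x)‖ + ‖φ x • (f x * g' x)‖) (fun n => ?_)
      ((hφ.integrable_smul h2).restrict.norm.add (hφ.integrable_smul h3).restrict.norm)
      (fun n => Eventually.of_forall fun x => ?_) (Eventually.of_forall fun x => ?_)
    · exact ((hφ.integrable_smul (H n).2).restrict).1
    · have ha := abs_mul_sin_div_le (hpos n) (f x)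
      have hb := abs_mul_sin_div_le (hpos n) (g x)
      have hc := Real.abs_cos_le_one (f x / (n + 1))
      have he := Real.abs_cos_le_one (g x / (n + 1))
      generalize ((n : ℝ) + 1) * Real.sin (f x / (n + 1)) = a at ha ⊢
      generalize ((n : ℝ) + 1) * Real.sin (g x / (n + 1)) = b at hb ⊢
      generalize Real.cos (f x / (n + 1)) = p at hc ⊢
      generalize Real.cos (g x / (n + 1)) = q at he ⊢
      rw [norm_smul, norm_smul, norm_smul, ← mul_add]
      refine mul_le_mul_of_nonneg_left ((norm_add_le _ _).trans (add_le_add ?_ ?_)) (norm_nonneg _)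
      · rw [Real.norm_eq_abs, Real.norm_eq_abs, abs_mul, abs_mul, abs_mul]
        calc |p| * |f' x| * |b| ≤ 1 * |f' x| * |g x| := by gcongr
          _ = _ := by ring
      · rw [Real.norm_eq_abs, Real.norm_eq_abs, abs_mul, abs_mul, abs_mul]
        calc |a| * (|q| * |g' x|) ≤ |f x| * (1 * |g' x|) := by gcongr
          _ = _ := by ring
    · have := ((((tendsto_cos_div (f x)).mul_const (f' x)).mul (tendsto_mul_sin_div (g x))).add
        ((tendsto_mul_sin_div (f x)).mul ((tendsto_cos_div (g x)).mul_const (g' x)))).const_smul (φ x)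
      simpa using this
  refine tendsto_nhds_unique L1 ?_
  simp only [fun n => (H n).3 φ hφ]
  exact L2.neg

/-- The product rule for the inner product of square integrable functions. -/
lemma HasWeakDeriv.inner (hD : IsOpen D) {f f' g g' : Sp d → V3}
    (hf : HasWeakDeriv D i f f') (hg : HasWeakDeriv D i g g')
    (mf : MemLp f 2 (volume.restrict D)) (mf' : MemLp f' 2 (volume.restrict D))
    (mg : MemLp g 2 (volume.restrict D)) (mg' : MemLp g' 2 (volume.restrict D)) :
    HasWeakDeriv D i (fun x => inner ℝ (f x) (g x))
      (fun x => inner ℝ (f' x) (g x) + inner ℝ (f x) (g' x)) := by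
  have mc {h : Sp d → V3} (mh : MemLp h 2 (volume.restrict D)) (j : Fin 3) :
      MemLp (fun x => h x j) 2 (volume.restrict D) :=
    (EuclideanSpace.proj (𝕜 := ℝ) j : V3 →L[ℝ] ℝ).comp_memLp' mh
  have li {h k : Sp d → V3} (mh : MemLp h 2 (volume.restrict D))
      (mk : MemLp k 2 (volume.restrict D)) (j : Fin 3) :
      LocallyIntegrableOn (fun x => h x j * k x j) D volume :=
    (memLp_one_iff_integrable.2
      ((mc mh j).integrable_mul (mc mk j))).locallyIntegrableOn_of_restrict le_rfl
  have comp (j : Fin 3) : HasWeakDeriv D i (fun x => f x j * g x j)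
      (fun x => f' x j * g x j + f x j * g' x j) :=
    (hf.clm_comp (EuclideanSpace.proj (𝕜 := ℝ) j : V3 →L[ℝ] ℝ)).mul hD
      (hg.clm_comp (EuclideanSpace.proj (𝕜 := ℝ) j : V3 →L[ℝ] ℝ))
      (li mf mg j) (li mf' mg j) (li mf mg' j)
  convert ((comp 0).add (comp 1)).add (comp 2) using 2 with x x
  · simp [PiLp.inner_apply, Fin.sum_univ_three, mul_comm]
  · simp [PiLp.inner_apply, Fin.sum_univ_three]
    ring

end ProductRule

end LLB

open MeasureTheory Filter Topology Set
open scoped ContDiff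
set_option linter.unusedSectionVars false

namespace LLB

noncomputable section

/-! ### Cutoffs built from a defining function. -/

section DefiningFunction

variable {d : ℕ} {D : Set (Sp d)} {ψ : Sp d → ℝ}

lemma IsDefiningFunction.isOpen (hψ : IsDefiningFunction D ψ) : IsOpen D := by
  rw [hψ.eq_sublevel]
  exact isOpen_lt hψ.contDiff.continuous continuous_const

lemma IsDefiningFunction.neg (hψ : IsDefiningFunction D ψ) {x : Sp d} (hx : x ∈ D) : ψ x < 0 := by
  rw [hψ.eq_sublevel] at hx
  exact hx

lemma contDiff_partialDeriv {f : Sp d → ℝ} (hf : ContDiff ℝ ∞ f) (i : Fin d) :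
    ContDiff ℝ ∞ (partialDeriv i f) :=
  (hf.fderiv_right (m := ∞) (by simp)).clm_apply contDiff_const

lemma exists_bound_of_isBounded (hb : Bornology.IsBounded D) {f : Sp d → ℝ} (hf : Continuous f) :
    ∃ B : ℝ, 0 ≤ B ∧ ∀ x ∈ D, |f x| ≤ B := by
  obtain ⟨B, hB⟩ := hb.isCompact_closure.exists_bound_of_continuousOn hf.continuousOn
  exact ⟨max B 0, le_max_right _ _, fun x hx => (hB x (subset_closure hx)).trans (le_max_left _ _)⟩

lemma fderiv_eq_zero_of_partialDeriv {f : Sp d → ℝ} {x : Sp d}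
    (h : ∀ i, partialDeriv i f x = 0) : fderiv ℝ f x = 0 := by
  ext v
  have hv : v = ∑ i, v i • EuclideanSpace.single i (1 : ℝ) := by
    ext j
    simp [Finset.sum_apply, Pi.single_apply]
  rw [hv, map_sum]
  simp only [map_smul]
  exact Finset.sum_eq_zero fun i _ => by
    rw [show fderiv ℝ f x (EuclideanSpace.single i 1) = 0 from h i, smul_zero]

/-- `|∇ψ|² + ψ²` is bounded below on `D`. -/
lemma IsDefiningFunction.exists_lower_bound (hψ : IsDefiningFunction D ψ)
    (hb : Bornology.IsBounded D) :
    ∃ c : ℝ, 0 < c ∧ ∀ x ∈ D, c ≤ (∑ i, partialDeriv i ψ x ^ 2) + ψ x ^ 2 := by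
  rcases (closure D).eq_empty_or_nonempty with he | hne
  · exact ⟨1, one_pos, fun x hx => absurd (subset_closure hx) (by simp [he])⟩
  have hcont : Continuous fun x => (∑ i, partialDeriv i ψ x ^ 2) + ψ x ^ 2 :=
    (continuous_finsetSum _ fun i _ =>
      ((contDiff_partialDeriv hψ.contDiff i).continuous.pow 2)).add (hψ.contDiff.continuous.pow 2)
  obtain ⟨x₀, hx₀, hmin⟩ := hb.isCompact_closure.exists_isMinOn hne hcont.continuousOn
  refine ⟨_, ?_, fun x hx => hmin (subset_closure hx)⟩
  have hs : 0 ≤ ∑ i, partialDeriv i ψ x₀ ^ 2 := Finset.sum_nonneg fun i _ => sq_nonneg _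
  -- The minimum over the compact closure is positive: at a point of `D` because ψ < 0, at a
  -- boundary point because ∇ψ ≠ 0.
  by_cases hx : x₀ ∈ D
  · have := hψ.neg hx
    have : 0 < ψ x₀ ^ 2 := sq_pos_of_neg this
    linarith
  · have hfr : x₀ ∈ frontier D := by
      rw [hψ.isOpen.frontier_eq]; exact ⟨hx₀, hx⟩
    have hpos : 0 < ∑ i, partialDeriv i ψ x₀ ^ 2 := by
      refine lt_of_le_of_ne hs fun h => hψ.fderiv_ne_zero x₀ hfr ?_
      refine fderiv_eq_zero_of_partialDeriv fun i => ?_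
      have := (Finset.sum_eq_zero_iff_of_nonneg fun i _ => sq_nonneg _).1 h.symm i
        (Finset.mem_univ i)
      exact pow_eq_zero_iff two_ne_zero |>.1 this
    have := sq_nonneg (ψ x₀)
    linarith

/-- A smooth step from `0` on `(-∞, 1]` to `1` on `[2, ∞)`. -/
def step (s : ℝ) : ℝ := Real.smoothTransition (s - 1)

lemma contDiff_step : ContDiff ℝ ∞ step :=
  Real.smoothTransition.contDiff.comp (contDiff_id.sub contDiff_const)

lemma deriv_step_nonneg (s : ℝ) : 0 ≤ deriv step s := by
  have : Monotone step := fun a b h => Real.smoothTransition.monotone (by linarith)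
  exact this.deriv_nonneg

lemma deriv_step_eq_zero {s : ℝ} (hs : s < 1 ∨ 2 < s) : deriv step s = 0 := by
  rcases hs with hs | hs
  · have : step =ᶠ[𝓝 s] fun _ => 0 := by
      filter_upwards [gt_mem_nhds hs] with y hy
      exact Real.smoothTransition.zero_of_nonpos (by linarith)
    rw [this.deriv_eq]; simp
  · have : step =ᶠ[𝓝 s] fun _ => 1 := by
      filter_upwards [lt_mem_nhds hs] with y hy
      exact Real.smoothTransition.one_of_one_le (by linarith)
    rw [this.deriv_eq]; simp

lemma continuous_deriv_step : Continuous (deriv step) :=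
  contDiff_step.continuous_deriv (by simp)

lemma exists_bound_mul_deriv_step : ∃ B : ℝ, 0 ≤ B ∧ ∀ s, |s * deriv step s| ≤ B := by
  have hc : HasCompactSupport fun s => s * deriv step s := by
    refine HasCompactSupport.intro (isCompact_Icc (a := (1 : ℝ)) (b := 2)) fun s hs => ?_
    rw [deriv_step_eq_zero, mul_zero]
    by_contra! h
    exact hs ⟨h.1, h.2⟩
  obtain ⟨B, hB⟩ := hc.exists_bound_of_continuous (continuous_id.mul continuous_deriv_step)
  exact ⟨B, (norm_nonneg _).trans (hB 0), hB⟩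

/-- Cutoff functions exhausting `D`. -/
def cutoff (ψ : Sp d → ℝ) (n : ℕ) (x : Sp d) : ℝ := step (-((n + 1) * ψ x))

/-- The density of the boundary layer of the cutoff functions: `∇ cutoff = - layer • ∇ψ`. -/
def layer (ψ : Sp d → ℝ) (n : ℕ) (x : Sp d) : ℝ := (n + 1) * deriv step (-((n + 1) * ψ x))

lemma cutoff_nonneg (n : ℕ) (x : Sp d) : 0 ≤ cutoff ψ n x := Real.smoothTransition.nonneg _

lemma cutoff_le_one (n : ℕ) (x : Sp d) : cutoff ψ n x ≤ 1 := Real.smoothTransition.le_one _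

lemma layer_nonneg (n : ℕ) (x : Sp d) : 0 ≤ layer ψ n x :=
  mul_nonneg (by positivity) (deriv_step_nonneg _)

lemma IsDefiningFunction.isTestFunction_cutoff (hψ : IsDefiningFunction D ψ)
    (hb : Bornology.IsBounded D) (n : ℕ) : IsTestFunction D (cutoff ψ n) := by
  have hcl : IsClosed {x | 1 ≤ -((n + 1) * ψ x)} :=
    isClosed_le continuous_const (continuous_const.mul hψ.contDiff.continuous).neg
  have hsub : {x | 1 ≤ -(((n : ℝ) + 1) * ψ x)} ⊆ D := by
    intro x hx
    rw [hψ.eq_sublevel]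
    by_contra h
    have h1 : 0 ≤ ψ x := not_lt.1 h
    have h2 : (1 : ℝ) ≤ -((n + 1) * ψ x) := hx
    have h3 : 0 ≤ ((n : ℝ) + 1) * ψ x := by positivity
    linarith
  have hts : tsupport (cutoff ψ n) ⊆ {x | 1 ≤ -(((n : ℝ) + 1) * ψ x)} := by
    refine closure_minimal (fun x hx => ?_) hcl
    by_contra h
    refine hx (Real.smoothTransition.zero_of_nonpos ?_)
    simp only [mem_ofPred_eq, not_le] at h
    linarith
  refine ⟨contDiff_step.comp (contDiff_const.mul hψ.contDiff).neg, ?_, hts.trans hsub⟩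
  exact hb.isCompact_closure.of_isClosed_subset (isClosed_tsupport _)
    ((hts.trans hsub).trans subset_closure)

lemma tendsto_cutoff {x : Sp d} (hx : ψ x < 0) :
    ∀ᶠ n in atTop, cutoff ψ n x = 1 ∧ layer ψ n x = 0 := by
  have h : Tendsto (fun n : ℕ => ((n : ℝ) + 1) * (-ψ x)) atTop atTop :=
    (tendsto_natCast_atTop_atTop.atTop_add tendsto_const_nhds).atTop_mul_const (by linarith)
  filter_upwards [h.eventually_gt_atTop 2] with n hn
  have hn' : 2 < -(((n : ℝ) + 1) * ψ x) := by linarith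
  exact ⟨Real.smoothTransition.one_of_one_le (by linarith), by
    rw [layer, deriv_step_eq_zero (Or.inr hn'), mul_zero]⟩

lemma partialDeriv_cutoff (hψ : ContDiff ℝ ∞ ψ) (n : ℕ) (i : Fin d) (x : Sp d) :
    partialDeriv i (cutoff ψ n) x = - (layer ψ n x * partialDeriv i ψ x) := by
  have h1 : HasFDerivAt (fun x => -((n + 1) * ψ x)) (-(((n : ℝ) + 1) • fderiv ℝ ψ x)) x :=
    (((hψ.differentiable (by simp)) x).hasFDerivAt.const_mul _).neg
  have h2 := ((contDiff_step.differentiable (by simp)) (-((n + 1) * ψ x))).hasDerivAt.comp_hasFDerivAt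
    x h1
  rw [partialDeriv, show cutoff ψ n = step ∘ fun x => -((n + 1) * ψ x) from rfl, h2.fderiv]
  simp [layer, partialDeriv]
  ring

lemma layer_continuous (hψ : ContDiff ℝ ∞ ψ) (n : ℕ) : Continuous (layer ψ n) :=
  continuous_const.mul (continuous_deriv_step.comp (continuous_const.mul hψ.continuous).neg)

/-- The layer has height of order n but lives where |ψ| is of order 1/n. After scaling, the product
becomes |s · `deriv step s`|, which does not depend on n. Thus ∇`cutoff` is bounded by a constant
times |∇ψ|/|ψ|, the weight that Hardy's inequality controls. -/
lemma exists_layer_mul_le (ψ : Sp d → ℝ) :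
    ∃ B : ℝ, 0 ≤ B ∧ ∀ (n : ℕ) (x : Sp d), layer ψ n x * |ψ x| ≤ B := by
  obtain ⟨B, hB0, hB⟩ := exists_bound_mul_deriv_step
  refine ⟨B, hB0, fun n x => le_trans (le_of_eq ?_) (hB (-((n + 1) * ψ x)))⟩
  rw [abs_mul, abs_neg, abs_mul, abs_of_nonneg (deriv_step_nonneg _),
    abs_of_nonneg (by positivity : (0 : ℝ) ≤ n + 1), layer]
  ring

end DefiningFunction

/-! ### Square integrable functions. -/

section SquareIntegrable

lemma integrable_norm_sq {α E : Type*} [MeasurableSpace α] {μ : Measure α} [NormedAddCommGroup E]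
    {f : α → E} (hf : MemLp f 2 μ) : Integrable (fun x => ‖f x‖ ^ 2) μ :=
  hf.integrable_norm_pow two_ne_zero

lemma eLpNorm_two_sq {α E : Type*} [MeasurableSpace α] {μ : Measure α} [NormedAddCommGroup E]
    {f : α → E} (hf : MemLp f 2 μ) :
    eLpNorm f 2 μ ^ 2 = ENNReal.ofReal (∫ x, ‖f x‖ ^ 2 ∂μ) := by
  rw [hf.eLpNorm_eq_integral_rpow_norm two_ne_zero ENNReal.ofNat_ne_top,
    ← ENNReal.ofReal_pow (by positivity)]
  congr 1
  simp only [ENNReal.toReal_ofNat, Real.rpow_ofNat]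
  rw [← Real.rpow_natCast, ← Real.rpow_mul (integral_nonneg fun _ => by positivity)]
  norm_num

lemma integrable_inner {α : Type*} [MeasurableSpace α] {μ : Measure α} {f g : α → V3}
    (hf : MemLp f 2 μ) (hg : MemLp g 2 μ) : Integrable (fun x => inner ℝ (f x) (g x)) μ := by
  refine Integrable.mono' (g := fun x => ‖f x‖ ^ 2 + ‖g x‖ ^ 2)
    ((integrable_norm_sq hf).add (integrable_norm_sq hg)) (hf.1.inner hg.1)
    (Eventually.of_forall fun x => ?_)
  refine (norm_inner_le_norm _ _).trans ?_
  nlinarith [sq_nonneg (‖f x‖ - ‖g x‖), sq_nonneg (‖f x‖ + ‖g x‖)]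

lemma integrable_norm_mul_norm {α E E' : Type*} [MeasurableSpace α] {μ : Measure α}
    [NormedAddCommGroup E] [NormedAddCommGroup E'] {f : α → E} {g : α → E'}
    (hf : MemLp f 2 μ) (hg : MemLp g 2 μ) : Integrable (fun x => ‖f x‖ * ‖g x‖) μ :=
  hf.norm.integrable_mul hg.norm

end SquareIntegrable

end

end LLB

open MeasureTheory Filter Topology Set
open scoped ContDiff
set_option linter.unusedSectionVars false

namespace LLB

noncomputable section

/-! ### Hardy's inequality and Green's formula. -/

section Hardy

variable {d : ℕ} {D : Set (Sp d)} {ψ : Sp d → ℝ}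

/-- Meant for q = 1/ψ, which is smooth only inside `D`. Off the support of `φ` the product vanishes
locally, so the singularity is never met. -/
lemma IsTestFunction.mul_contDiffOn {φ q : Sp d → ℝ} (hφ : IsTestFunction D φ) (hD : IsOpen D)
    (hq : ContDiffOn ℝ ∞ q D) : IsTestFunction D (fun x => φ x * q x) where
  contDiff := contDiff_iff_contDiffAt.2 fun x => by
    by_cases hx : x ∈ tsupport φ
    · exact hφ.contDiff.contDiffAt.mul
        (hq.contDiffAt (hD.mem_nhds (hφ.tsupport_subset hx)))
    · refine (contDiffAt_const (c := (0 : ℝ))).congr_of_eventuallyEq ?_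
      filter_upwards [(isClosed_tsupport φ).isOpen_compl.mem_nhds hx] with y hy
      rw [image_eq_zero_of_notMem_tsupport hy, zero_mul]
  hasCompactSupport := hφ.hasCompactSupport.mul_right
  tsupport_subset := (tsupport_mul_subset_left).trans hφ.tsupport_subset

lemma IsTestFunction.norm_sq {φ : Sp d → V3} (hφ : IsTestFunction D φ) :
    IsTestFunction D (fun x => ‖φ x‖ ^ 2) where
  contDiff := hφ.contDiff.norm_sq ℝ
  hasCompactSupport := hφ.hasCompactSupport.comp_left (g := fun y => ‖y‖ ^ 2) (by simp)
  tsupport_subset := (closure_mono fun x (hx : ‖φ x‖ ^ 2 ≠ 0) (h : φ x = 0) => hx (by simp [h])).trans hφ.tsupport_subset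

lemma IsTestFunction.integrable {φ : Sp d → ℝ} (hφ : IsTestFunction D φ) :
    Integrable φ (volume.restrict D) :=
  (hφ.continuous.integrable_of_hasCompactSupport hφ.hasCompactSupport).restrict

lemma IsTestFunction.memLp {φ : Sp d → V3} (hφ : IsTestFunction D φ) :
    MemLp φ 2 (volume.restrict D) :=
  (hφ.continuous.memLp_of_hasCompactSupport hφ.hasCompactSupport).restrict D

/-- Integration by parts of a test function against a smooth function. -/
lemma IsTestFunction.integral_mul_partialDeriv {φ q : Sp d → ℝ} (hφ : IsTestFunction D φ)
    (hq : ContDiff ℝ ∞ q) (i : Fin d) :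
    ∫ x in D, (φ x * LLB.partialDeriv i q x + LLB.partialDeriv i φ x * q x) = 0 := by
  have h1 := hφ.mul (contDiff_partialDeriv hq i)
  have h2 := (hφ.partialDeriv i).mul hq
  rw [integral_add h1.integrable h2.integrable]
  have e1 := h1.setIntegral_smul (fun _ => (1 : ℝ))
  have e2 := h2.setIntegral_smul (fun _ => (1 : ℝ))
  simp only [smul_eq_mul, mul_one] at e1 e2
  rw [e1, e2]
  have := integral_mul_fderiv_eq_neg_fderiv_mul_of_integrable (μ := volume) (f := φ) (g := q)
    (v := EuclideanSpace.single i (1 : ℝ))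
    (h2.continuous.integrable_of_hasCompactSupport h2.hasCompactSupport)
    (h1.continuous.integrable_of_hasCompactSupport h1.hasCompactSupport)
    ((hφ.mul hq).continuous.integrable_of_hasCompactSupport (hφ.mul hq).hasCompactSupport)
    (fun x _ => hφ.contDiff.differentiable (by simp) x)
    (fun x _ => hq.differentiable (by simp) x)
  simp only [LLB.partialDeriv]
  linarith

lemma partialDeriv_norm_sq_div {φ : Sp d → V3} (hφ : ContDiff ℝ ∞ φ) (hψ : ContDiff ℝ ∞ ψ)
    {x : Sp d} (hx : ψ x ≠ 0) (i : Fin d) :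
    partialDeriv i (fun y => ‖φ y‖ ^ 2 * (ψ y)⁻¹) x =
      2 * inner ℝ (φ x) (partialDeriv i φ x) * (ψ x)⁻¹
        - ‖φ x‖ ^ 2 * partialDeriv i ψ x * (ψ x)⁻¹ ^ 2 := by
  have h1 := ((hφ.differentiable (by simp)) x).hasFDerivAt.norm_sq
  have h2 := (hasDerivAt_inv hx).comp_hasFDerivAt x ((hψ.differentiable (by simp)) x).hasFDerivAt
  have h3 := h1.mul h2
  rw [partialDeriv, show (fun y => ‖φ y‖ ^ 2 * (ψ y)⁻¹) = fun y => ‖φ y‖ ^ 2 * (Inv.inv ∘ ψ) y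
    from rfl, HasFDerivAt.fderiv (f := fun y => ‖φ y‖ ^ 2 * (Inv.inv ∘ ψ) y) h3]
  simp [partialDeriv]
  ring

/-- Hardy's inequality for test functions. -/
lemma IsDefiningFunction.exists_hardy_test (hψ : IsDefiningFunction D ψ)
    (hb : Bornology.IsBounded D) :
    ∃ C : ℝ, 0 ≤ C ∧ ∀ φ : Sp d → V3, IsTestFunction D φ →
      ∫ x in D, ‖(ψ x)⁻¹ • φ x‖ ^ 2 ≤
        C * ((∫ x in D, ‖φ x‖ ^ 2) + ∑ i, ∫ x in D, ‖partialDeriv i φ x‖ ^ 2) := by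
  obtain ⟨c, hc, hlow⟩ := hψ.exists_lower_bound hb
  choose B1 hB10 hB1 using fun i => exists_bound_of_isBounded hb
    (contDiff_partialDeriv hψ.contDiff i).continuous
  choose B2 hB20 hB2 using fun i => exists_bound_of_isBounded hb
    (contDiff_partialDeriv (contDiff_partialDeriv hψ.contDiff i) i).continuous
  set b : ℝ := ∑ i, (B1 i + B2 i) with hbdef
  have hb1 : ∀ i, B1 i ≤ b := fun i =>
    (le_add_of_nonneg_right (hB20 i)).trans (Finset.single_le_sum (f := fun i => B1 i + B2 i)
      (fun j _ => add_nonneg (hB10 j) (hB20 j)) (Finset.mem_univ i))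
  have hb2 : ∀ i, B2 i ≤ b := fun i =>
    (le_add_of_nonneg_left (hB10 i)).trans (Finset.single_le_sum (f := fun i => B1 i + B2 i)
      (fun j _ => add_nonneg (hB10 j) (hB20 j)) (Finset.mem_univ i))
  have hb0 : 0 ≤ b := Finset.sum_nonneg fun j _ => add_nonneg (hB10 j) (hB20 j)
  -- a weight for Young's inequality
  set δ : ℝ := c / (4 * (d + 1)) with hδ
  have hδ0 : 0 < δ := by positivity
  set K : ℝ := 1 + d * (b ^ 2 / δ) with hK
  refine ⟨2 / c * (K + b ^ 2 / δ), by positivity, fun φ hφ => ?_⟩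
  have hinv : ContDiffOn ℝ ∞ (fun x => (ψ x)⁻¹) D :=
    hψ.contDiff.contDiffOn.inv fun x hx => (hψ.neg hx).ne
  have tr : IsTestFunction D (fun x => ‖φ x‖ ^ 2 * (ψ x)⁻¹) :=
    hφ.norm_sq.mul_contDiffOn hψ.isOpen hinv
  have ta : IsTestFunction D (fun x => ‖φ x‖ ^ 2 * (ψ x)⁻¹ ^ 2) :=
    hφ.norm_sq.mul_contDiffOn hψ.isOpen (hinv.pow 2)
  -- The divergence of |φ|² ψ⁻¹ ∇ψ integrates to zero. Expanded, it contains -|φ|²|∇ψ|²/ψ², the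
  -- quantity to be bounded; the other terms carry only one power of 1/ψ and yield to Young's
  -- inequality.
  have hzero : ∑ i, ∫ x in D, ((‖φ x‖ ^ 2 * (ψ x)⁻¹) * partialDeriv i (partialDeriv i ψ) x +
      partialDeriv i (fun y => ‖φ y‖ ^ 2 * (ψ y)⁻¹) x * partialDeriv i ψ x) = 0 :=
    Finset.sum_eq_zero fun i _ => tr.integral_mul_partialDeriv (contDiff_partialDeriv hψ.contDiff i) i
  have hint (i : Fin d) : Integrable (fun x => (‖φ x‖ ^ 2 * (ψ x)⁻¹) * partialDeriv i (partialDeriv i ψ) x +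
      partialDeriv i (fun y => ‖φ y‖ ^ 2 * (ψ y)⁻¹) x * partialDeriv i ψ x) (volume.restrict D) :=
    (tr.mul (contDiff_partialDeriv (contDiff_partialDeriv hψ.contDiff i) i)).integrable.add
      ((tr.partialDeriv i).mul (contDiff_partialDeriv hψ.contDiff i)).integrable
  have hN : Integrable (fun x => ‖φ x‖ ^ 2) (volume.restrict D) := hφ.norm_sq.integrable
  have hP (i : Fin d) : Integrable (fun x => ‖partialDeriv i φ x‖ ^ 2) (volume.restrict D) :=
    (hφ.partialDeriv i).norm_sq.integrable
  have e0 : ∀ x, ‖(ψ x)⁻¹ • φ x‖ ^ 2 = ‖φ x‖ ^ 2 * (ψ x)⁻¹ ^ 2 := fun x => by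
    rw [norm_smul, mul_pow, Real.norm_eq_abs, sq_abs, mul_comm]
  simp only [e0]
  have hpt : ∀ x ∈ D, c / 2 * (‖φ x‖ ^ 2 * (ψ x)⁻¹ ^ 2) ≤
      -(∑ i, ((‖φ x‖ ^ 2 * (ψ x)⁻¹) * partialDeriv i (partialDeriv i ψ) x +
        partialDeriv i (fun y => ‖φ y‖ ^ 2 * (ψ y)⁻¹) x * partialDeriv i ψ x)) +
      (K * ‖φ x‖ ^ 2 + b ^ 2 / δ * ∑ i, ‖partialDeriv i φ x‖ ^ 2) := by
    intro x hx
    have hψx : ψ x ≠ 0 := (hψ.neg hx).ne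
    set N := ‖φ x‖ with hNx
    set p := (ψ x)⁻¹ with hp
    have hpp : p ^ 2 * ψ x ^ 2 = 1 := by rw [hp]; field_simp
    have hN0 : 0 ≤ N := norm_nonneg _
    have hl := mul_le_mul_of_nonneg_left (hlow x hx) (show 0 ≤ N ^ 2 * p ^ 2 by positivity)
    have hterm : ∀ i, (N ^ 2 * p) * partialDeriv i (partialDeriv i ψ) x +
        partialDeriv i (fun y => ‖φ y‖ ^ 2 * (ψ y)⁻¹) x * partialDeriv i ψ x ≤
        -(N ^ 2 * p ^ 2 * partialDeriv i ψ x ^ 2) + 2 * δ * (N ^ 2 * p ^ 2) +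
        (b ^ 2 / δ * N ^ 2 + b ^ 2 / δ * ‖partialDeriv i φ x‖ ^ 2) := by
      intro i
      rw [partialDeriv_norm_sq_div hφ.contDiff hψ.contDiff hψx i]
      have y1 : (N ^ 2 * p) * partialDeriv i (partialDeriv i ψ) x ≤
          δ * (N ^ 2 * p ^ 2) + b ^ 2 / δ * N ^ 2 := by
        have h1 := (abs_le.1 ((hB2 i x hx).trans (hb2 i)))
        set t := partialDeriv i (partialDeriv i ψ) x
        have ht : t ^ 2 ≤ b ^ 2 := sq_le_sq' h1.1 h1.2
        have h2 : p * t ≤ δ * p ^ 2 + b ^ 2 / δ := by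
          have h3 : p * t ≤ δ * p ^ 2 + t ^ 2 / δ := by
            rw [← sub_nonneg]
            have : δ * p ^ 2 + t ^ 2 / δ - p * t =
              ((δ * p - t / 2) ^ 2 + 3 / 4 * t ^ 2) / δ := by field_simp; ring
            rw [this]; positivity
          exact h3.trans (by gcongr)
        nlinarith [sq_nonneg N]
      have y2 : 2 * inner ℝ (φ x) (partialDeriv i φ x) * p * partialDeriv i ψ x ≤
          δ * (N ^ 2 * p ^ 2) + b ^ 2 / δ * ‖partialDeriv i φ x‖ ^ 2 := by
        have h1 := (abs_le.1 ((hB1 i x hx).trans (hb1 i)))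
        set t := partialDeriv i ψ x
        have ht : t ^ 2 ≤ b ^ 2 := sq_le_sq' h1.1 h1.2
        set q := ‖partialDeriv i φ x‖
        have h2 : inner ℝ (φ x) (partialDeriv i φ x) * (p * t) ≤ N * q * |p * t| := by
          refine (le_abs_self _).trans ?_
          rw [abs_mul]
          exact mul_le_mul_of_nonneg_right (abs_real_inner_le_norm _ _) (abs_nonneg _)
        have h3 : 2 * (N * q * |p * t|) ≤ δ * (N ^ 2 * p ^ 2) + t ^ 2 / δ * q ^ 2 := by
          rw [← sub_nonneg, abs_mul]
          have : δ * (N ^ 2 * p ^ 2) + t ^ 2 / δ * q ^ 2 - 2 * (N * q * (|p| * |t|)) =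
              (δ * N * |p| - |t| * q) ^ 2 / δ := by
            have e1 := sq_abs p
            have e2 := sq_abs t
            rw [← e1, ← e2]; field_simp; ring
          rw [this]; positivity
        have h4 : t ^ 2 / δ * q ^ 2 ≤ b ^ 2 / δ * q ^ 2 := by gcongr
        nlinarith
      nlinarith
    have hsum := Finset.sum_le_sum fun i (_ : i ∈ Finset.univ) => hterm i
    rw [Finset.sum_add_distrib (f := fun i => -(N ^ 2 * p ^ 2 * partialDeriv i ψ x ^ 2) +
        2 * δ * (N ^ 2 * p ^ 2)), Finset.sum_add_distrib (f := fun i => -(N ^ 2 * p ^ 2 *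
        partialDeriv i ψ x ^ 2)), Finset.sum_neg_distrib, ← Finset.mul_sum,
      Finset.sum_add_distrib (f := fun _ => b ^ 2 / δ * N ^ 2), Finset.sum_const, Finset.sum_const, ← Finset.mul_sum] at hsum
    simp only [Finset.card_univ, Fintype.card_fin, nsmul_eq_mul] at hsum
    -- The choice of `δ`: two Young errors for each of the d coordinates together absorb at most
    -- half of the coercive constant `c`.
    have hd : (d : ℝ) * (2 * δ * (N ^ 2 * p ^ 2)) ≤ c / 2 * (N ^ 2 * p ^ 2) := by
      have : (d : ℝ) * (2 * δ) ≤ c / 2 := by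
        rw [hδ]
        rw [show (d : ℝ) * (2 * (c / (4 * (d + 1)))) = c / 2 * (d / (d + 1)) by field_simp; norm_num]
        have : (d : ℝ) / (d + 1) ≤ 1 := by rw [div_le_one (by positivity)]; linarith
        nlinarith
      nlinarith [show 0 ≤ N ^ 2 * p ^ 2 by positivity]
    -- The ψ² part of the lower bound, multiplied by |φ|²/ψ², costs only |φ|²; this is the summand 1
    -- in `K`.
    have e3 : N ^ 2 * p ^ 2 * ((∑ i, partialDeriv i ψ x ^ 2) + ψ x ^ 2) =
        N ^ 2 * p ^ 2 * (∑ i, partialDeriv i ψ x ^ 2) + N ^ 2 := by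
      rw [mul_add, mul_assoc (N ^ 2) (p ^ 2) (ψ x ^ 2), hpp, mul_one]
    rw [e3] at hl
    rw [hK]
    nlinarith
  have j1 : Integrable (fun x => -∑ i, ((‖φ x‖ ^ 2 * (ψ x)⁻¹) * partialDeriv i (partialDeriv i ψ) x +
      partialDeriv i (fun y => ‖φ y‖ ^ 2 * (ψ y)⁻¹) x * partialDeriv i ψ x))
      (volume.restrict D) := (integrable_finsetSum _ fun i _ => hint i).fun_neg
  have j2 : Integrable (fun x => b ^ 2 / δ * ∑ i, ‖partialDeriv i φ x‖ ^ 2)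
      (volume.restrict D) := (integrable_finsetSum _ fun i _ => hP i).const_mul (b ^ 2 / δ)
  have j3 := (hN.const_mul K).fun_add j2
  have hI := setIntegral_mono_on (μ := volume) (ta.integrable.const_mul (c / 2))
    (j1.fun_add j3) hψ.isOpen.measurableSet hpt
  rw [integral_const_mul, integral_add j1 j3, integral_neg,
      integral_finsetSum _ fun i _ => hint i, hzero, neg_zero, zero_add,
      integral_add (hN.const_mul K) j2,
      integral_const_mul, integral_const_mul, integral_finsetSum _ fun i _ => hP i] at hI
  set A := ∫ x in D, ‖φ x‖ ^ 2
  set S := ∑ i, ∫ x in D, ‖partialDeriv i φ x‖ ^ 2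
  have hA : 0 ≤ A := integral_nonneg fun _ => by positivity
  have hS : 0 ≤ S := Finset.sum_nonneg fun _ _ => integral_nonneg fun _ => by positivity
  have hK0 : 0 ≤ K := by positivity
  have hbd : 0 ≤ b ^ 2 / δ := by positivity
  have : K * A + b ^ 2 / δ * S ≤ (K + b ^ 2 / δ) * (A + S) := by nlinarith [mul_nonneg hK0 hS, mul_nonneg hbd hA]
  rw [show 2 / c * (K + b ^ 2 / δ) * (A + S) = ((K + b ^ 2 / δ) * (A + S)) / (c / 2) by field_simp,
    le_div_iff₀ (by positivity)]
  linarith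

/-- Hardy's inequality: functions of `H¹₀` divided by the defining function are in `L²`. -/
lemma IsDefiningFunction.memLp_inv_smul (hψ : IsDefiningFunction D ψ)
    (hb : Bornology.IsBounded D) {g : Sp d → V3} (hg : MemH10 D g) :
    MemLp (fun x => (ψ x)⁻¹ • g x) 2 (volume.restrict D) := by
  obtain ⟨C, hC0, hC⟩ := hψ.exists_hardy_test hb
  obtain ⟨hg1, φ, hφ, hφg, hφd⟩ := hg
  have mg := hg1.memLp
  have hψm : AEStronglyMeasurable (fun x => (ψ x)⁻¹) (volume.restrict D) :=
    (hψ.contDiff.continuous.measurable.inv).aestronglyMeasurable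
  have htest (n : ℕ) : MemLp (fun x => (ψ x)⁻¹ • φ n x) 2 (volume.restrict D) := by
    have h1 := (((hφ n).norm_sq.mul_contDiffOn hψ.isOpen
      ((hψ.contDiff.contDiffOn.inv fun x hx => (hψ.neg hx).ne).pow 2)))
    refine (integrable_norm_rpow_iff (hψm.smul (hφ n).memLp.1) two_ne_zero
      ENNReal.ofNat_ne_top).1 ?_
    refine h1.integrable.congr (Eventually.of_forall fun x => ?_)
    simp [norm_smul, mul_pow, mul_comm]
  obtain ⟨s, hs, hae⟩ := (tendstoInMeasure_of_tendsto_eLpNorm (f := φ) (g := g) two_ne_zero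
    (fun n => (hφ n).memLp.1) mg.1 hφg).exists_seq_tendsto_ae
  have hbd : ∀ᶠ n in atTop, eLpNorm (fun x => (ψ x)⁻¹ • φ n x) 2 (volume.restrict D) ^ 2 ≤
      ENNReal.ofReal C * ((eLpNorm g 2 (volume.restrict D) + 1) ^ 2 +
        ∑ i, (eLpNorm (weakDeriv D i g) 2 (volume.restrict D) + 1) ^ 2) := by
    have h1 : ∀ᶠ n in atTop, eLpNorm (fun x => φ n x - g x) 2 (volume.restrict D) ≤ 1 :=
      (hφg.eventually_lt_const one_pos).mono fun _ h => h.le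
    have h2 : ∀ᶠ n in atTop, ∀ i, eLpNorm (fun x => partialDeriv i (φ n) x - weakDeriv D i g x) 2
        (volume.restrict D) ≤ 1 :=
      eventually_all.2 fun i => ((hφd i).eventually_lt_const one_pos).mono fun _ h => h.le
    filter_upwards [h1, h2] with n h1 h2
    have tri {f h : Sp d → V3} (mf : MemLp f 2 (volume.restrict D))
        (mh : MemLp h 2 (volume.restrict D))
        (hfh : eLpNorm (fun x => f x - h x) 2 (volume.restrict D) ≤ 1) :
        ENNReal.ofReal (∫ x in D, ‖f x‖ ^ 2) ≤ (eLpNorm h 2 (volume.restrict D) + 1) ^ 2 := by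
      rw [← eLpNorm_two_sq mf]
      gcongr
      have h3 := eLpNorm_add_le mh.1 (mf.1.sub mh.1) (p := 2) (by norm_num)
      rw [add_sub_cancel] at h3
      exact h3.trans (by gcongr; exact hfh)
    rw [eLpNorm_two_sq (htest n)]
    refine (ENNReal.ofReal_le_ofReal (hC (φ n) (hφ n))).trans ?_
    rw [ENNReal.ofReal_mul hC0, ENNReal.ofReal_add (integral_nonneg fun _ => by positivity)
      (Finset.sum_nonneg fun _ _ => integral_nonneg fun _ => by positivity),
      ENNReal.ofReal_sum_of_nonneg fun _ _ => integral_nonneg fun _ => by positivity]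
    gcongr with i _
    · exact tri (hφ n).memLp mg h1
    · exact tri ((hφ n).partialDeriv i).memLp (hg1.memLp_deriv i) (h2 i)
  set K := ENNReal.ofReal C * ((eLpNorm g 2 (volume.restrict D) + 1) ^ 2 +
        ∑ i, (eLpNorm (weakDeriv D i g) 2 (volume.restrict D) + 1) ^ 2) with hKdef
  have hK : K < ⊤ := by
    refine ENNReal.mul_lt_top ENNReal.ofReal_lt_top (ENNReal.add_lt_top.2 ⟨?_, ?_⟩)
    · exact ENNReal.pow_lt_top (ENNReal.add_lt_top.2 ⟨mg.2, ENNReal.one_lt_top⟩)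
    · exact ENNReal.sum_lt_top.2 fun i _ => ENNReal.pow_lt_top
        (ENNReal.add_lt_top.2 ⟨(hg1.memLp_deriv i).2, ENNReal.one_lt_top⟩)
  -- Fatou along the almost everywhere convergent subsequence. Only the square of the norm is
  -- bounded by `K`; y ≤ 1 + y² gives a finite bound for the norm without a square root.
  refine ⟨hψm.smul mg.1, lt_of_le_of_lt ?_ (ENNReal.add_lt_top.2 ⟨ENNReal.one_lt_top, hK⟩)⟩
  have hlim := Lp.eLpNorm_lim_le_liminf_eLpNorm (p := 2) (μ := volume.restrict D)
    (f := fun n x => (ψ x)⁻¹ • φ (s n) x) (fun n => (htest (s n)).1) (fun x => (ψ x)⁻¹ • g x)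
    (hae.mono fun x hx => hx.const_smul _)
  refine hlim.trans (liminf_le_of_frequently_le' ?_)
  refine ((hs.tendsto_atTop.eventually hbd).mono fun n hn => ?_).frequently
  refine le_trans ?_ (add_le_add le_rfl hn)
  set y := eLpNorm (fun x => (ψ x)⁻¹ • φ (s n) x) 2 (volume.restrict D)
  rcases le_total y 1 with h | h
  · exact h.trans le_self_add
  · calc y ≤ y ^ 2 := le_self_pow₀ h two_ne_zero
      _ ≤ _ := le_add_self

/-- **Green's formula** for functions of `H²` with homogeneous Neumann boundary condition. -/
theorem green (hD : Bornology.IsBounded D) {u v : Sp d → V3} (hu : MemH2 D u)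
    (hN : NeumannZero D u) {v' : Fin d → Sp d → V3} (hv : ∀ i, HasWeakDeriv D i v (v' i))
    (mv : MemLp v 2 (volume.restrict D)) (mv' : ∀ i, MemLp (v' i) 2 (volume.restrict D)) :
    ∫ x in D, inner ℝ (laplacian D u x) (v x) =
      - ∑ i, ∫ x in D, inner ℝ (weakDeriv D i u x) (v' i x) := by
  obtain ⟨ψ, hψ, hg⟩ := hN
  set g : Sp d → V3 := fun x => ∑ i : Fin d, partialDeriv i ψ x • weakDeriv D i u x with hgdef
  have hH := hψ.memLp_inv_smul hD hg
  obtain ⟨B, hB0, hB⟩ := exists_layer_mul_le ψ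
  have mP (i : Fin d) : MemLp (weakDeriv D i u) 2 (volume.restrict D) := hu.memH1.memLp_deriv i
  have mQ (i : Fin d) : MemLp (weakDeriv D i (weakDeriv D i u)) 2 (volume.restrict D) :=
    (hu.memH1_deriv i).memLp_deriv i
  have hW (i : Fin d) := (hasWeakDeriv_weakDeriv ((hu.memH1_deriv i).exists_deriv i)).inner
    hψ.isOpen (hv i) (mP i) (mQ i) mv (mv' i)
  have iA (i : Fin d) := integrable_inner (mQ i) mv
  have iB (i : Fin d) := integrable_inner (mP i) (mv' i)
  have hcut := hψ.isTestFunction_cutoff hD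
  -- The weak divergence of the field ⟨∂ᵢu, v⟩ is tested with the cutoff. The gradient of the cutoff
  -- is -`layer` ∇ψ, so the approximate boundary term contains exactly the conormal derivative `g`.
  have ident (n : ℕ) : ∫ x in D, layer ψ n x * inner ℝ (g x) (v x) =
      ∫ x in D, cutoff ψ n x * ∑ i, (inner ℝ (weakDeriv D i (weakDeriv D i u) x) (v x) +
        inner ℝ (weakDeriv D i u x) (v' i x)) := by
    have h1 : ∀ x, layer ψ n x * inner ℝ (g x) (v x) =
        - ∑ i, partialDeriv i (cutoff ψ n) x • inner ℝ (weakDeriv D i u x) (v x) := fun x => by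
      simp only [hgdef, sum_inner, inner_smul_left, partialDeriv_cutoff hψ.contDiff, smul_eq_mul,
        neg_mul, Finset.sum_neg_distrib, neg_neg, Finset.mul_sum]
      exact Finset.sum_congr rfl fun i _ => by simp [mul_assoc]
    have h2 : ∀ i : Fin d, Integrable (fun x => partialDeriv i (cutoff ψ n) x •
        (inner ℝ (weakDeriv D i u x) (v x) : ℝ)) (volume.restrict D) := fun i =>
      (((hcut n).partialDeriv i).integrable_smul (hW i).1).restrict
    have h3 : ∀ i : Fin d, Integrable (fun x => cutoff ψ n x •
        (inner ℝ (weakDeriv D i (weakDeriv D i u) x) (v x) +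
        inner ℝ (weakDeriv D i u x) (v' i x) : ℝ)) (volume.restrict D) := fun i =>
      ((hcut n).integrable_smul (hW i).2).restrict
    simp only [h1, Finset.mul_sum]
    rw [integral_neg, integral_finsetSum _ fun i _ => h2 i]
    simp only [fun i => (hW i).3 _ (hcut n), Finset.sum_neg_distrib, neg_neg]
    rw [← integral_finsetSum _ fun i _ => h3 i]
    simp only [smul_eq_mul]
  have iS : Integrable (fun x => ∑ i, (inner ℝ (weakDeriv D i (weakDeriv D i u) x) (v x) +
        inner ℝ (weakDeriv D i u x) (v' i x))) (volume.restrict D) :=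
    integrable_finsetSum _ fun i _ => (iA i).add (iB i)
  have hev : ∀ᵐ x ∂(volume.restrict D), ∀ᶠ n in atTop, cutoff ψ n x = 1 ∧ layer ψ n x = 0 :=
    (ae_restrict_mem hψ.isOpen.measurableSet).mono fun x hx => tendsto_cutoff (hψ.neg hx)
  have lim1 : Tendsto (fun n => ∫ x in D, cutoff ψ n x *
      ∑ i, (inner ℝ (weakDeriv D i (weakDeriv D i u) x) (v x) +
        inner ℝ (weakDeriv D i u x) (v' i x))) atTop (𝓝 (∫ x in D,
      ∑ i, (inner ℝ (weakDeriv D i (weakDeriv D i u) x) (v x) +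
        inner ℝ (weakDeriv D i u x) (v' i x)))) := by
    refine tendsto_integral_of_dominated_convergence _ (fun n => ?_) iS.norm
      (fun n => Eventually.of_forall fun x => ?_) ?_
    · exact (hcut n).continuous.aestronglyMeasurable.mul iS.1
    · rw [norm_mul, Real.norm_of_nonneg (cutoff_nonneg n x)]
      exact mul_le_of_le_one_left (norm_nonneg _) (cutoff_le_one n x)
    · filter_upwards [hev] with x hx
      exact tendsto_const_nhds.congr' (hx.mono fun n hn => by simp only [hn.1, one_mul])
  -- The boundary term vanishes by dominated convergence: `layer` is at most B/|ψ|, g/ψ is in L² by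
  -- Hardy, and every interior point eventually leaves the layer.
  have lim2 : Tendsto (fun n => ∫ x in D, layer ψ n x * inner ℝ (g x) (v x)) atTop
      (𝓝 (∫ _ in D, (0 : ℝ))) := by
    refine tendsto_integral_of_dominated_convergence
      (fun x => B * (‖(ψ x)⁻¹ • g x‖ * ‖v x‖)) (fun n => ?_)
      ((integrable_norm_mul_norm hH mv).const_mul B) (fun n => ?_) ?_
    · exact (layer_continuous hψ.contDiff n).aestronglyMeasurable.mul (hg.1.memLp.1.inner mv.1)
    · filter_upwards [ae_restrict_mem hψ.isOpen.measurableSet] with x hx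
      have hne : 0 < |ψ x| := abs_pos.2 (hψ.neg hx).ne
      rw [norm_mul, Real.norm_of_nonneg (layer_nonneg n x), norm_smul, norm_inv, Real.norm_eq_abs]
      calc layer ψ n x * ‖inner ℝ (g x) (v x)‖ ≤ layer ψ n x * (‖g x‖ * ‖v x‖) :=
            mul_le_mul_of_nonneg_left (norm_inner_le_norm _ _) (layer_nonneg n x)
        _ = (layer ψ n x * |ψ x|) * (|ψ x|⁻¹ * ‖g x‖ * ‖v x‖) := by field_simp
        _ ≤ _ := mul_le_mul_of_nonneg_right (hB n x) (by positivity)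
    · filter_upwards [hev] with x hx
      exact tendsto_const_nhds.congr' (hx.mono fun n hn => by simp only [hn.2, zero_mul])
  simp only [ident, integral_zero] at lim2
  have hz := tendsto_nhds_unique lim1 lim2
  rw [integral_finsetSum _ fun i _ => (iA i).fun_add (iB i)] at hz
  simp only [fun i => integral_add (iA i) (iB i), Finset.sum_add_distrib] at hz
  rw [← integral_finsetSum _ fun i _ => iA i] at hz
  simp only [laplacian, sum_inner]
  linarith

end Hardy

end

end LLB

open MeasureTheory Filter Topology Set
open scoped ContDiff
set_option linter.unusedSectionVars false

namespace LLB

noncomputable section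

/-! ### The Sobolev inequality for W^{1,1} functions. -/

section Sobolev

variable {d : ℕ} {D : Set (Sp d)} {ψ : Sp d → ℝ}

lemma enorm_fderiv_le_sum (f : Sp d → ℝ) (x : Sp d) :
    ‖fderiv ℝ f x‖ₑ ≤ ∑ i, ‖partialDeriv i f x‖ₑ := by
  have h : ‖fderiv ℝ f x‖ ≤ ∑ i, ‖partialDeriv i f x‖ := by
    refine ContinuousLinearMap.opNorm_le_bound _ (by positivity) fun v => ?_
    have hv : v = ∑ i, v i • EuclideanSpace.single i (1 : ℝ) := by
      ext j
      simp [Finset.sum_apply, Pi.single_apply]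
    calc ‖fderiv ℝ f x v‖ = ‖∑ i, v i • partialDeriv i f x‖ := by
          conv_lhs => rw [hv]
          simp [partialDeriv]
      _ ≤ ∑ i, ‖v i • partialDeriv i f x‖ := norm_sum_le _ _
      _ ≤ ∑ i, ‖partialDeriv i f x‖ * ‖v‖ := Finset.sum_le_sum fun i _ => by
          rw [norm_smul, mul_comm]
          exact mul_le_mul_of_nonneg_left (PiLp.norm_apply_le v i) (norm_nonneg _)
      _ = _ := by rw [Finset.sum_mul]
  calc ‖fderiv ℝ f x‖ₑ = ENNReal.ofReal ‖fderiv ℝ f x‖ := (ofReal_norm _).symm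
    _ ≤ ENNReal.ofReal (∑ i, ‖partialDeriv i f x‖) := ENNReal.ofReal_le_ofReal h
    _ = ∑ i, ‖partialDeriv i f x‖ₑ := by
      rw [ENNReal.ofReal_sum_of_nonneg fun _ _ => norm_nonneg _]
      simp only [ofReal_norm]

lemma measurePreserving_toLp_const :
    MeasurePreserving (fun t : ℝ => (WithLp.toLp 2 fun _ : Fin 1 => t : Sp 1)) volume volume := by
  have h1 := (volume_preserving_funUnique (Fin 1) ℝ).symm
  have h2 := (EuclideanSpace.volume_preserving_symm_measurableEquiv_toLp (Fin 1)).symm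
  exact h2.comp h1

/-- On the line |f(x)| is at most the integral of |f'|, and the bounded support converts this
uniform bound into an L^{3/2} bound. The argument used for d > 1 needs the exponent 1 to be strictly
below the dimension. -/
lemma exists_gagliardo_nirenberg_one {s : Set (Sp 1)} (hs : Bornology.IsBounded s) :
    ∃ C : NNReal, ∀ f : Sp 1 → ℝ, ContDiff ℝ 1 f → Function.support f ⊆ s →
      eLpNorm f (3 / 2) volume ≤ C * eLpNorm (fderiv ℝ f) 1 volume := by
  obtain ⟨R, hR⟩ := hs.subset_closedBall 0
  set K := Metric.closedBall (0 : Sp 1) R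
  have hKv : volume K < ⊤ := (isCompact_closedBall _ _).measure_lt_top
  refine ⟨(volume K ^ ((3 / 2 : ENNReal).toReal⁻¹)).toNNReal, fun f hf hfs => ?_⟩
  have hfK : Function.support f ⊆ K := hfs.trans hR
  have hcs : HasCompactSupport f :=
    HasCompactSupport.of_support_subset_isCompact (isCompact_closedBall _ _) hfK
  set ι : ℝ → Sp 1 := fun t => WithLp.toLp 2 fun _ : Fin 1 => t
  have hι : ∀ t, HasDerivAt ι (EuclideanSpace.single 0 1) t := fun t => by
    have h1 : ι = fun t : ℝ => t • (EuclideanSpace.single 0 1 : Sp 1) := by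
      ext t j
      simp [ι, Subsingleton.elim j 0]
    rw [h1]
    simpa using (hasDerivAt_id t).smul_const (EuclideanSpace.single 0 1 : Sp 1)
  have hιn : ∀ t, ‖ι t‖ = |t| := fun t => by
    simp [ι, EuclideanSpace.norm_eq, Real.sqrt_sq_eq_abs]
  have hιc : Continuous ι := continuous_iff_continuousAt.2 fun t => (hι t).continuousAt
  have hder : ∀ t, HasDerivAt (f ∘ ι) (fderiv ℝ f (ι t) (EuclideanSpace.single 0 1)) t := fun t =>
    ((hf.differentiable one_ne_zero) (ι t)).hasFDerivAt.comp_hasDerivAt t (hι t)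
  have hcd : ContDiff ℝ 1 (f ∘ ι) := by
    refine contDiff_one_iff_deriv.2 ⟨fun t => (hder t).differentiableAt, ?_⟩
    rw [funext fun t => (hder t).deriv]
    exact ((hf.continuous_fderiv one_ne_zero).comp hιc).clm_apply continuous_const
  have hcsι : HasCompactSupport (f ∘ ι) := by
    refine HasCompactSupport.of_support_subset_isCompact (isCompact_Icc (a := -R) (b := R)) ?_
    intro t ht
    have := hfK (show ι t ∈ Function.support f from ht)
    rw [mem_closedBall_zero_iff, hιn] at this
    exact abs_le.1 this
  have hbound : ∀ x, ‖f x‖ₑ ≤ eLpNorm (fderiv ℝ f) 1 volume := fun x => by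
    have hx : x = ι (x 0) := by
      ext j; simp [ι, Subsingleton.elim j 0]
    calc ‖f x‖ₑ = ‖(f ∘ ι) (x 0)‖ₑ := by rw [Function.comp, ← hx]
      _ ≤ ∫⁻ t in Iic (x 0), ‖deriv (f ∘ ι) t‖ₑ :=
        hcsι.enorm_le_lintegral_Ici_deriv hcd (x 0)
      _ ≤ ∫⁻ t, ‖deriv (f ∘ ι) t‖ₑ := setLIntegral_le_lintegral _ _
      _ ≤ ∫⁻ t, ‖fderiv ℝ f (ι t)‖ₑ := lintegral_mono fun t => by
          rw [(hder t).deriv]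
          refine (ContinuousLinearMap.le_opENorm _ _).trans (le_of_eq ?_)
          simp [enorm_eq_nnnorm]
      _ = eLpNorm (fderiv ℝ f) 1 volume := by
          rw [eLpNorm_one_eq_lintegral_enorm]
          exact measurePreserving_toLp_const.lintegral_comp
            ((hf.continuous_fderiv one_ne_zero).enorm.measurable)
  have e1 : eLpNorm f (3 / 2) volume = eLpNorm f (3 / 2) (volume.restrict K) :=
    (eLpNorm_restrict_eq_of_support_subset hfK).symm
  rw [e1]
  refine (eLpNorm_le_of_ae_enorm_bound (Eventually.of_forall hbound)).trans (le_of_eq ?_)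
  rw [ENNReal.coe_toNNReal (ENNReal.rpow_lt_top_of_nonneg (by positivity) hKv.ne).ne,
    Measure.restrict_apply_univ]
  simp [mul_comm]

/-- The exponent 3/2 is the critical one, d/(d - 1), when d = 3 and is subcritical when d = 2; the
requirement is 1 - 1/d ≤ 2/3. -/
lemma exists_gagliardo_nirenberg (hd1 : 1 ≤ d) (hd3 : d ≤ 3) {s : Set (Sp d)}
    (hs : Bornology.IsBounded s) :
    ∃ C : NNReal, ∀ f : Sp d → ℝ, ContDiff ℝ 1 f → Function.support f ⊆ s →
      eLpNorm f (3 / 2) volume ≤ C * eLpNorm (fderiv ℝ f) 1 volume := by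
  rcases hd1.eq_or_lt with h | h
  · subst h
    exact exists_gagliardo_nirenberg_one hs
  · refine ⟨eLpNormLESNormFDerivOfLeConst ℝ (volume : Measure (Sp d)) s 1 (3 / 2), fun f hf hfs => ?_⟩
    have := eLpNorm_le_eLpNorm_fderiv_of_le (volume : Measure (Sp d)) hf hfs (p := 1) (q := 3 / 2)
      le_rfl (by simpa using h) ?_ hs
    · rw [ENNReal.coe_one] at this
      convert this using 2
      rw [ENNReal.coe_div two_ne_zero]; norm_num
    · have hd : (d : ℝ) ≤ 3 := by exact_mod_cast hd3
      have hd' : (0 : ℝ) < d := by exact_mod_cast (zero_lt_one.trans h)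
      simp only [finrank_euclideanSpace, Fintype.card_fin]
      have : (3 : ℝ)⁻¹ ≤ (d : ℝ)⁻¹ := inv_anti₀ hd' hd
      push_cast
      norm_num at this ⊢
      linarith

/-- The bumps have radius at most one, so all mollifications are supported in a single bounded set
and share one Gagliardo–Nirenberg constant. -/
lemma support_moll_subset {F : Sp d → ℝ} (hF : Function.support F ⊆ D) (n : ℕ) :
    Function.support (moll n F) ⊆ Metric.thickening 1 D := by
  intro x hx
  by_contra h
  refine hx ?_
  rw [moll_apply]
  refine integral_eq_zero_of_ae (Eventually.of_forall fun t => ?_)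
  by_cases ht : t ∈ D
  · have h1 : (bump d n).normed volume (x - t) = 0 := by
      rw [← Function.notMem_support, ContDiffBump.support_normed_eq]
      intro hb
      refine h (Metric.mem_thickening_iff.2 ⟨t, ht, ?_⟩)
      rw [mem_ball_zero_iff] at hb
      rw [dist_eq_norm]
      refine hb.trans_le ?_
      show 1 / ((n : ℝ) + 1) ≤ 1
      rw [div_le_one (by positivity)]
      linarith [(Nat.cast_nonneg n : (0 : ℝ) ≤ n)]
    simp [h1]
  · have h1 : F t = 0 := by
      by_contra h2; exact ht (hF h2)
    simp [h1]

/-- The Gagliardo–Nirenberg inequality for `W^{1,1}` functions supported in a bounded set. -/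
lemma exists_gagliardo_nirenberg_weak (hd1 : 1 ≤ d) (hd3 : d ≤ 3) (hb : Bornology.IsBounded D) :
    ∃ C : ℝ, 0 ≤ C ∧ ∀ (F : Sp d → ℝ) (H : Fin d → Sp d → ℝ),
      (∀ i, HasWeakDeriv univ i F (H i)) → Integrable F volume → (∀ i, Integrable (H i) volume) →
      Function.support F ⊆ D →
      eLpNorm F (3 / 2) volume ≤ ENNReal.ofReal (C * ∑ i, ∫ x, ‖H i x‖) := by
  obtain ⟨C, hC⟩ := exists_gagliardo_nirenberg hd1 hd3 (hb.thickening (δ := 1))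
  refine ⟨C, C.coe_nonneg, fun F H hFH hF hH hs => ?_⟩
  have hbound (n : ℕ) : eLpNorm (moll n F) (3 / 2) volume ≤
      ENNReal.ofReal (C * ∑ i, ∫ x, ‖H i x‖) := by
    have sm := contDiff_moll hF.locallyIntegrable n
    refine (hC _ (sm.of_le (by simp)) (support_moll_subset hs n)).trans ?_
    rw [ENNReal.ofReal_mul C.coe_nonneg, ENNReal.ofReal_coe_nnreal,
      ENNReal.ofReal_sum_of_nonneg fun _ _ => integral_nonneg fun _ => norm_nonneg _]
    gcongr
    rw [eLpNorm_one_eq_lintegral_enorm]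
    calc ∫⁻ x, ‖fderiv ℝ (moll n F) x‖ₑ ≤ ∫⁻ x, ∑ i, ‖moll n (H i) x‖ₑ :=
          lintegral_mono fun x => by
            simpa only [fun i => partialDeriv_moll (hFH i) n x] using
              enorm_fderiv_le_sum (moll n F) x
      _ = ∑ i, ∫⁻ x, ‖moll n (H i) x‖ₑ := lintegral_finsetSum _ fun i _ =>
          (contDiff_moll (hH i).locallyIntegrable n).continuous.enorm.measurable
      _ ≤ _ := Finset.sum_le_sum fun i _ => by
          rw [← ofReal_integral_norm_eq_lintegral_enorm (integrable_moll (hH i) n)]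
          exact ENNReal.ofReal_le_ofReal (integral_norm_moll_le (hH i) n)
  have hlim := Lp.eLpNorm_lim_le_liminf_eLpNorm (p := 3 / 2) (μ := volume)
    (f := fun n => moll n F) (fun n => (integrable_moll hF n).1) F (ae_tendsto_moll hF.locallyIntegrable)
  exact hlim.trans (liminf_le_of_frequently_le' (Frequently.of_forall hbound))

/-- The Sobolev inequality `W^{1,1}(D) ⊂ L^{3/2}(D)` in dimension at most three. -/
theorem IsDefiningFunction.exists_sobolev (hd1 : 1 ≤ d) (hd3 : d ≤ 3)
    (hψ : IsDefiningFunction D ψ) (hb : Bornology.IsBounded D) :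
    ∃ C : ℝ, 0 ≤ C ∧ ∀ (z : Sp d → ℝ) (z' : Fin d → Sp d → ℝ),
      (∀ i, HasWeakDeriv D i z (z' i)) → (∀ x, 0 ≤ z x) → IntegrableOn z D volume →
      (∀ i, IntegrableOn (z' i) D volume) →
      eLpNorm z (3 / 2) (volume.restrict D) ≤
        ENNReal.ofReal (C * ((∫ x in D, z x) + ∑ i, ∫ x in D, ‖z' i x‖)) := by
  obtain ⟨C, hC0, hC⟩ := exists_gagliardo_nirenberg_weak hd1 hd3 hb
  obtain ⟨c, hc, hlow⟩ := hψ.exists_lower_bound hb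
  obtain ⟨B, hB0, hB⟩ := exists_layer_mul_le ψ
  obtain ⟨B', hB'0, hB'⟩ := exists_bound_of_isBounded hb hψ.contDiff.continuous
  choose B1 hB10 hB1 using fun i => exists_bound_of_isBounded hb
    (contDiff_partialDeriv hψ.contDiff i).continuous
  choose B2 hB20 hB2 using fun i => exists_bound_of_isBounded hb
    (contDiff_partialDeriv (contDiff_partialDeriv hψ.contDiff i) i).continuous
  set b : ℝ := ∑ i, (B1 i + B2 i) with hbdef
  have hb1 : ∀ i, B1 i ≤ b := fun i =>
    (le_add_of_nonneg_right (hB20 i)).trans (Finset.single_le_sum (f := fun i => B1 i + B2 i)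
      (fun j _ => add_nonneg (hB10 j) (hB20 j)) (Finset.mem_univ i))
  have hb2 : ∀ i, B2 i ≤ b := fun i =>
    (le_add_of_nonneg_left (hB10 i)).trans (Finset.single_le_sum (f := fun i => B1 i + B2 i)
      (fun j _ => add_nonneg (hB10 j) (hB20 j)) (Finset.mem_univ i))
  have hb0 : 0 ≤ b := Finset.sum_nonneg fun j _ => add_nonneg (hB10 j) (hB20 j)
  set K : ℝ := (d * b + b + B * B') / c with hK
  have hK0 : 0 ≤ K := by positivity
  refine ⟨C * (d * b * K + 1), by positivity, fun z z' hz hz0 iz iz' => ?_⟩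
  set A := ∫ x in D, z x
  set S := ∑ i, ∫ x in D, ‖z' i x‖ with hS
  have hA : 0 ≤ A := integral_nonneg hz0
  have hS0 : 0 ≤ S := Finset.sum_nonneg fun _ _ => integral_nonneg fun _ => norm_nonneg _
  have hcut := hψ.isTestFunction_cutoff hb
  have hmeas := hψ.isOpen.measurableSet
  -- boundedness of the boundary layer mass
  have hlayer (n : ℕ) : IntegrableOn (fun x => layer ψ n x * z x) D volume ∧
      ∫ x in D, layer ψ n x * z x ≤ K * (A + S) := by
    -- A substitute for the trace inequality. Testing with the components of `cutoff` ∇ψ produces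
    -- the integral of `layer` |∇ψ|² z, and the remaining terms are controlled by the W^{1,1} norm
    -- of z uniformly in n.
    have hT (i : Fin d) : IsTestFunction D (fun x => cutoff ψ n x * partialDeriv i ψ x) :=
      (hcut n).mul (contDiff_partialDeriv hψ.contDiff i)
    have eT (i : Fin d) (x : Sp d) :
        partialDeriv i (fun x => cutoff ψ n x * partialDeriv i ψ x) x * z x =
        - (layer ψ n x * partialDeriv i ψ x ^ 2 * z x) +
          cutoff ψ n x * partialDeriv i (partialDeriv i ψ) x * z x := by
      rw [partialDeriv_mul ((hcut n).contDiff.differentiable (by simp) x)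
        ((contDiff_partialDeriv hψ.contDiff i).differentiable (by simp) x),
        partialDeriv_cutoff hψ.contDiff]
      ring
    have i2 (i : Fin d) : IntegrableOn
        (fun x => cutoff ψ n x * partialDeriv i (partialDeriv i ψ) x * z x) D volume :=
      (((hcut n).mul (contDiff_partialDeriv (contDiff_partialDeriv hψ.contDiff i)
        i)).integrable_smul (hz i).1).restrict
    have iw (i : Fin d) : IntegrableOn
        (fun x => cutoff ψ n x * partialDeriv i ψ x * z' i x) D volume :=
      ((hT i).integrable_smul (hz i).2).restrict
    have i1 (i : Fin d) : IntegrableOn (fun x => layer ψ n x * partialDeriv i ψ x ^ 2 * z x)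
        D volume := by
      have h1 : IntegrableOn (fun x =>
        partialDeriv i (fun x => cutoff ψ n x * partialDeriv i ψ x) x * z x) D volume :=
        (((hT i).partialDeriv i).integrable_smul (hz i).1).restrict
      refine ((i2 i).sub h1).congr (Eventually.of_forall fun x => ?_)
      simp only [Pi.sub_apply, eT]; ring
    have i0 : IntegrableOn (fun x => layer ψ n x * z x) D volume := by
      have hl : HasCompactSupport (layer ψ n) := by
        refine HasCompactSupport.of_support_subset_isCompact hb.isCompact_closure fun x hx => ?_
        refine subset_closure ?_
        rw [hψ.eq_sublevel]
        by_contra h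
        refine hx ?_
        have h0 : 0 ≤ ψ x := not_lt.1 h
        rw [layer, deriv_step_eq_zero (Or.inl ?_), mul_zero]
        have : 0 ≤ ((n : ℝ) + 1) * ψ x := by positivity
        linarith
      obtain ⟨M, hM⟩ := hl.exists_bound_of_continuous (layer_continuous hψ.contDiff n)
      exact Integrable.bdd_mul iz (layer_continuous hψ.contDiff n).aestronglyMeasurable
        (Eventually.of_forall hM)
    refine ⟨i0, ?_⟩
    have id1 (i : Fin d) : ∫ x in D, layer ψ n x * partialDeriv i ψ x ^ 2 * z x ≤
        b * A + b * ∫ x in D, ‖z' i x‖ := by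
      have h1 := (hz i).3 _ (hT i)
      simp only [smul_eq_mul, eT] at h1
      rw [integral_add (i1 i).fun_neg (i2 i), integral_neg] at h1
      have h2 : ∫ x in D, cutoff ψ n x * partialDeriv i (partialDeriv i ψ) x * z x ≤ b * A := by
        rw [← integral_const_mul]
        refine setIntegral_mono_on (i2 i) (iz.const_mul b) hmeas fun x hx => ?_
        have h3 : cutoff ψ n x * partialDeriv i (partialDeriv i ψ) x ≤ b := by
          have := (le_abs_self _).trans ((hB2 i x hx).trans (hb2 i))
          have c0 := cutoff_nonneg (ψ := ψ) n x
          have c1 := cutoff_le_one (ψ := ψ) n x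
          nlinarith
        exact mul_le_mul_of_nonneg_right h3 (hz0 x)
      have h4 : ∫ x in D, cutoff ψ n x * partialDeriv i ψ x * z' i x ≤
          b * ∫ x in D, ‖z' i x‖ := by
        rw [← integral_const_mul]
        refine setIntegral_mono_on (iw i) ((iz' i).norm.const_mul b) hmeas fun x hx => ?_
        refine (le_abs_self _).trans ?_
        rw [abs_mul, abs_mul, abs_of_nonneg (cutoff_nonneg n x), Real.norm_eq_abs]
        refine mul_le_mul_of_nonneg_right ?_ (abs_nonneg _)
        calc cutoff ψ n x * |partialDeriv i ψ x| ≤ 1 * b :=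
              mul_le_mul (cutoff_le_one n x) ((hB1 i x hx).trans (hb1 i)) (abs_nonneg _) zero_le_one
          _ = b := one_mul b
      linarith
    -- The lower bound on |∇ψ|² + ψ² removes the weight |∇ψ|²; the correction `layer` ψ² stays
    -- bounded because `layer` |ψ| does. Nonnegativity of z is essential here.
    have id2 : c * ∫ x in D, layer ψ n x * z x ≤
        (∑ i, ∫ x in D, layer ψ n x * partialDeriv i ψ x ^ 2 * z x) + B * B' * A := by
      have is : IntegrableOn (fun x => ∑ i, layer ψ n x * partialDeriv i ψ x ^ 2 * z x) D volume :=
        integrable_finsetSum _ fun i _ => i1 i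
      rw [← integral_finsetSum _ fun i _ => i1 i, ← integral_const_mul, ← integral_const_mul,
        ← integral_add is (iz.const_mul _)]
      refine setIntegral_mono_on (i0.const_mul c) (is.fun_add (iz.const_mul _)) hmeas fun x hx => ?_
      have h1 := mul_le_mul_of_nonneg_right (hlow x hx)
        (mul_nonneg (layer_nonneg (ψ := ψ) n x) (hz0 x))
      have h2 : layer ψ n x * ψ x ^ 2 ≤ B * B' := by
        rw [← sq_abs, pow_two, ← mul_assoc]
        exact mul_le_mul (hB n x) (hB' x hx) (abs_nonneg _) hB0
      have h3 := mul_le_mul_of_nonneg_right h2 (hz0 x)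
      have h4 : ∑ i, layer ψ n x * partialDeriv i ψ x ^ 2 * z x =
          (∑ i, partialDeriv i ψ x ^ 2) * (layer ψ n x * z x) := by
        rw [Finset.sum_mul]; exact Finset.sum_congr rfl fun i _ => by ring
      rw [h4]
      nlinarith
    have id3 := Finset.sum_le_sum fun i (_ : i ∈ Finset.univ) => id1 i
    rw [Finset.sum_add_distrib, Finset.sum_const, ← Finset.mul_sum, ← hS] at id3
    simp only [Finset.card_univ, Fintype.card_fin, nsmul_eq_mul] at id3
    rw [hK, div_mul_eq_mul_div, le_div_iff₀ hc]
    have h5 : 0 ≤ B * B' * S := by positivity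
    have h6 : 0 ≤ (d : ℝ) * b * S := by positivity
    have h7 : 0 ≤ b * A := by positivity
    nlinarith
  -- No extension operator is needed: z is cut off and extended by zero. The gradient this creates
  -- is the layer mass just bounded, so the estimate is uniform in n and passes to z by Fatou.
  have hbound (n : ℕ) : eLpNorm (fun x => cutoff ψ n x * z x) (3 / 2) volume ≤
      ENNReal.ofReal (C * (d * b * K + 1) * (A + S)) := by
    refine (hC _ _ (fun i => (hz i).smul_test (hcut n)) ((hcut n).integrable_smul (hz ⟨0, hd1⟩).1)
      (fun i => (((hcut n).partialDeriv i).integrable_smul (hz i).1).add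
        ((hcut n).integrable_smul (hz i).2)) (fun x hx => ?_)).trans ?_
    · by_contra h
      exact hx (by simp [(hcut n).zero_of_notMem h])
    · refine ENNReal.ofReal_le_ofReal ?_
      rw [mul_assoc]
      refine mul_le_mul_of_nonneg_left ?_ hC0
      have hi (i : Fin d) : ∫ x, ‖partialDeriv i (cutoff ψ n) x • z x + cutoff ψ n x • z' i x‖ ≤
          b * (K * (A + S)) + ∫ x in D, ‖z' i x‖ := by
        rw [← setIntegral_eq_integral_of_forall_compl_eq_zero (s := D) fun x hx => by
          simp [(hcut n).zero_of_notMem hx, ((hcut n).partialDeriv i).zero_of_notMem hx]]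
        have e : ∫ x in D, ‖partialDeriv i (cutoff ψ n) x • z x + cutoff ψ n x • z' i x‖ ≤
            ∫ x in D, (b * (layer ψ n x * z x) + ‖z' i x‖) := by
          refine setIntegral_mono_on ?_ (((hlayer n).1.const_mul b).fun_add (iz' i).norm) hmeas
            fun x hx => ?_
          · exact ((((hcut n).partialDeriv i).integrable_smul (hz i).1).add
              ((hcut n).integrable_smul (hz i).2)).restrict.norm
          · refine (norm_add_le _ _).trans (add_le_add ?_ ?_)
            · rw [partialDeriv_cutoff hψ.contDiff, smul_eq_mul, norm_mul, norm_neg, norm_mul,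
                Real.norm_of_nonneg (layer_nonneg n x), Real.norm_of_nonneg (hz0 x)]
              have := (hB1 i x hx).trans (hb1 i)
              have h0 := mul_nonneg (layer_nonneg (ψ := ψ) n x) (hz0 x)
              rw [Real.norm_eq_abs]
              nlinarith
            · rw [smul_eq_mul, norm_mul, Real.norm_of_nonneg (cutoff_nonneg n x)]
              exact mul_le_of_le_one_left (norm_nonneg _) (cutoff_le_one n x)
        refine e.trans ?_
        rw [integral_add ((hlayer n).1.const_mul b) (iz' i).norm, integral_const_mul]
        have := mul_le_mul_of_nonneg_left (hlayer n).2 hb0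
        linarith
      refine (Finset.sum_le_sum fun i _ => hi i).trans ?_
      rw [Finset.sum_add_distrib, Finset.sum_const, ← hS]
      simp only [Finset.card_univ, Fintype.card_fin, nsmul_eq_mul]
      nlinarith
  have hlim := Lp.eLpNorm_lim_le_liminf_eLpNorm (p := 3 / 2) (μ := volume.restrict D)
    (f := fun n x => cutoff ψ n x * z x)
    (fun n => (hcut n).continuous.aestronglyMeasurable.mul iz.1) z
    ((ae_restrict_mem hmeas).mono fun x hx => tendsto_const_nhds.congr'
      ((tendsto_cutoff (hψ.neg hx)).mono fun n hn => by simp only [hn.1, one_mul]))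
  exact hlim.trans (liminf_le_of_frequently_le' (Frequently.of_forall fun n =>
    (eLpNorm_mono_measure _ Measure.restrict_le_self).trans (hbound n)))

end Sobolev

end

end LLB

open MeasureTheory Filter Topology Set
open scoped ContDiff
set_option linter.unusedSectionVars false

namespace LLB

noncomputable section

/-! ### Decay of superlevel sets. -/

section Stampacchia

/-- A `C¹` truncation vanishing below `k` and of slope one above `k + δ`. -/
def trunc (k δ y : ℝ) : ℝ := ∫ t in k..y, Real.smoothTransition ((t - k) / δ)

lemma hasDerivAt_trunc (k δ y : ℝ) :
    HasDerivAt (trunc k δ) (Real.smoothTransition ((y - k) / δ)) y := by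
  have hc : Continuous fun t => Real.smoothTransition ((t - k) / δ) :=
    Real.smoothTransition.continuous.comp ((continuous_id.sub continuous_const).div_const δ)
  exact intervalIntegral.integral_hasDerivAt_right (hc.intervalIntegrable _ _)
    hc.aestronglyMeasurable.stronglyMeasurableAtFilter hc.continuousAt

lemma contDiff_trunc (k δ : ℝ) : ContDiff ℝ 1 (trunc k δ) := by
  refine contDiff_one_iff_deriv.2 ⟨fun y => (hasDerivAt_trunc k δ y).differentiableAt, ?_⟩
  rw [funext fun y => (hasDerivAt_trunc k δ y).deriv]
  exact Real.smoothTransition.continuous.comp ((continuous_id.sub continuous_const).div_const δ)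

lemma monotone_trunc (k δ : ℝ) : Monotone (trunc k δ) :=
  monotone_of_deriv_nonneg (fun y => (hasDerivAt_trunc k δ y).differentiableAt) fun y => by
    rw [(hasDerivAt_trunc k δ y).deriv]; exact Real.smoothTransition.nonneg _

lemma trunc_eq_zero {k δ y : ℝ} (hδ : 0 < δ) (h : y ≤ k) : trunc k δ y = 0 := by
  rw [trunc]
  refine intervalIntegral.integral_zero_ae (Eventually.of_forall fun t ht => ?_)
  rw [uIoc_of_ge h] at ht
  exact Real.smoothTransition.zero_of_nonpos (div_nonpos_of_nonpos_of_nonneg (by linarith [ht.2]) hδ.le)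

lemma trunc_nonneg {k δ : ℝ} (hδ : 0 < δ) (y : ℝ) : 0 ≤ trunc k δ y := by
  rcases le_total y k with h | h
  · rw [trunc_eq_zero hδ h]
  · rw [← trunc_eq_zero hδ (le_refl k)]; exact monotone_trunc k δ h

lemma trunc_le {k δ y : ℝ} (h : k ≤ y) : trunc k δ y ≤ y - k := by
  have hc : Continuous fun t => Real.smoothTransition ((t - k) / δ) :=
    Real.smoothTransition.continuous.comp ((continuous_id.sub continuous_const).div_const δ)
  have := intervalIntegral.integral_mono_on h (hc.intervalIntegrable k y)
    (intervalIntegrable_const (μ := volume) (c := (1 : ℝ)))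
    fun t _ => Real.smoothTransition.le_one _
  simpa [trunc] using this

lemma le_trunc {k δ y : ℝ} (hδ : 0 < δ) (h : k + 2 * δ ≤ y) : δ ≤ trunc k δ y := by
  refine le_trans ?_ (monotone_trunc k δ h)
  have hc : Continuous fun t => Real.smoothTransition ((t - k) / δ) :=
    Real.smoothTransition.continuous.comp ((continuous_id.sub continuous_const).div_const δ)
  have h1 : trunc k δ (k + 2 * δ) = trunc k δ (k + δ) +
      ∫ t in (k + δ)..(k + 2 * δ), Real.smoothTransition ((t - k) / δ) :=
    (intervalIntegral.integral_add_adjacent_intervals (hc.intervalIntegrable _ _)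
      (hc.intervalIntegrable _ _)).symm
  have h2 : ∫ t in (k + δ)..(k + 2 * δ), Real.smoothTransition ((t - k) / δ) =
      ∫ _ in (k + δ)..(k + 2 * δ), (1 : ℝ) :=
    intervalIntegral.integral_congr fun t ht => by
      rw [uIcc_of_le (by linarith)] at ht
      exact Real.smoothTransition.one_of_one_le (by rw [le_div_iff₀ hδ]; linarith [ht.1])
  rw [h1, h2]
  have := trunc_nonneg hδ (k := k) (k + δ)
  simp
  linarith

lemma sq_trunc_le {k δ : ℝ} (hk : 0 ≤ k) (hδ : 0 < δ) (y : ℝ) :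
    trunc k δ y ^ 2 ≤ y * trunc k δ y := by
  rcases le_total y k with h | h
  · rw [trunc_eq_zero hδ h]; simp
  · have h1 := trunc_le (δ := δ) h
    have h2 := trunc_nonneg hδ (k := k) y
    nlinarith

variable {d : ℕ} {D : Set (Sp d)}

/-- Cauchy–Schwarz for square integrable functions. -/
lemma integral_norm_mul_le {E E' : Type*} [NormedAddCommGroup E] [NormedAddCommGroup E']
    {α : Type*} [MeasurableSpace α] {μ : Measure α} {f : α → E} {g : α → E'}
    (hf : MemLp f 2 μ) (hg : MemLp g 2 μ) :
    ∫ x, ‖f x‖ * ‖g x‖ ∂μ ≤ √(∫ x, ‖f x‖ ^ 2 ∂μ) * √(∫ x, ‖g x‖ ^ 2 ∂μ) := by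
  have := integral_mul_norm_le_Lp_mul_Lq (μ := μ) (f := fun x => ‖f x‖) (g := fun x => ‖g x‖)
    Real.HolderConjugate.two_two (by simpa using hf.norm) (by simpa using hg.norm)
  simpa [Real.sqrt_eq_rpow] using this

/-- Hölder's inequality; the power of the measure is 1 - 2/3. -/
lemma eLpNorm_one_le_three_halves {A : Set (Sp d)} (hA : volume A ≠ ⊤) {z : Sp d → ℝ}
    (hz : AEStronglyMeasurable z (volume.restrict A)) {M : ℝ} (hM : 0 ≤ M)
    (h : eLpNorm z (3 / 2) (volume.restrict A) ≤ ENNReal.ofReal M) (hz0 : ∀ x, 0 ≤ z x) :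
    ∫ x in A, z x ≤ M * (volume.real A) ^ (1 / 3 : ℝ) := by
  have h1 := eLpNorm_le_eLpNorm_mul_rpow_measure_univ (μ := volume.restrict A) (f := z)
    (p := 1) (q := 3 / 2) (by
      rw [ENNReal.le_div_iff_mul_le (by simp) (by simp)]; norm_num) hz
  rw [Measure.restrict_apply_univ, eLpNorm_one_eq_lintegral_enorm] at h1
  have h2 := h1.trans (mul_le_mul_left h _)
  have e : (1 / (1 : ENNReal).toReal - 1 / (3 / 2 : ENNReal).toReal) = (1 / 3 : ℝ) := by
    rw [ENNReal.toReal_div]; norm_num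
  rw [e] at h2
  rw [integral_eq_lintegral_of_nonneg_ae (Eventually.of_forall hz0) hz]
  have h3 : ∫⁻ x in A, ENNReal.ofReal (z x) ≤ ENNReal.ofReal M * volume A ^ (1 / 3 : ℝ) := by
    refine le_trans (le_of_eq (lintegral_congr fun x => ?_)) h2
    rw [← ofReal_norm, Real.norm_of_nonneg (hz0 x)]
  refine (ENNReal.toReal_mono (ENNReal.mul_ne_top ENNReal.ofReal_ne_top
    (ENNReal.rpow_lt_top_of_nonneg (by norm_num) hA).ne) h3).trans (le_of_eq ?_)
  rw [ENNReal.toReal_mul, ENNReal.toReal_ofReal hM, ← ENNReal.toReal_rpow]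
  rfl

/-- With s and g the square roots of `V2` and `G2`, the hypotheses read s² ≤ Kα s g and g² ≤ s m.
Hence s ≤ Kα g, so g ≤ Kα m, and finally s ≤ K²α² m. -/
lemma le_of_sqrt_le_mul {V2 G2 K α m : ℝ} (hV20 : 0 ≤ V2) (hVG : V2 ≤ G2) (hK0 : 0 ≤ K)
    (hα0 : 0 ≤ α) (hm0 : 0 ≤ m) (hV2le : V2 ≤ K * (√V2 * √G2) * α) (hE : G2 ≤ √V2 * m) :
    V2 ≤ K ^ 4 * α ^ 4 * m ^ 2 := by
  have hG0 : 0 ≤ G2 := hV20.trans hVG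
  rcases hV20.eq_or_lt with h0 | hpos
  · rw [← h0]; positivity
  have hs : 0 < √V2 := Real.sqrt_pos.2 hpos
  have hg : 0 < √G2 := Real.sqrt_pos.2 (hpos.trans_le hVG)
  have e1 : √V2 * √V2 = V2 := Real.mul_self_sqrt hV20
  have e2 : √G2 * √G2 = G2 := Real.mul_self_sqrt hG0
  have f1 : √V2 ≤ K * α * √G2 := by
    refine le_of_mul_le_mul_left ?_ hs
    rw [e1]; linarith
  have f2 : √G2 ≤ K * α * m := by
    refine le_of_mul_le_mul_left ?_ hg
    rw [e2]
    calc G2 ≤ √V2 * m := hE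
      _ ≤ (K * α * √G2) * m := by gcongr
      _ = _ := by ring
  have f3 : √V2 ≤ K ^ 2 * α ^ 2 * m := by
    calc √V2 ≤ K * α * √G2 := f1
      _ ≤ K * α * (K * α * m) := by gcongr
      _ = _ := by ring
  calc V2 = √V2 ^ 2 := by rw [pow_two, e1]
    _ ≤ (K ^ 2 * α ^ 2 * m) ^ 2 := by gcongr
    _ = _ := by ring

set_option maxHeartbeats 1000000 in
/-- The decay of the measure of the superlevel sets of a component of a Neumann function. -/
lemma IsSmoothBoundedDomain.exists_level_set_estimate (hd1 : 1 ≤ d) (hd3 : d ≤ 3)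
    (hD : IsSmoothBoundedDomain D) :
    ∃ C : ℝ, 0 ≤ C ∧ ∀ u : Sp d → V3, MemH2 D u → NeumannZero D u →
      ∀ y : V3, ‖y‖ = 1 → ∀ k δ : ℝ, 0 ≤ k → 0 < δ →
      δ ^ 2 * volume.real {x ∈ D | k + 2 * δ < inner ℝ y (u x)} ≤
        C * (volume.real {x ∈ D | k < inner ℝ y (u x)} ^ (1 / 3 : ℝ)) ^ 4 *
          ∫ x in D, ‖u x - laplacian D u x‖ ^ 2 := by
  obtain ⟨ψ, hψ⟩ := hD.smooth_boundary
  obtain ⟨C, hC0, hC⟩ := hψ.exists_sobolev hd1 hd3 hD.isBounded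
  refine ⟨(C * (1 + 2 * d)) ^ 4, by positivity, fun u hu hN y hy k δ hk hδ => ?_⟩
  have hmeas := hD.isOpen.measurableSet
  have hDfin : volume D ≠ ⊤ := hD.isBounded.measure_lt_top.ne
  set P : Fin d → Sp d → V3 := fun i => weakDeriv D i u
  set f : Sp d → V3 := fun x => u x - laplacian D u x with hf
  set A : Set (Sp d) := {x ∈ D | k < inner ℝ y (u x)} with hA
  set w : Sp d → ℝ := fun x => inner ℝ y (u x) with hw
  have mu : MemLp u 2 (volume.restrict D) := hu.memH1.memLp
  have mP (i : Fin d) : MemLp (P i) 2 (volume.restrict D) := hu.memH1.memLp_deriv i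
  have mΔ : MemLp (laplacian D u) 2 (volume.restrict D) :=
    memLp_finsetSum _ fun i _ => (hu.memH1_deriv i).memLp_deriv i
  have mf : MemLp f 2 (volume.restrict D) := mu.sub mΔ
  have dP (i : Fin d) : HasWeakDeriv D i u (P i) :=
    hasWeakDeriv_weakDeriv (hu.memH1.exists_deriv i)
  have dw (i : Fin d) : HasWeakDeriv D i w (fun x => inner ℝ y (P i x)) :=
    (dP i).clm_comp (innerSL ℝ y)
  have mw : MemLp w 2 (volume.restrict D) := (innerSL ℝ y).comp_memLp' mu
  have mPy (i : Fin d) : MemLp (fun x => (inner ℝ y (P i x) : ℝ)) 2 (volume.restrict D) :=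
    (innerSL ℝ y).comp_memLp' (mP i)
  set p := trunc k δ with hp
  set p' : ℝ → ℝ := fun s => Real.smoothTransition ((s - k) / δ) with hp'
  have hp'c : Continuous p' :=
    Real.smoothTransition.continuous.comp ((continuous_id.sub continuous_const).div_const δ)
  have hp'0 : ∀ s, 0 ≤ p' s := fun s => Real.smoothTransition.nonneg _
  have hp'1 : ∀ s, p' s ≤ 1 := fun s => Real.smoothTransition.le_one _
  have hfd : ∀ s t, fderiv ℝ p s t = p' s * t := fun s t => by
    rw [(hasDerivAt_trunc k δ s).hasFDerivAt.fderiv]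
    simp [mul_comm, hp']
  set v : Sp d → ℝ := fun x => p (w x) with hv
  set v' : Fin d → Sp d → ℝ := fun i x => p' (w x) * inner ℝ y (P i x) with hv'
  have dv (i : Fin d) : HasWeakDeriv D i v (v' i) := by
    have := (dw i).comp hD.isOpen (contDiff_trunc k δ) (C := 1) fun s =>
      ContinuousLinearMap.opNorm_le_bound _ zero_le_one fun t => by
        rw [hfd, norm_mul, Real.norm_of_nonneg (hp'0 _)]
        exact mul_le_mul_of_nonneg_right (hp'1 s) (norm_nonneg _)
    simp only [← hp, hfd] at this
    exact this
  have hv0 : ∀ x, 0 ≤ v x := fun x => trunc_nonneg hδ _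
  have hvw : ∀ x, v x ≤ |w x| := fun x => by
    rcases le_total (w x) k with h | h
    · simp only [hv, hp, trunc_eq_zero hδ h]; exact abs_nonneg _
    · have := trunc_le (δ := δ) h
      simp only [hv, hp]
      exact (this.trans (by linarith)).trans (le_abs_self _)
  have mv : MemLp v 2 (volume.restrict D) := by
    refine mw.mono ((contDiff_trunc k δ).continuous.comp_aestronglyMeasurable mw.1)
      (Eventually.of_forall fun x => ?_)
    rw [Real.norm_of_nonneg (hv0 x)]
    exact hvw x
  have mv' (i : Fin d) : MemLp (v' i) 2 (volume.restrict D) := by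
    refine (mPy i).mono ((hp'c.comp_aestronglyMeasurable mw.1).mul (mPy i).1)
      (Eventually.of_forall fun x => ?_)
    rw [norm_mul, Real.norm_of_nonneg (hp'0 _)]
    exact mul_le_of_le_one_left (norm_nonneg _) (hp'1 _)
  -- testing the equation
  set L : ℝ →L[ℝ] V3 := (ContinuousLinearMap.id ℝ ℝ).smulRight y with hL
  have hLin : ∀ (a : V3) (t : ℝ), inner ℝ a (L t) = t * inner ℝ y a := fun a t => by
    simp [hL, inner_smul_right, real_inner_comm]
  have gr := green hD.isBounded hu hN (fun i => (dv i).clm_comp L) (L.comp_memLp' mv)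
    (fun i => L.comp_memLp' (mv' i))
  simp only [hLin] at gr
  set V2 := ∫ x in D, ‖v x‖ ^ 2 with hV2
  set W2 : Fin d → ℝ := fun i => ∫ x in D, ‖v' i x‖ ^ 2 with hW2
  set m := √(∫ x in D, ‖f x‖ ^ 2) with hm
  set G2 := V2 + ∑ i, W2 i with hG2
  have hV20 : 0 ≤ V2 := integral_nonneg fun _ => by positivity
  have hW20 : ∀ i, 0 ≤ W2 i := fun i => integral_nonneg fun _ => by positivity
  have hS0 : 0 ≤ ∑ i, W2 i := Finset.sum_nonneg fun i _ => hW20 i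
  have iv2 : Integrable (fun x => ‖v x‖ ^ 2) (volume.restrict D) := integrable_norm_sq mv
  have mfy : MemLp (fun x => (inner ℝ y (f x) : ℝ)) 2 (volume.restrict D) :=
    (innerSL ℝ y).comp_memLp' mf
  have mΔy : MemLp (fun x => (inner ℝ y (laplacian D u x) : ℝ)) 2 (volume.restrict D) :=
    (innerSL ℝ y).comp_memLp' mΔ
  -- The test function is v y, the truncation of the component of u along y. The zero order term
  -- uses p(s)² ≤ s p(s), where k ≥ 0 matters, and the gradient term uses (p')² ≤ p'.
  have hE : G2 ≤ √V2 * m := by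
    have h1 : ∫ x in D, v x * inner ℝ y (f x) =
        (∫ x in D, v x * w x) - ∫ x in D, v x * inner ℝ y (laplacian D u x) := by
      have j1 : Integrable (fun x => v x * w x) (volume.restrict D) := mv.integrable_mul mw
      have j2 : Integrable (fun x => v x * inner ℝ y (laplacian D u x)) (volume.restrict D) :=
        mv.integrable_mul mΔy
      rw [← integral_sub j1 j2]
      simp only [hf, inner_sub_right, mul_sub, hw]
    have h2 : V2 ≤ ∫ x in D, v x * w x := by
      refine integral_mono iv2 (mv.integrable_mul mw) fun x => ?_
      have := sq_trunc_le hk hδ (w x)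
      simp only [hv, hp, Real.norm_eq_abs, sq_abs]
      linarith
    have h3 : ∑ i, W2 i ≤ ∑ i, ∫ x in D, v' i x * inner ℝ y (P i x) := by
      refine Finset.sum_le_sum fun i _ => integral_mono (integrable_norm_sq (mv' i))
        ((mv' i).integrable_mul (mPy i)) fun x => ?_
      simp only [hv', Real.norm_eq_abs, sq_abs]
      have h0 := hp'0 (w x)
      have h1 := hp'1 (w x)
      have := sq_nonneg (inner ℝ y (P i x))
      nlinarith [mul_nonneg h0 (sub_nonneg.2 h1)]
    have h4 : ∫ x in D, v x * inner ℝ y (f x) ≤ √V2 * m := by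
      refine le_trans ?_ (integral_norm_mul_le mv mf)
      refine integral_mono (mv.integrable_mul mfy) (integrable_norm_mul_norm mv mf) fun x => ?_
      refine (le_abs_self _).trans ?_
      rw [abs_mul]
      refine mul_le_mul_of_nonneg_left ?_ (abs_nonneg _)
      simpa [hy] using abs_real_inner_le_norm y (f x)
    linarith
  -- the Sobolev inequality for `v²`
  have ivv' (i : Fin d) : Integrable (fun x => v x * v' i x) (volume.restrict D) :=
    mv.integrable_mul (mv' i)
  have li {h : Sp d → ℝ} (hi : Integrable h (volume.restrict D)) : LocallyIntegrableOn h D volume :=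
    (memLp_one_iff_integrable.2 hi).locallyIntegrableOn_of_restrict le_rfl
  have dz (i : Fin d) : HasWeakDeriv D i (fun x => v x * v x) (fun x => v' i x * v x + v x * v' i x) :=
    (dv i).mul hD.isOpen (dv i) (li (mv.integrable_mul mv)) (li ((mv' i).integrable_mul mv))
      (li (ivv' i))
  have sob := hC (fun x => v x * v x) _ dz (fun x => mul_self_nonneg _) (mv.integrable_mul mv)
    (fun i => ((mv' i).integrable_mul mv).add (ivv' i))
  have hVG : V2 ≤ G2 := by linarith
  have hG0 : 0 ≤ G2 := hV20.trans hVG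
  have hsobR : C * ((∫ x in D, v x * v x) + ∑ i, ∫ x in D, ‖v' i x * v x + v x * v' i x‖) ≤
      C * (1 + 2 * d) * (√V2 * √G2) := by
    rw [mul_assoc]
    refine mul_le_mul_of_nonneg_left ?_ hC0
    have h1 : ∫ x in D, v x * v x ≤ √V2 * √G2 := by
      have : ∫ x in D, v x * v x = V2 := by
        simp only [hV2, Real.norm_eq_abs, sq_abs]; simp only [pow_two]
      rw [this]
      calc V2 = √V2 * √V2 := (Real.mul_self_sqrt hV20).symm
        _ ≤ √V2 * √G2 := by gcongr
    have h2 (i : Fin d) : ∫ x in D, ‖v' i x * v x + v x * v' i x‖ ≤ 2 * (√V2 * √G2) := by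
      have e : ∀ x, ‖v' i x * v x + v x * v' i x‖ = 2 * (‖v x‖ * ‖v' i x‖) := fun x => by
        rw [mul_comm, ← two_mul, norm_mul, norm_mul]; norm_num
      simp only [e]
      rw [integral_const_mul]
      refine mul_le_mul_of_nonneg_left ((integral_norm_mul_le mv (mv' i)).trans ?_) zero_le_two
      refine mul_le_mul_of_nonneg_left (Real.sqrt_le_sqrt ?_) (Real.sqrt_nonneg _)
      have := Finset.single_le_sum (f := W2) (fun j _ => hW20 j) (Finset.mem_univ i)
      simp only [hW2] at this ⊢
      linarith
    have h3 := Finset.sum_le_sum fun i (_ : i ∈ Finset.univ) => h2 i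
    rw [Finset.sum_const] at h3
    simp only [Finset.card_univ, Fintype.card_fin, nsmul_eq_mul] at h3
    nlinarith
  set K := C * (1 + 2 * d) with hK
  have hK0 : 0 ≤ K := by positivity
  have hAD : A ⊆ D := fun x hx => hx.1
  have hAfin : volume A ≠ ⊤ := ((measure_mono hAD).trans_lt hDfin.lt_top).ne
  set α := volume.real A ^ (1 / 3 : ℝ) with hα
  have hα0 : 0 ≤ α := by positivity
  have hVA : V2 = ∫ x in A, v x * v x := by
    have h1 : V2 = ∫ x in D, v x * v x := by simp only [hV2, Real.norm_eq_abs, sq_abs]; simp only [pow_two]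
    rw [h1]
    have h2 : ∀ x ∈ D \ A, v x * v x = 0 := fun x hx => by
      have : w x ≤ k := not_lt.1 fun h => hx.2 ⟨hx.1, h⟩
      simp only [hv, hp, trunc_eq_zero hδ this, mul_zero]
    exact setIntegral_eq_of_subset_of_forall_sdiff_eq_zero hmeas hAD h2
  -- Since v vanishes off the superlevel set `A`, Hölder on `A` alone gains the factor |A|^{1/3}.
  have hV2le : V2 ≤ K * (√V2 * √G2) * α := by
    rw [hVA]
    refine eLpNorm_one_le_three_halves hAfin
      ((mv.1.mul mv.1).mono_measure (Measure.restrict_mono hAD le_rfl))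
      (by positivity) ?_ fun x => mul_self_nonneg _
    rw [← hVA]
    exact (eLpNorm_mono_measure _ (Measure.restrict_mono hAD le_rfl)).trans
      (sob.trans (ENNReal.ofReal_le_ofReal hsobR))
  -- The resulting power |A|^{4/3} has exponent larger than one, which is what makes the iteration
  -- over levels terminate at a finite height.
  have hfinal : V2 ≤ K ^ 4 * α ^ 4 * m ^ 2 :=
    le_of_sqrt_le_mul hV20 hVG hK0 hα0 (Real.sqrt_nonneg _) hV2le hE
  have hm2 : m ^ 2 = ∫ x in D, ‖f x‖ ^ 2 := Real.sq_sqrt (integral_nonneg fun _ => by positivity)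
  rw [← hm2]
  refine le_trans ?_ hfinal
  -- Chebyshev's inequality
  set A' : Set (Sp d) := {x ∈ D | k + 2 * δ < inner ℝ y (u x)} with hA'
  have hA'D : A' ⊆ D := fun x hx => hx.1
  have hA'fin : volume A' ≠ ⊤ := ((measure_mono hA'D).trans_lt hDfin.lt_top).ne
  have hA'm : NullMeasurableSet A' volume := by
    have h1 : NullMeasurableSet {x | k + 2 * δ < w x} (volume.restrict D) :=
      nullMeasurableSet_lt aemeasurable_const mw.1.aemeasurable
    have h2 := (nullMeasurableSet_restrict hmeas.nullMeasurableSet).1 h1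
    rwa [show A' = {x | k + 2 * δ < w x} ∩ D from by ext x; simp [hA', hw, and_comm]]
  calc δ ^ 2 * volume.real A' = ∫ _ in A', δ ^ 2 := by
        rw [setIntegral_const, smul_eq_mul, mul_comm]
    _ ≤ ∫ x in A', ‖v x‖ ^ 2 := by
        refine integral_mono_ae ?_ (IntegrableOn.mono_set iv2 hA'D) ?_
        · exact integrableOn_const hA'fin
        · refine (ae_restrict_mem₀ hA'm).mono fun x hx => ?_
          have := le_trunc hδ hx.2.le
          show δ ^ 2 ≤ ‖v x‖ ^ 2
          rw [Real.norm_of_nonneg (hv0 x)]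
          exact pow_le_pow_left₀ hδ.le this 2
    _ ≤ V2 := setIntegral_mono_set iv2 (Eventually.of_forall fun _ => by positivity)
        hA'D.eventuallyLE

end Stampacchia

end

end LLB

open MeasureTheory Filter Topology Set
open scoped ContDiff
set_option linter.unusedSectionVars false

namespace LLB

noncomputable section

/-! ### Boundedness of Neumann functions in H². -/

section Boundedness

/-- Stampacchia's iteration lemma. -/
lemma eq_zero_of_level_estimate {a : ℝ → ℝ} (ha0 : ∀ k, 0 ≤ a k) (hanti : Antitone a) {Q β L : ℝ}
    (hQ : 0 ≤ Q) (hL : 0 < L)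
    (h : ∀ k δ : ℝ, 0 ≤ k → 0 < δ → δ ^ 2 * a (k + 2 * δ) ≤ Q * (a k ^ (1 / 3 : ℝ)) ^ 4)
    (hβ : a 0 ^ (1 / 3 : ℝ) ≤ β) (hLQ : 1024 * Q * β ≤ L ^ 2) : a L = 0 := by
  -- The levels increase from 0 towards L with gaps halving at each step. Working with cube roots
  -- turns the fractional exponent 4/3 into integer powers.
  set b : ℕ → ℝ := fun n => a (L - L / 2 ^ n) ^ (1 / 3 : ℝ) with hb
  have hb0 : ∀ n, 0 ≤ b n := fun n => Real.rpow_nonneg (ha0 _) _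
  have hb3 : ∀ n, b n ^ 3 = a (L - L / 2 ^ n) := fun n => by
    simp only [hb]
    rw [← Real.rpow_natCast, ← Real.rpow_mul (ha0 _)]
    norm_num
  have hβ0 : 0 ≤ β := (Real.rpow_nonneg (ha0 0) _).trans hβ
  have hL2 : 0 < L ^ 2 := by positivity
  -- The induction closes because the gap δ = L/2^(n+2) contributes 16 · 4ⁿ/L² and the target ratio
  -- 1/4 costs 4³; the product 16 · 64 is the constant 1024.
  have key : ∀ n, b n ≤ β / 4 ^ n := by
    intro n
    induction n with
    | zero => simpa [hb] using hβ
    | succ n ih =>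
      have h1 := h (L - L / 2 ^ n) (L / 2 ^ (n + 2))
        (sub_nonneg.2 (div_le_self hL.le (one_le_pow₀ one_le_two))) (by positivity)
      have e1 : L - L / 2 ^ n + 2 * (L / 2 ^ (n + 2)) = L - L / 2 ^ (n + 1) := by
        field_simp; ring
      rw [e1, ← hb3 (n + 1)] at h1
      have h2 : (L / 2 ^ (n + 2)) ^ 2 * b (n + 1) ^ 3 ≤ Q * (β / 4 ^ n) ^ 4 :=
        h1.trans (by gcongr; exact hb0 n)
      refine le_of_pow_le_pow_left₀ three_ne_zero (by positivity) ?_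
      have e2 : (L / 2 ^ (n + 2)) ^ 2 = L ^ 2 / (16 * 4 ^ n) := by
        rw [div_pow, ← pow_mul, mul_comm, pow_mul, pow_add]; norm_num; ring
      rw [e2, div_mul_eq_mul_div, div_le_iff₀ (by positivity)] at h2
      have e3 : Q * (β / 4 ^ n) ^ 4 * (16 * 4 ^ n) = (1024 * Q * β) * (β / 4 ^ (n + 1)) ^ 3 := by
        rw [pow_succ]; field_simp; ring
      rw [e3] at h2
      exact le_of_mul_le_mul_left (h2.trans (mul_le_mul_of_nonneg_right hLQ (by positivity))) hL2
  have lim : Tendsto (fun n : ℕ => (β / 4 ^ n) ^ 3) atTop (𝓝 0) := by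
    have h1 : Tendsto (fun n : ℕ => β / 4 ^ n) atTop (𝓝 0) :=
      tendsto_const_nhds.div_atTop (tendsto_pow_atTop_atTop_of_one_lt (by norm_num))
    simpa using h1.pow 3
  refine le_antisymm (ge_of_tendsto lim (Eventually.of_forall fun n => ?_)) (ha0 L)
  calc a L ≤ a (L - L / 2 ^ n) := hanti (sub_le_self _ (by positivity))
    _ = b n ^ 3 := (hb3 n).symm
    _ ≤ _ := pow_le_pow_left₀ (hb0 n) (key n) 3

variable {d : ℕ} {D : Set (Sp d)}

/-- Functions of `H²` with homogeneous Neumann boundary condition are bounded. -/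
theorem IsSmoothBoundedDomain.exists_norm_le (hd1 : 1 ≤ d) (hd3 : d ≤ 3)
    (hD : IsSmoothBoundedDomain D) :
    ∃ C : ℝ, 0 ≤ C ∧ ∀ u : Sp d → V3, MemH2 D u → NeumannZero D u →
      ∀ M : ℝ, 0 < M → ∫ x in D, ‖u x - laplacian D u x‖ ^ 2 ≤ M ^ 2 →
      ∀ᵐ x ∂(volume.restrict D), ‖u x‖ ≤ C * M := by
  obtain ⟨C, hC0, hC⟩ := hD.exists_level_set_estimate hd1 hd3
  have hDfin : volume D ≠ ⊤ := hD.isBounded.measure_lt_top.ne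
  set β := volume.real D ^ (1 / 3 : ℝ) with hβ
  have hβ0 : 0 ≤ β := by positivity
  set R := √(1024 * C * β + 1) with hR
  have hR0 : 0 < R := Real.sqrt_pos.2 (by positivity)
  have hR2 : R ^ 2 = 1024 * C * β + 1 := Real.sq_sqrt (by positivity)
  refine ⟨3 * R, by positivity, fun u hu hN M hM hf => ?_⟩
  -- The scaling L = RM makes the smallness condition independent of M: `Q` is CM², and R² exceeds
  -- 1024Cβ, with the added 1 ensuring R > 0. The directions ±eⱼ then bound all components.
  have bound : ∀ y : V3, ‖y‖ = 1 → ∀ᵐ x ∂(volume.restrict D), inner ℝ y (u x) ≤ R * M := by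
    intro y hy
    have hfin (k : ℝ) : volume {x ∈ D | k < inner ℝ y (u x)} ≠ ⊤ :=
      ((measure_mono fun x hx => hx.1).trans_lt hDfin.lt_top).ne
    have hz := eq_zero_of_level_estimate
      (a := fun k => volume.real {x ∈ D | k < inner ℝ y (u x)}) (Q := C * M ^ 2) (β := β)
      (L := R * M) (fun _ => measureReal_nonneg)
      (fun k l hkl => measureReal_mono (fun x hx => ⟨hx.1, hkl.trans_lt hx.2⟩) (hfin k))
      (by positivity) (by positivity) (fun k δ hk hδ => ?_) ?_ ?_
    · have h0 : volume {x ∈ D | R * M < inner ℝ y (u x)} = 0 :=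
        (measureReal_eq_zero_iff (hfin _)).1 hz
      rw [ae_restrict_iff' hD.isOpen.measurableSet, ae_iff]
      convert h0 using 2
      ext x
      simp
    · refine (hC u hu hN y hy k δ hk hδ).trans ?_
      calc _ ≤ C * (volume.real {x ∈ D | k < inner ℝ y (u x)} ^ (1 / 3 : ℝ)) ^ 4 * M ^ 2 := by
            gcongr
        _ = _ := by ring
    · exact Real.rpow_le_rpow measureReal_nonneg (measureReal_mono (fun x hx => hx.1) hDfin)
        (by norm_num)
    · rw [mul_pow, hR2]
      nlinarith [sq_nonneg M]
  have hcomp (j : Fin 3) : ∀ᵐ x ∂(volume.restrict D), |u x j| ≤ R * M := by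
    filter_upwards [bound (EuclideanSpace.single j 1) (by simp),
      bound (-EuclideanSpace.single j 1) (by simp)] with x h1 h2
    simp only [inner_neg_left, EuclideanSpace.inner_single_left, map_one, one_mul] at h1 h2
    exact abs_le.2 ⟨by linarith, h1⟩
  filter_upwards [ae_all_iff.2 hcomp] with x hx
  rw [EuclideanSpace.norm_eq, Fin.sum_univ_three]
  refine Real.sqrt_le_iff.2 ⟨by positivity, ?_⟩
  have h (j : Fin 3) : ‖u x j‖ ^ 2 ≤ (R * M) ^ 2 := pow_le_pow_left₀ (norm_nonneg _) (hx j) 2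
  nlinarith [h 0, h 1, h 2, sq_nonneg (R * M)]

end Boundedness

end

end LLB

open MeasureTheory Filter Topology Set
open scoped ContDiff
set_option linter.unusedSectionVars false

namespace LLB

noncomputable section

/-! ### Vector-valued functions of time and decay along curves. -/

section Time

/-- A sequence of bump functions on the line concentrating at the origin. -/
def timeBump (n : ℕ) : ContDiffBump (0 : ℝ) where
  rIn := 1 / (2 * (n + 1))
  rOut := 1 / (n + 1)
  rIn_pos := by positivity
  rIn_lt_rOut := by
    apply one_div_lt_one_div_of_lt <;> [positivity; nlinarith [(Nat.cast_nonneg n : (0 : ℝ) ≤ n)]]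

lemma tendsto_timeBump_rOut : Tendsto (fun n => (timeBump n).rOut) atTop (𝓝 0) :=
  tendsto_one_div_add_atTop_nhds_zero_nat

/-- A smooth approximation of the indicator function of `(s,t)`. -/
def timeCutoff (n : ℕ) (s t r : ℝ) : ℝ :=
  ∫ x in (s - r)..(t - r), (timeBump n).normed volume x

lemma timeBump_normed_eq_zero {n : ℕ} {x : ℝ} (hx : (timeBump n).rOut ≤ |x|) :
    (timeBump n).normed volume x = 0 := by
  rw [← Function.notMem_support, ContDiffBump.support_normed_eq]
  simpa using hx

lemma contDiff_primitive {f : ℝ → ℝ} (hf : ContDiff ℝ ∞ f) :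
    ContDiff ℝ ∞ (fun x => ∫ y in (0 : ℝ)..x, f y) := by
  have h (x : ℝ) : HasDerivAt (fun x => ∫ y in (0 : ℝ)..x, f y) (f x) x :=
    (hf.continuous.integral_hasStrictDerivAt 0 x).hasDerivAt
  rw [contDiff_infty_iff_deriv]
  refine ⟨fun x => (h x).differentiableAt, ?_⟩
  rwa [show deriv (fun x => ∫ y in (0 : ℝ)..x, f y) = f from funext fun x => (h x).deriv]

lemma timeCutoff_eq (n : ℕ) (s t r : ℝ) :
    timeCutoff n s t r = (∫ x in (0 : ℝ)..(t - r), (timeBump n).normed volume x)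
      - ∫ x in (0 : ℝ)..(s - r), (timeBump n).normed volume x :=
  (intervalIntegral.integral_interval_sub_left
    ((timeBump n).continuous_normed.intervalIntegrable _ _)
    ((timeBump n).continuous_normed.intervalIntegrable _ _)).symm

lemma contDiff_timeCutoff (n : ℕ) (s t : ℝ) : ContDiff ℝ ∞ (timeCutoff n s t) := by
  have h := contDiff_primitive ((timeBump n).contDiff_normed (μ := volume) (n := ⊤))
  rw [show timeCutoff n s t = _ from funext (timeCutoff_eq n s t)]
  exact (h.comp (contDiff_const.sub contDiff_id)).sub (h.comp (contDiff_const.sub contDiff_id))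

lemma deriv_timeCutoff (n : ℕ) (s t r : ℝ) : deriv (timeCutoff n s t) r =
    (timeBump n).normed volume (s - r) - (timeBump n).normed volume (t - r) := by
  have h (a : ℝ) : HasDerivAt (fun r => ∫ x in (0 : ℝ)..(a - r), (timeBump n).normed volume x)
      (-(timeBump n).normed volume (a - r)) r := by
    have h1 := ((timeBump n).continuous_normed (μ := volume)).integral_hasStrictDerivAt 0 (a - r)
    have h2 := h1.hasDerivAt.comp r ((hasDerivAt_id r).const_sub a)
    rwa [mul_neg_one] at h2
  rw [show timeCutoff n s t = _ from funext (timeCutoff_eq n s t)]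
  have := ((h t).sub (h s)).deriv
  simp only [Pi.sub_def] at this
  rw [this]
  ring

lemma timeCutoff_nonneg (n : ℕ) {s t : ℝ} (hst : s ≤ t) (r : ℝ) : 0 ≤ timeCutoff n s t r :=
  intervalIntegral.integral_nonneg (by linarith) fun _ _ => (timeBump n).nonneg_normed _

lemma timeCutoff_le_one (n : ℕ) {s t : ℝ} (hst : s ≤ t) (r : ℝ) : timeCutoff n s t r ≤ 1 := by
  rw [timeCutoff, intervalIntegral.integral_of_le (by linarith)]
  exact (setIntegral_le_integral (timeBump n).integrable_normed
    (Eventually.of_forall fun _ => (timeBump n).nonneg_normed _)).trans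
    (timeBump n).integral_normed.le

lemma timeCutoff_eq_zero {n : ℕ} {s t r : ℝ}
    (h : r ≤ s - (timeBump n).rOut ∨ t + (timeBump n).rOut ≤ r) (hst : s ≤ t) :
    timeCutoff n s t r = 0 := by
  rw [timeCutoff, intervalIntegral.integral_congr (g := fun _ => 0)]
  · simp
  · intro x hx
    rw [uIcc_of_le (by linarith)] at hx
    apply timeBump_normed_eq_zero
    rcases h with h | h
    · exact (by linarith [hx.1] : _ ≤ x).trans (le_abs_self x)
    · exact (by linarith [hx.2] : _ ≤ -x).trans (neg_le_abs x)

lemma timeCutoff_eq_one {n : ℕ} {s t r : ℝ} (h1 : s + (timeBump n).rOut ≤ r)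
    (h2 : r ≤ t - (timeBump n).rOut) : timeCutoff n s t r = 1 := by
  have hp := (timeBump n).rOut_pos
  rw [timeCutoff, ← (timeBump n).integral_normed (μ := volume),
    intervalIntegral.integral_eq_integral_of_support_subset]
  intro x hx
  rw [ContDiffBump.support_normed_eq, Real.ball_eq_Ioo] at hx
  exact ⟨by linarith [hx.1], by linarith [hx.2]⟩

lemma tendsto_timeCutoff {s t r : ℝ} (hst : s ≤ t) (hs : r ≠ s) (ht : r ≠ t) :
    Tendsto (fun n => timeCutoff n s t r) atTop (𝓝 ((Ioc s t).indicator 1 r)) := by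
  refine tendsto_const_nhds.congr' ?_
  have small {δ : ℝ} (hδ : 0 < δ) : ∀ᶠ n in atTop, (timeBump n).rOut < δ :=
    tendsto_timeBump_rOut.eventually (gt_mem_nhds hδ)
  rcases lt_or_gt_of_ne hs with h | h
  · filter_upwards [small (sub_pos.2 h)] with n hn
    rw [timeCutoff_eq_zero (Or.inl (by linarith)) hst, indicator_of_notMem]
    exact fun h' => h.not_gt h'.1
  rcases lt_or_gt_of_ne ht with h' | h'
  · filter_upwards [small (sub_pos.2 h), small (sub_pos.2 h')] with n h1 h2
    rw [timeCutoff_eq_one (by linarith) (by linarith),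
      indicator_of_mem (show r ∈ Ioc s t from ⟨h, h'.le⟩), Pi.one_apply]
  · filter_upwards [small (sub_pos.2 h')] with n hn
    rw [timeCutoff_eq_zero (Or.inr (by linarith)) hst, indicator_of_notMem]
    exact fun h => h'.not_ge h.2

variable {X : Type*} [NormedAddCommGroup X] [NormedSpace ℝ X] [CompleteSpace X]

lemma tendsto_integral_timeBump {T : ℝ} {u : ℝ → X} (hu : ContinuousOn u (Icc 0 T)) {s : ℝ}
    (hs : s ∈ Ioo 0 T) :
    Tendsto (fun n => ∫ r in Ioo 0 T, (timeBump n).normed volume (s - r) • u r) atTop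
      (𝓝 (u s)) := by
  have hT : (0 : ℝ) ≤ T := (hs.1.trans hs.2).le
  -- Constant extension beyond [0,T] makes the function continuous on the line; near an interior
  -- time the bump does not see the extension.
  set v : ℝ → X := IccExtend hT ((Icc 0 T).domRestrict u) with hv
  have hvc : Continuous v := (continuousOn_iff_continuous_domRestrict.1 hu).Icc_extend'
  have hvu {r : ℝ} (hr : r ∈ Icc 0 T) : v r = u r := by simp [hv, IccExtend_of_mem hT _ hr, Set.domRestrict]
  have h1 := ContDiffBump.convolution_tendsto_right_of_continuous (μ := volume)
    tendsto_timeBump_rOut hvc s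
  rw [hvu (Ioo_subset_Icc_self hs)] at h1
  refine h1.congr' ?_
  filter_upwards [tendsto_timeBump_rOut.eventually (gt_mem_nhds (lt_min hs.1 (sub_pos.2 hs.2)))]
    with n hn
  rw [lt_min_iff] at hn
  rw [convolution_lsmul_swap]
  rw [← setIntegral_eq_integral_of_forall_compl_eq_zero (s := Ioo 0 T)]
  · exact setIntegral_congr_fun measurableSet_Ioo fun r hr => by
      simp only [hvu (Ioo_subset_Icc_self hr)]
  · intro r hr
    rw [timeBump_normed_eq_zero, zero_smul]
    by_contra! h
    rw [abs_lt] at h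
    exact hr ⟨by linarith [hn.1, h.2], by linarith [hn.2, h.1]⟩

lemma HasH1TimeDeriv.integrableOn_deriv {T : ℝ} {u u' : ℝ → X} (h : HasH1TimeDeriv T u u') :
    IntegrableOn u' (Ioo 0 T) :=
  h.memLp_deriv.integrable one_le_two

lemma HasH1TimeDeriv.intervalIntegrable {T : ℝ} {u u' : ℝ → X} (h : HasH1TimeDeriv T u u')
    {s t : ℝ} (hs : s ∈ Icc 0 T) (ht : t ∈ Icc 0 T) : IntervalIntegrable u' volume s t := by
  rw [intervalIntegrable_iff]
  refine ((integrableOn_Icc_iff_integrableOn_Ioo (by finiteness) (by finiteness)).2 h.integrableOn_deriv).mono_set ?_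
  exact uIoc_subset_uIcc.trans ((convex_Icc 0 T).ordConnected.uIcc_subset hs ht)

/-- A function in `H¹(0,T; X)` and `C([0,T]; X)` is the integral of its weak derivative. -/
lemma HasH1TimeDeriv.sub_eq_integral_of_mem_Ioo {T : ℝ} {u u' : ℝ → X} (h : HasH1TimeDeriv T u u')
    (hu : ContinuousOn u (Icc 0 T)) {s t : ℝ} (hs : s ∈ Ioo 0 T) (ht : t ∈ Ioo 0 T)
    (hst : s ≤ t) : u t - u s = ∫ r in s..t, u' r := by
  have hui : IntegrableOn u (Ioo 0 T) := (hu.integrableOn_Icc).mono_set Ioo_subset_Icc_self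
  -- The weak identity is tested with a smoothed indicator of (s,t). Its derivative is a bump at s
  -- minus a bump at t, so one side tends to u(s) - u(t) and the other to minus the integral of u'
  -- over (s,t].
  have lhs : Tendsto (fun n => ∫ r in Ioo 0 T, deriv (timeCutoff n s t) r • u r) atTop
      (𝓝 (u s - u t)) := by
    refine ((tendsto_integral_timeBump hu hs).sub (tendsto_integral_timeBump hu ht)).congr
      fun n => ?_
    have hi (a : ℝ) : IntegrableOn (fun r => (timeBump n).normed volume (a - r) • u r)
        (Ioo 0 T) := by
      have hc : Continuous fun r => (timeBump n).normed volume (a - r) :=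
        (timeBump n).continuous_normed.comp (continuous_const.sub continuous_id)
      exact ((hc.continuousOn.smul hu).integrableOn_Icc).mono_set Ioo_subset_Icc_self
    rw [← integral_sub (hi s) (hi t)]
    simp only [deriv_timeCutoff, sub_smul]
  have rhs : Tendsto (fun n => ∫ r in Ioo 0 T, timeCutoff n s t r • u' r) atTop
      (𝓝 (∫ r in Ioo 0 T, (Ioc s t).indicator (1 : ℝ → ℝ) r • u' r)) := by
    refine tendsto_integral_of_dominated_convergence (fun r => ‖u' r‖) (fun n => ?_)
      h.integrableOn_deriv.norm (fun n => ?_) ?_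
    · exact (contDiff_timeCutoff n s t).continuous.aestronglyMeasurable.smul
        h.integrableOn_deriv.aestronglyMeasurable
    · refine Eventually.of_forall fun r => ?_
      rw [norm_smul, Real.norm_of_nonneg (timeCutoff_nonneg n hst r)]
      exact mul_le_of_le_one_left (norm_nonneg _) (timeCutoff_le_one n hst r)
    · have : ∀ᵐ r : ℝ, r ≠ s ∧ r ≠ t := by
        filter_upwards [Measure.ae_ne volume s, Measure.ae_ne volume t] with r h1 h2
          using ⟨h1, h2⟩
      filter_upwards [ae_restrict_of_ae this] with r hr
      exact (tendsto_timeCutoff hst hr.1 hr.2).smul_const _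
  have key : u s - u t = -∫ r in Ioo 0 T, (Ioc s t).indicator (1 : ℝ → ℝ) r • u' r := by
    refine tendsto_nhds_unique lhs (rhs.neg.congr' ?_)
    filter_upwards [tendsto_timeBump_rOut.eventually
      (gt_mem_nhds (lt_min hs.1 (sub_pos.2 ht.2)))] with n hn
    rw [lt_min_iff] at hn
    have hsupp : tsupport (timeCutoff n s t) ⊆
        Icc (s - (timeBump n).rOut) (t + (timeBump n).rOut) := by
      refine closure_minimal (fun r hr => ?_) isClosed_Icc
      by_contra hr'
      rw [mem_Icc, not_and_or, not_le, not_le] at hr'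
      exact hr (timeCutoff_eq_zero (hr'.imp le_of_lt le_of_lt) hst)
    rw [h.integral_eq _ (contDiff_timeCutoff n s t)
      (isCompact_Icc.of_isClosed_subset (isClosed_tsupport _) hsupp)]
    exact hsupp.trans (Icc_subset_Ioo (by linarith) (by linarith))
  have e : ∫ r in Ioo 0 T, (Ioc s t).indicator (1 : ℝ → ℝ) r • u' r = ∫ r in s..t, u' r := by
    rw [intervalIntegral.integral_of_le hst]
    have : (fun r => (Ioc s t).indicator (1 : ℝ → ℝ) r • u' r) = (Ioc s t).indicator u' := by
      ext r
      by_cases hr : r ∈ Ioc s t <;> simp [hr]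
    rw [this, setIntegral_indicator measurableSet_Ioc, inter_eq_right.2]
    exact fun r hr => ⟨hs.1.trans hr.1, hr.2.trans_lt ht.2⟩
  rw [← e, ← neg_sub, key, neg_neg]

/-- The interior identity makes u minus the primitive of u' constant on (0,T), and continuity
carries this to both endpoints, where no test function is available. -/
lemma HasH1TimeDeriv.eq_add_integral {T : ℝ} (hT : 0 < T) {u u' : ℝ → X}
    (h : HasH1TimeDeriv T u u') (hu : ContinuousOn u (Icc 0 T)) {t : ℝ} (ht : t ∈ Icc 0 T) :
    u t = u 0 + ∫ r in (0 : ℝ)..t, u' r := by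
  have hT2 : T / 2 ∈ Ioo 0 T := ⟨by linarith, by linarith⟩
  have hi0 := h.intervalIntegrable (left_mem_Icc.2 hT.le) (right_mem_Icc.2 hT.le)
  have hcont : ContinuousOn (fun t => u t - ∫ r in (0 : ℝ)..t, u' r) (Icc 0 T) := by
    refine hu.sub ?_
    have := intervalIntegral.continuousOn_primitive_interval (μ := volume) (f := u') (a := 0)
      (b := T) (by rw [uIcc_of_le hT.le]; exact (integrableOn_Icc_iff_integrableOn_Ioo (by finiteness) (by finiteness)).2
                    h.integrableOn_deriv)
    rwa [uIcc_of_le hT.le] at this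
  have hconst : EqOn (fun t => u t - ∫ r in (0 : ℝ)..t, u' r)
      (fun _ => u (T / 2) - ∫ r in (0 : ℝ)..(T / 2), u' r) (Ioo 0 T) := by
    intro t ht
    have hz : (0 : ℝ) ∈ Icc 0 T := left_mem_Icc.2 hT.le
    have ha := intervalIntegral.integral_interval_sub_left
      (h.intervalIntegrable hz (Ioo_subset_Icc_self ht))
      (h.intervalIntegrable hz (Ioo_subset_Icc_self hT2))
    have hb := intervalIntegral.integral_symm (μ := volume) (f := u') (T / 2) t
    have : u t - u (T / 2) = ∫ r in (T / 2)..t, u' r := by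
      rcases le_total t (T / 2) with hle | hle
      · have := h.sub_eq_integral_of_mem_Ioo hu ht hT2 hle
        rw [hb] at this
        rw [← neg_sub, this, neg_neg]
      · exact h.sub_eq_integral_of_mem_Ioo hu hT2 ht hle
    rw [← ha] at this
    simp only
    rw [sub_eq_sub_iff_add_eq_add] at this ⊢
    rw [this]; abel
  have hall := hconst.of_subset_closure hcont continuousOn_const Ioo_subset_Icc_self
    (by rw [closure_Ioo hT.ne])
  have h1 := hall ht
  have h0 := hall (left_mem_Icc.2 hT.le)
  simp only [intervalIntegral.integral_same, sub_zero] at h0 h1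
  rw [← h0, sub_eq_iff_eq_add] at h1
  exact h1

lemma HasH1TimeDeriv.sub_eq_integral {T : ℝ} (hT : 0 < T) {u u' : ℝ → X}
    (h : HasH1TimeDeriv T u u') (hu : ContinuousOn u (Icc 0 T)) {s t : ℝ} (hs : s ∈ Icc 0 T)
    (ht : t ∈ Icc 0 T) : u t - u s = ∫ r in s..t, u' r := by
  have hz : (0 : ℝ) ∈ Icc 0 T := left_mem_Icc.2 hT.le
  rw [h.eq_add_integral hT hu ht, h.eq_add_integral hT hu hs, add_sub_add_left_eq_sub,
    intervalIntegral.integral_interval_sub_left (h.intervalIntegrable hz ht)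
      (h.intervalIntegrable hz hs)]

lemma HasH1TimeDeriv.ae_hasDerivAt {T : ℝ} (hT : 0 < T) {u u' : ℝ → X}
    (h : HasH1TimeDeriv T u u') (hu : ContinuousOn u (Icc 0 T)) :
    ∀ᵐ t ∂(volume.restrict (Ioo 0 T)), HasDerivAt u (u' t) t := by
  have hz : (0 : ℝ) ∈ Icc 0 T := left_mem_Icc.2 hT.le
  rw [ae_restrict_iff' measurableSet_Ioo]
  filter_upwards [(h.intervalIntegrable hz (right_mem_Icc.2 hT.le)).ae_hasDerivAt_integral]
    with t ht htT
  rw [uIcc_of_le hT.le] at ht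
  have h1 := (ht (Ioo_subset_Icc_self htT) 0 hz).const_add (u 0)
  refine h1.congr_of_eventuallyEq ?_
  filter_upwards [Ioo_mem_nhds htT.1 htT.2] with r hr
  exact h.eq_add_integral hT hu (Ioo_subset_Icc_self hr)

/-- A set of full measure meets every nonempty open subset of the interval. This converts properties
valid at almost every time into closed properties valid at every time. -/
lemma Icc_subset_closure_of_ae {T : ℝ} (hT : 0 < T) {p : ℝ → Prop}
    (h : ∀ᵐ t ∂(volume.restrict (Ioo 0 T)), p t) :
    Icc 0 T ⊆ closure {t | t ∈ Ioo 0 T ∧ p t} := by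
  rw [← closure_Ioo hT.ne]
  refine closure_minimal (fun t ht => ?_) isClosed_closure
  rw [mem_closure_iff_nhds]
  intro V hV
  by_contra hne
  rw [not_nonempty_iff_eq_empty] at hne
  have hV' : interior V ∩ Ioo 0 T ∈ 𝓝 t :=
    inter_mem (interior_mem_nhds.2 hV) (Ioo_mem_nhds ht.1 ht.2)
  have hpos := Measure.measure_pos_of_mem_nhds volume hV'
  rw [ae_restrict_iff' measurableSet_Ioo] at h
  refine hpos.ne' (measure_mono_null (fun r hr => ?_) h)
  intro hr'
  exact (Set.ext_iff.1 hne r).1 ⟨interior_subset hr.1, hr.2, hr' hr.2⟩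

/-- Exponential decay of a functional along a curve of bounded variation in a Hilbert space, under
a subgradient inequality at almost every time. -/
lemma le_exp_mul_of_subgradient {X : Type*} [NormedAddCommGroup X] [InnerProductSpace ℝ X]
    {T lam C : ℝ} (hT : 0 < T) {Φ m : ℝ → ℝ} {w : ℝ → X} (hC : 0 ≤ C)
    (hΦ : ContinuousOn Φ (Icc 0 T))
    (hm : IntegrableOn m (Ioo 0 T))
    (hw : ∀ s ∈ Icc 0 T, ∀ t ∈ Icc 0 T, s ≤ t → ‖w t - w s‖ ≤ ∫ r in s..t, m r)
    (h : ∀ᵐ t ∂(volume.restrict (Ioo 0 T)), ∃ g w' : X, ‖g‖ ≤ C ∧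
      (∀ s ∈ Icc 0 T, Φ t - Φ s ≤ inner ℝ g (w t - w s)) ∧ HasDerivAt w w' t ∧
      inner ℝ g w' ≤ -(lam * Φ t)) {t : ℝ} (ht : t ∈ Icc 0 T) :
    Φ t ≤ Real.exp (-(lam * t)) * Φ 0 := by
  have hz : (0 : ℝ) ∈ Icc 0 T := left_mem_Icc.2 hT.le
  have hmI : IntegrableOn m (Icc 0 T) := (integrableOn_Icc_iff_integrableOn_Ioo (by finiteness) (by finiteness)).2 hm
  have hmi {s t : ℝ} (hs : s ∈ Icc 0 T) (ht : t ∈ Icc 0 T) : IntervalIntegrable m volume s t := by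
    rw [intervalIntegrable_iff]
    exact hmI.mono_set
      (uIoc_subset_uIcc.trans ((convex_Icc 0 T).ordConnected.uIcc_subset hs ht))
  set P : ℝ → ℝ := fun t => ∫ r in (0 : ℝ)..t, m r with hP
  have hPw {s t : ℝ} (hs : s ∈ Icc 0 T) (ht : t ∈ Icc 0 T) : ‖w t - w s‖ ≤ |P t - P s| := by
    have e {s t : ℝ} (hs : s ∈ Icc 0 T) (ht : t ∈ Icc 0 T) : P t - P s = ∫ r in s..t, m r :=
      intervalIntegral.integral_interval_sub_left (hmi hz ht) (hmi hz hs)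
    rcases le_total s t with hst | hst
    · rw [e hs ht]; exact (hw s hs t ht hst).trans (le_abs_self _)
    · rw [norm_sub_rev, abs_sub_comm, e ht hs]; exact (hw t ht s hs hst).trans (le_abs_self _)
  have hPc : ContinuousOn P (Icc 0 T) := by
    have := intervalIntegral.continuousOn_primitive_interval (μ := volume) (f := m) (a := 0)
      (b := T) (by rwa [uIcc_of_le hT.le])
    rwa [uIcc_of_le hT.le] at this
  obtain ⟨N, hN, hNsub⟩ : ∃ N : Set ℝ, N ⊆ Icc 0 T ∧ Icc 0 T ⊆ closure N ∧ ∀ t ∈ N,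
      ∃ g w' : X, ‖g‖ ≤ C ∧
      (∀ s ∈ Icc 0 T, Φ t - Φ s ≤ inner ℝ g (w t - w s)) ∧ HasDerivAt w w' t ∧
      inner ℝ g w' ≤ -(lam * Φ t) := by
    exact ⟨_, fun t ht => Ioo_subset_Icc_self ht.1, Icc_subset_closure_of_ae hT h,
      fun t ht => ht.2⟩
  have step1 : ∀ t ∈ N, ∀ s ∈ Icc 0 T, Φ t - Φ s ≤ C * |P t - P s| := by
    intro t htN s hs
    obtain ⟨g, w', hg, h1, -⟩ := hNsub.2 t htN
    calc Φ t - Φ s ≤ inner ℝ g (w t - w s) := h1 s hs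
      _ ≤ ‖g‖ * ‖w t - w s‖ := real_inner_le_norm _ _
      _ ≤ C * |P t - P s| := by gcongr; exact hPw hs (hN htN)
  -- Both sides are continuous in t, so the bound extends from the dense set `N` to all times.
  -- Exchanging s and t then makes Φ Lipschitz with respect to the absolutely continuous `P`, and so
  -- absolutely continuous itself.
  have step2 : ∀ t ∈ Icc 0 T, ∀ s ∈ Icc 0 T, Φ t - Φ s ≤ C * |P t - P s| := by
    intro t ht s hs
    obtain ⟨x, hxN, hx⟩ := mem_closure_iff_seq_limit.1 (hNsub.1 ht)
    have hx' : Tendsto x atTop (𝓝[Icc 0 T] t) :=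
      tendsto_nhdsWithin_iff.2 ⟨hx, Eventually.of_forall fun n => hN (hxN n)⟩
    have c1 := (hΦ t ht).tendsto.comp hx'
    have c2 := (hPc t ht).tendsto.comp hx'
    exact le_of_tendsto_of_tendsto' (c1.sub_const _) (((c2.sub_const (P s)).abs).const_mul C)
      fun n => step1 _ (hxN n) s hs
  have step3 {s t : ℝ} (hs : s ∈ Icc 0 T) (ht : t ∈ Icc 0 T) :
      dist (Φ s) (Φ t) ≤ C * dist (P s) (P t) := by
    rw [Real.dist_eq, Real.dist_eq, abs_le]
    have h1 := step2 s hs t ht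
    have h2 := step2 t ht s hs
    rw [abs_sub_comm] at h2
    exact ⟨by linarith, h1⟩
  have hPac : AbsolutelyContinuousOnInterval P 0 T :=
    (hmi hz (right_mem_Icc.2 hT.le)).absolutelyContinuousOnInterval_intervalIntegral
      (by rw [uIcc_of_le hT.le]; exact hz)
  have hΦac : AbsolutelyContinuousOnInterval Φ 0 T := by
    have h1 := Tendsto.const_mul C hPac
    rw [mul_zero] at h1
    refine squeeze_zero' (Eventually.of_forall fun E => Finset.sum_nonneg fun _ _ => dist_nonneg)
      ?_ h1
    filter_upwards [mem_inf_of_right (mem_principal_self _)] with E hE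
    rw [Finset.mul_sum]
    refine Finset.sum_le_sum fun i hi => ?_
    have := hE.1 i hi
    rw [uIcc_of_le hT.le] at this
    exact step3 this.1 this.2
  have hsub : uIcc 0 t ⊆ uIcc 0 T := by
    rw [uIcc_of_le ht.1, uIcc_of_le hT.le]; exact Icc_subset_Icc_right ht.2
  set Ψ : ℝ → ℝ := fun t => Real.exp (lam * t) * Φ t with hΨ
  have hexp : ContDiff ℝ 1 (fun t : ℝ => Real.exp (lam * t)) :=
    Real.contDiff_exp.comp (contDiff_const.mul contDiff_id)
  have hΨac : AbsolutelyContinuousOnInterval Ψ 0 t :=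
    (hexp.contDiffOn.absolutelyContinuousOnInterval).mul (hΦac.mono hsub)
  have hint : ∫ x in (0 : ℝ)..t, deriv Ψ x ≤ 0 := by
    rw [intervalIntegral.integral_of_le ht.1, integral_Ioc_eq_integral_Ioo]
    refine integral_nonpos_of_ae ?_
    have h' : ∀ᵐ r ∂(volume.restrict (Ioo 0 t)), _ :=
      ae_restrict_of_ae_restrict_of_subset (Ioo_subset_Ioo_right ht.2) h
    filter_upwards [h', ae_restrict_of_ae hΦac.ae_differentiableAt,
      ae_restrict_mem measurableSet_Ioo] with r ⟨g, w', hg, h1, h2, h3⟩ hd hr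
    have hrT : r ∈ Ioo 0 T := ⟨hr.1, hr.2.trans_le ht.2⟩
    have hdr := (hd (by rw [uIcc_of_le hT.le]; exact Ioo_subset_Icc_self hrT)).hasDerivAt
    have hq : HasDerivAt (fun x => Φ x - inner ℝ g (w x)) (deriv Φ r - inner ℝ g w') r := by
      have := (hasDerivAt_const r g).inner ℝ h2
      simp only [inner_zero_left, add_zero] at this
      exact hdr.sub this
    -- The tangent inequality says that Φ - ⟨g, w⟩ has a minimum at r, so its derivative vanishes
    -- there. This replaces a chain rule for the functional.
    have hle : deriv Φ r - inner ℝ g w' = 0 := by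
      refine IsLocalMin.hasDerivAt_eq_zero ?_ hq
      filter_upwards [Ioo_mem_nhds hrT.1 hrT.2] with x hx
      have := h1 x (Ioo_subset_Icc_self hx)
      rw [inner_sub_right] at this
      linarith
    have hΨd : HasDerivAt Ψ (lam * Real.exp (lam * r) * Φ r + Real.exp (lam * r) * deriv Φ r) r := by
      have he : HasDerivAt (fun x => Real.exp (lam * x)) (lam * Real.exp (lam * r)) r := by
        have := ((hasDerivAt_id r).const_mul lam).exp
        simpa [mul_comm] using this
      exact he.mul hdr
    rw [hΨd.deriv]
    have hp := Real.exp_pos (lam * r)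
    show _ ≤ (0 : ℝ)
    nlinarith
  rw [hΨac.integral_deriv_eq_sub] at hint
  simp only [hΨ, mul_zero, Real.exp_zero, one_mul] at hint
  rw [Real.exp_neg, inv_mul_eq_div, le_div_iff₀ (Real.exp_pos _)]
  linarith

end Time

end

end LLB

open MeasureTheory Filter Topology Set
open scoped ContDiff
set_option linter.unusedSectionVars false

namespace LLB

noncomputable section

/-! ### Bounded sets of Neumann functions and their L² closure. -/

section NeumannBall

variable {d : ℕ} {D : Set (Sp d)}

/-- The ball of radius `M` of `H²` intersected with the homogeneous Neumann condition, as a subset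
of `L²`. -/
def neumannBall (D : Set (Sp d)) (M : NNReal) : Set (L2 D) :=
  {v | MemH2 D v ∧ NeumannZero D v ∧ h2Norm D v ≤ M}

/-- A term of a sum of squares is bounded by a bound for the square root of the sum. -/
lemma le_of_sq_le_of_rpow_half_le {x S : ENNReal} {M : NNReal} (h : x ^ 2 ≤ S)
    (hS : S ^ (1 / 2 : ℝ) ≤ M) : x ≤ M := by
  refine le_trans ?_ hS
  have := ENNReal.rpow_le_rpow h (by norm_num : (0 : ℝ) ≤ 1 / 2)
  rwa [← ENNReal.rpow_natCast, ← ENNReal.rpow_mul, Nat.cast_ofNat, mul_one_div_cancel two_ne_zero,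
    ENNReal.rpow_one] at this

lemma eLpNorm_le_of_h2Norm_le {v : Sp d → V3} {M : NNReal} (h : h2Norm D v ≤ M) :
    eLpNorm v 2 (volume.restrict D) ≤ M :=
  le_of_sq_le_of_rpow_half_le (by rw [add_assoc]; exact le_self_add) h

lemma eLpNorm_weakDeriv_weakDeriv_le_of_h2Norm_le {v : Sp d → V3} {M : NNReal}
    (h : h2Norm D v ≤ M) (i j : Fin d) :
    eLpNorm (weakDeriv D j (weakDeriv D i v)) 2 (volume.restrict D) ≤ M := by
  refine le_of_sq_le_of_rpow_half_le (le_trans ?_ le_add_self) h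
  refine le_trans ?_ (Finset.single_le_sum (f := fun i => ∑ j : Fin d,
        eLpNorm (weakDeriv D j (weakDeriv D i v)) 2 (volume.restrict D) ^ 2)
        (fun _ _ => zero_le) (Finset.mem_univ i))
  exact Finset.single_le_sum (f := fun j =>
        eLpNorm (weakDeriv D j (weakDeriv D i v)) 2 (volume.restrict D) ^ 2)
        (fun _ _ => zero_le) (Finset.mem_univ j)

lemma MemH2.memLp_laplacian {v : Sp d → V3} (hv : MemH2 D v) :
    MemLp (laplacian D v) 2 (volume.restrict D) :=
  memLp_finsetSum _ fun i _ => (hv.memH1_deriv i).memLp_deriv i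

lemma eLpNorm_laplacian_le {v : Sp d → V3} {M : NNReal} (hv : MemH2 D v) (h : h2Norm D v ≤ M) :
    eLpNorm (laplacian D v) 2 (volume.restrict D) ≤ d * M := by
  have e : laplacian D v = ∑ i : Fin d, weakDeriv D i (weakDeriv D i v) := by
    ext1 x; simp [laplacian]
  rw [e]
  refine (eLpNorm_sum_le (fun i _ => ((hv.memH1_deriv i).memLp_deriv i).1) (by norm_num)).trans ?_
  refine (Finset.sum_le_sum fun i _ => eLpNorm_weakDeriv_weakDeriv_le_of_h2Norm_le h i i).trans ?_
  simp

lemma integral_norm_sq_le_of_eLpNorm_le {α E : Type*} [MeasurableSpace α] {μ : Measure α}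
    [NormedAddCommGroup E] {f : α → E} (hf : MemLp f 2 μ) {K : NNReal} (h : eLpNorm f 2 μ ≤ K) :
    ∫ x, ‖f x‖ ^ 2 ∂μ ≤ (K : ℝ) ^ 2 := by
  have h1 : eLpNorm f 2 μ ^ 2 ≤ (K : ENNReal) ^ 2 := by gcongr
  rw [eLpNorm_two_sq hf, ← ENNReal.ofReal_coe_nnreal, ← ENNReal.ofReal_pow K.coe_nonneg] at h1
  exact (ENNReal.ofReal_le_ofReal_iff (by positivity)).1 h1

/-- An L² convergent sequence has a subsequence converging almost everywhere, so pointwise bounds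
survive L² limits. -/
lemma ae_norm_le_of_mem_closure {α E : Type*} [MeasurableSpace α] {μ : Measure α}
    [NormedAddCommGroup E] {U : ℝ} {S : Set (Lp E 2 μ)} (hS : ∀ v ∈ S, ∀ᵐ x ∂μ, ‖v x‖ ≤ U)
    {v : Lp E 2 μ} (hv : v ∈ closure S) : ∀ᵐ x ∂μ, ‖v x‖ ≤ U := by
  obtain ⟨w, hwS, hw⟩ := mem_closure_iff_seq_limit.1 hv
  obtain ⟨ns, -, hns⟩ := (tendstoInMeasure_of_tendsto_Lp hw).exists_seq_tendsto_ae
  filter_upwards [hns, ae_all_iff.2 fun n => hS _ (hwS n)] with x h1 h2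
  exact le_of_tendsto' h1.norm fun n => h2 _

/-- A uniform bound for the elements of `neumannBall D M`. -/
lemma IsSmoothBoundedDomain.exists_bound_closure_neumannBall (hd1 : 1 ≤ d) (hd3 : d ≤ 3)
    (hD : IsSmoothBoundedDomain D) (M : NNReal) :
    ∃ U : ℝ, 0 ≤ U ∧ ∀ v ∈ closure (neumannBall D M), ∀ᵐ x ∂(volume.restrict D), ‖v x‖ ≤ U := by
  obtain ⟨C, hC0, hC⟩ := hD.exists_norm_le hd1 hd3
  -- The L² norm of v - Δv is at most M + dM; the extra 1 supplies the strict positivity that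
  -- `exists_norm_le` demands.
  refine ⟨C * (((d + 1) * M + 1 : NNReal) : ℝ), by positivity, fun v hv =>
    ae_norm_le_of_mem_closure (fun v hv => ?_) hv⟩
  obtain ⟨h1, h2, h3⟩ := hv
  refine hC v h1 h2 _ (by positivity) (integral_norm_sq_le_of_eLpNorm_le
    (f := fun x => v x - laplacian D v x) (h1.memH1.memLp.sub h1.memLp_laplacian) ?_)
  refine (eLpNorm_sub_le h1.memH1.memLp.1 h1.memLp_laplacian.1 (by norm_num)).trans ?_
  push_cast
  calc _ ≤ (M : ENNReal) + d * M :=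
        add_le_add (eLpNorm_le_of_h2Norm_le h3) (eLpNorm_laplacian_le h1 h3)
    _ = (d + 1) * M := by ring
    _ ≤ _ := le_self_add

open Classical in
/-- The weak derivative as an element of `L²`. -/
def gradLp (D : Set (Sp d)) (i : Fin d) (v : Sp d → V3) : L2 D :=
  if h : MemLp (weakDeriv D i v) 2 (volume.restrict D) then h.toLp _ else 0

lemma MemH1.coeFn_gradLp {v : Sp d → V3} (hv : MemH1 D v) (i : Fin d) :
    gradLp D i v =ᵐ[volume.restrict D] weakDeriv D i v := by
  rw [gradLp, dif_pos (hv.memLp_deriv i)]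
  exact MemLp.coeFn_toLp _

lemma MemH1.hasWeakDeriv_gradLp {v : Sp d → V3} (hv : MemH1 D v) (i : Fin d) :
    HasWeakDeriv D i v (gradLp D i v) :=
  (hasWeakDeriv_weakDeriv (hv.exists_deriv i)).congr EventuallyEq.rfl (hv.coeFn_gradLp i).symm

lemma memH1_of_hasWeakDeriv (hD : IsOpen D) {v : L2 D} {g : Fin d → L2 D}
    (h : ∀ i, HasWeakDeriv D i v (g i)) : MemH1 D v ∧ ∀ i, gradLp D i v = g i := by
  have e (i : Fin d) : weakDeriv D i v =ᵐ[volume.restrict D] g i :=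
    (hasWeakDeriv_weakDeriv ⟨_, h i⟩).unique hD (h i)
  have hv : MemH1 D v := ⟨Lp.memLp v, fun i => ⟨_, h i⟩, fun i => (memLp_congr_ae (e i)).2
    (Lp.memLp _)⟩
  exact ⟨hv, fun i => Lp.ext ((hv.coeFn_gradLp i).trans (e i))⟩

/-- Green's formula in `L²`. -/
lemma inner_toLp_laplacian (hD : Bornology.IsBounded D) {v : Sp d → V3} (hv : MemH2 D v)
    (hN : NeumannZero D v) {w : L2 D} (hw : MemH1 D w) :
    inner ℝ (hv.memLp_laplacian.toLp _) w = - ∑ i, inner ℝ (gradLp D i v) (gradLp D i w) := by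
  have h := green hD hv hN hw.hasWeakDeriv_gradLp (Lp.memLp w) fun i => Lp.memLp _
  rw [L2.inner_def]
  simp only [L2.inner_def]
  rw [integral_congr_ae (g := fun x => inner ℝ (laplacian D v x) (w x)), h]
  · congr 1
    refine Finset.sum_congr rfl fun i _ => integral_congr_ae ?_
    filter_upwards [hv.memH1.coeFn_gradLp i] with x hx
    rw [hx]
  · filter_upwards [hv.memLp_laplacian.coeFn_toLp] with x hx
    rw [hx]

lemma norm_toLp_laplacian_le {v : Sp d → V3} {M : NNReal} (hv : MemH2 D v) (h : h2Norm D v ≤ M) :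
    ‖hv.memLp_laplacian.toLp _‖ ≤ d * M := by
  rw [Lp.norm_toLp]
  refine ENNReal.toReal_le_of_le_ofReal (by positivity) ((eLpNorm_laplacian_le hv h).trans ?_)
  rw [ENNReal.ofReal_mul (by positivity), ENNReal.ofReal_natCast, ENNReal.ofReal_coe_nnreal]

/-- Interpolation by Green's formula: ‖∇(v - w)‖² = -⟨Δv - Δw, v - w⟩, and the Laplacians are
bounded in L². The four products are treated one by one, so no linearity of the chosen weak
derivatives is needed. -/
lemma sum_norm_gradLp_sub_sq_le (hD : Bornology.IsBounded D) {M : NNReal} {v w : L2 D}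
    (hv : v ∈ neumannBall D M) (hw : w ∈ neumannBall D M) :
    ∑ i, ‖gradLp D i v - gradLp D i w‖ ^ 2 ≤ 2 * (d * M) * ‖v - w‖ := by
  obtain ⟨hv1, hv2, hv3⟩ := hv
  obtain ⟨hw1, hw2, hw3⟩ := hw
  set A := hv1.memLp_laplacian.toLp
  set B := hw1.memLp_laplacian.toLp
  have e : ∑ i, ‖gradLp D i v - gradLp D i w‖ ^ 2 = -inner ℝ (A - B) (v - w) := by
    rw [inner_sub_left, inner_sub_right, inner_sub_right, inner_toLp_laplacian hD hv1 hv2 hv1.memH1,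
      inner_toLp_laplacian hD hv1 hv2 hw1.memH1, inner_toLp_laplacian hD hw1 hw2 hv1.memH1,
      inner_toLp_laplacian hD hw1 hw2 hw1.memH1]
    have (i : Fin d) : ‖gradLp D i v - gradLp D i w‖ ^ 2 =
        inner ℝ (gradLp D i v) (gradLp D i v) - inner ℝ (gradLp D i v) (gradLp D i w)
        - inner ℝ (gradLp D i w) (gradLp D i v) + inner ℝ (gradLp D i w) (gradLp D i w) := by
      rw [← real_inner_self_eq_norm_sq, inner_sub_left, inner_sub_right, inner_sub_right]
      ring
    simp only [this, Finset.sum_add_distrib, Finset.sum_sub_distrib]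
    ring
  rw [e]
  calc -inner ℝ (A - B) (v - w) ≤ ‖A - B‖ * ‖v - w‖ := by
        rw [← inner_neg_left]
        exact (real_inner_le_norm _ _).trans_eq (by rw [norm_neg])
    _ ≤ _ := by
        gcongr
        exact (norm_sub_le _ _).trans
          ((add_le_add (norm_toLp_laplacian_le hv1 hv3) (norm_toLp_laplacian_le hw1 hw3)).trans_eq
            (by ring))

lemma norm_gradLp_sub_le (hD : Bornology.IsBounded D) {M : NNReal} {v w : L2 D}
    (hv : v ∈ neumannBall D M) (hw : w ∈ neumannBall D M) (i : Fin d) :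
    ‖gradLp D i v - gradLp D i w‖ ≤ √(2 * (d * M) * ‖v - w‖) := by
  refine Real.le_sqrt_of_sq_le (le_trans ?_ (sum_norm_gradLp_sub_sq_le hD hv hw))
  exact Finset.single_le_sum (f := fun i => ‖gradLp D i v - gradLp D i w‖ ^ 2)
    (fun _ _ => by positivity) (Finset.mem_univ i)

/-- Along `L²`-convergent sequences of `neumannBall D M` the gradients converge. -/
lemma memH1_and_tendsto_gradLp (hDo : IsOpen D) (hD : Bornology.IsBounded D) {M : NNReal}
    {x : ℕ → L2 D} {v : L2 D} (hx : ∀ n, x n ∈ neumannBall D M) (hxv : Tendsto x atTop (𝓝 v)) :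
    MemH1 D v ∧ ∀ i, Tendsto (fun n => gradLp D i (x n)) atTop (𝓝 (gradLp D i v)) := by
  have hc (i : Fin d) : CauchySeq fun n => gradLp D i (x n) := by
    rw [cauchySeq_iff_tendsto_dist_atTop_0]
    have h1 := (cauchySeq_iff_tendsto_dist_atTop_0.1 hxv.cauchySeq).const_mul (2 * (d * (M : ℝ)))
    have h2 := (Real.continuous_sqrt.tendsto _).comp h1
    rw [mul_zero, Real.sqrt_zero] at h2
    refine squeeze_zero (fun _ => dist_nonneg) (fun p => ?_) h2
    simp only [Function.comp, dist_eq_norm]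
    exact norm_gradLp_sub_le hD (hx _) (hx _) i
  -- Stability of weak derivatives under L² limits shows that these limits are the derivatives of
  -- `v`; membership in H² and the Neumann condition need not pass to the limit.
  choose g hg using fun i => cauchySeq_tendsto_of_complete (hc i)
  obtain ⟨h1, h2⟩ := memH1_of_hasWeakDeriv hDo fun i => HasWeakDeriv.of_tendsto hxv (hg i)
    fun n => (hx n).1.memH1.hasWeakDeriv_gradLp i
  exact ⟨h1, fun i => by rw [h2 i]; exact hg i⟩

lemma memH1_of_mem_closure_neumannBall (hDo : IsOpen D) (hD : Bornology.IsBounded D) {M : NNReal}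
    {v : L2 D} (hv : v ∈ closure (neumannBall D M)) : MemH1 D v := by
  obtain ⟨x, hx, hxv⟩ := mem_closure_iff_seq_limit.1 hv
  exact (memH1_and_tendsto_gradLp hDo hD hx hxv).1

/-- The Hölder-1/2 estimate is closed under L² limits of both arguments. -/
lemma continuousOn_gradLp (hDo : IsOpen D) (hD : Bornology.IsBounded D) (M : NNReal) (i : Fin d) :
    ContinuousOn (fun v : L2 D => gradLp D i v) (closure (neumannBall D M)) := by
  have key : ∀ v ∈ closure (neumannBall D M), ∀ w ∈ closure (neumannBall D M),
      ‖gradLp D i v - gradLp D i w‖ ≤ √(2 * (d * M) * ‖v - w‖) := by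
    intro v hv w hw
    obtain ⟨x, hx, hxv⟩ := mem_closure_iff_seq_limit.1 hv
    obtain ⟨y, hy, hyw⟩ := mem_closure_iff_seq_limit.1 hw
    exact le_of_tendsto_of_tendsto'
      (((memH1_and_tendsto_gradLp hDo hD hx hxv).2 i).sub
        ((memH1_and_tendsto_gradLp hDo hD hy hyw).2 i)).norm
      ((Real.continuous_sqrt.tendsto _).comp ((hxv.sub hyw).norm.const_mul _))
      fun n => norm_gradLp_sub_le hD (hx n) (hy n) i
  intro v hv
  rw [ContinuousWithinAt, tendsto_iff_norm_sub_tendsto_zero]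
  have h0 : Tendsto (fun w : L2 D => √(2 * (d * M) * ‖w - v‖))
      (𝓝[closure (neumannBall D M)] v) (𝓝 0) := by
    have : Continuous fun w : L2 D => √(2 * (d * M) * ‖w - v‖) := by fun_prop
    have := (this.tendsto v).mono_left (nhdsWithin_le_nhds (s := closure (neumannBall D M)))
    simpa using this
  refine squeeze_zero' (Eventually.of_forall fun _ => norm_nonneg _) ?_ h0
  filter_upwards [self_mem_nhdsWithin] with w hw using key w hw v hv

end NeumannBall

end

end LLB

open MeasureTheory Filter Topology Set
open scoped ContDiff
set_option linter.unusedSectionVars false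

namespace LLB

noncomputable section

/-! ### Integral functionals of convex densities. -/

section ConvexIntegrals

variable {α : Type*} [MeasurableSpace α] {μ : Measure α} [IsFiniteMeasure μ]

lemma memLp_comp_of_norm_le {F : Type*} [NormedAddCommGroup F] {v : α → V3}
    (hv : AEStronglyMeasurable v μ) {U : ℝ} (hU : ∀ᵐ x ∂μ, ‖v x‖ ≤ U) {G : V3 → F}
    (hG : Continuous G) (p : ENNReal) : MemLp (fun x => G (v x)) p μ := by
  obtain ⟨C, hC⟩ := (isCompact_closedBall (0 : V3) U).exists_bound_of_continuousOn hG.continuousOn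
  refine MemLp.of_bound (hG.comp_aestronglyMeasurable hv) C ?_
  filter_upwards [hU] with x hx using hC _ (by simpa using hx)

/-- The integral functional of a convex function `q` lies above its tangents. -/
lemma integral_sub_integral_le_inner {q : V3 → ℝ} {G : V3 → V3} (hq : Continuous q)
    (hG : Continuous G) (hqG : ∀ y z, q y - q z ≤ inner ℝ (G y) (y - z)) {v w : Lp V3 2 μ} {U : ℝ}
    (hv : ∀ᵐ x ∂μ, ‖v x‖ ≤ U) (hw : ∀ᵐ x ∂μ, ‖w x‖ ≤ U) :
    (∫ x, q (v x) ∂μ) - ∫ x, q (w x) ∂μ ≤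
      inner ℝ ((memLp_comp_of_norm_le (Lp.aestronglyMeasurable v) hv hG 2).toLp _) (v - w) := by
  have mG := memLp_comp_of_norm_le (Lp.aestronglyMeasurable v) hv hG 2
  have iv := (memLp_comp_of_norm_le (Lp.aestronglyMeasurable v) hv hq 1).integrable le_rfl
  have iw := (memLp_comp_of_norm_le (Lp.aestronglyMeasurable w) hw hq 1).integrable le_rfl
  rw [← integral_sub iv iw, L2.inner_def]
  refine integral_mono_ae (iv.sub iw) (L2.integrable_inner _ _) ?_
  filter_upwards [mG.coeFn_toLp, Lp.coeFn_sub v w] with x h1 h2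
  rw [h1, h2]
  exact hqG _ _

lemma exists_norm_toLp_comp_le {G : V3 → V3} (hG : Continuous G) (U : ℝ) :
    ∃ C : ℝ, 0 ≤ C ∧ ∀ (v : Lp V3 2 μ) (hv : ∀ᵐ x ∂μ, ‖v x‖ ≤ U),
      ‖(memLp_comp_of_norm_le (Lp.aestronglyMeasurable v) hv hG 2).toLp _‖ ≤ C := by
  obtain ⟨C, hC⟩ := (isCompact_closedBall (0 : V3) U).exists_bound_of_continuousOn hG.continuousOn
  refine ⟨measureUnivNNReal μ ^ (2 : ENNReal).toReal⁻¹ * max C 0, by positivity, fun v hv => ?_⟩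
  refine Lp.norm_le_of_ae_bound (le_max_right _ _) ?_
  filter_upwards [hv, (memLp_comp_of_norm_le (Lp.aestronglyMeasurable v) hv hG 2).coeFn_toLp]
    with x hx h1
  rw [h1]
  exact (hC _ (by simpa using hx)).trans (le_max_left _ _)

/-- The tangent inequality, used in both directions, gives a Lipschitz bound, because the gradient
field is bounded on a common ball. -/
lemma continuousOn_integral_comp {q : V3 → ℝ} {G : V3 → V3} (hq : Continuous q)
    (hG : Continuous G) (hqG : ∀ y z, q y - q z ≤ inner ℝ (G y) (y - z)) {S : Set (Lp V3 2 μ)}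
    {U : ℝ} (hS : ∀ v ∈ S, ∀ᵐ x ∂μ, ‖v x‖ ≤ U) :
    ContinuousOn (fun v : Lp V3 2 μ => ∫ x, q (v x) ∂μ) S := by
  obtain ⟨C, hC0, hC⟩ := exists_norm_toLp_comp_le (μ := μ) hG U
  have key : ∀ v ∈ S, ∀ w ∈ S, (∫ x, q (v x) ∂μ) - ∫ x, q (w x) ∂μ ≤ C * ‖v - w‖ := by
    intro v hv w hw
    refine (integral_sub_integral_le_inner hq hG hqG (hS v hv) (hS w hw)).trans ?_
    refine (real_inner_le_norm _ _).trans ?_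
    gcongr
    exact hC v (hS v hv)
  refine (LipschitzOnWith.of_dist_le_mul (K := C.toNNReal) fun v hv w hw => ?_).continuousOn
  rw [Real.dist_eq, dist_eq_norm, abs_le, Real.coe_toNNReal _ hC0]
  have h1 := key v hv w hw
  have h2 := key w hw v hv
  rw [norm_sub_rev] at h2
  exact ⟨by linarith, h1⟩

end ConvexIntegrals

/-! ### Convexity and coercivity of the energy. -/

section Energy

variable {d : ℕ} {D : Set (Sp d)} {c : Coeffs}

/-- The density of the part of the energy without derivatives. -/
def potential (c : Coeffs) (y : V3) : ℝ :=
  c.κ * c.μ / 2 * ‖y‖ ^ 2 + c.κ / 4 * ‖y‖ ^ 4 + c.lam / 2 * (inner ℝ c.e y) ^ 2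

/-- The gradient of `potential`. -/
def potentialGrad (c : Coeffs) (y : V3) : V3 :=
  (c.κ * c.μ) • y + (c.κ * ‖y‖ ^ 2) • y + (c.lam * inner ℝ c.e y) • c.e

lemma continuous_potential (c : Coeffs) : Continuous (potential c) := by
  unfold potential; fun_prop

lemma continuous_potentialGrad (c : Coeffs) : Continuous (potentialGrad c) := by
  unfold potentialGrad; fun_prop

lemma effField_eq (v : Sp d → V3) (x : Sp d) :
    effField D c v x = c.σ • laplacian D v x - potentialGrad c (v x) := by
  simp only [effField, potentialGrad]; abel

lemma inner_potentialGrad (y z : V3) : inner ℝ (potentialGrad c y) z =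
    c.κ * c.μ * inner ℝ y z + c.κ * ‖y‖ ^ 2 * inner ℝ y z
      + c.lam * inner ℝ c.e y * inner ℝ c.e z := by
  simp only [potentialGrad, inner_add_left, real_inner_smul_left]

/-- Each summand is convex. With A = |y|², B = |z|² and I = y · z, everything reduces to 2I ≤ A + B;
for the quartic term the remaining gap is (A - B)²/4. -/
lemma potential_sub_le (hc : c.Admissible) (y z : V3) :
    potential c y - potential c z ≤ inner ℝ (potentialGrad c y) (y - z) := by
  have h1 : 0 ≤ ‖y‖ ^ 2 - 2 * inner ℝ y z + ‖z‖ ^ 2 := by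
    rw [← norm_sub_sq_real]; positivity
  rw [inner_potentialGrad, inner_sub_right, inner_sub_right, real_inner_self_eq_norm_sq]
  simp only [potential]
  have hA : 0 ≤ ‖y‖ ^ 2 := by positivity
  have e4 (y : V3) : ‖y‖ ^ 4 = (‖y‖ ^ 2) ^ 2 := by ring
  rw [e4 y, e4 z]
  generalize ‖y‖ ^ 2 = A at *
  generalize ‖z‖ ^ 2 = B at *
  generalize inner ℝ y z = I at *
  have t1 : c.κ * c.μ / 2 * (A - B) ≤ c.κ * c.μ * (A - I) := by
    have := mul_pos hc.κ_pos hc.μ_pos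
    nlinarith
  have t2 : c.κ / 4 * (A ^ 2 - B ^ 2) ≤ c.κ * A * (A - I) := by
    have : (A ^ 2 - B ^ 2) / 4 ≤ A * (A - I) := by nlinarith [sq_nonneg (A - B)]
    nlinarith [hc.κ_pos]
  have t3 : c.lam / 2 * (inner ℝ c.e y ^ 2 - inner ℝ c.e z ^ 2) ≤
      c.lam * inner ℝ c.e y * (inner ℝ c.e y - inner ℝ c.e z) := by
    nlinarith [mul_nonneg hc.lam_pos.le (sq_nonneg (inner ℝ c.e y - inner ℝ c.e z))]
  linarith

lemma le_potential (hc : c.Admissible) (y : V3) : c.κ * c.μ / 2 * ‖y‖ ^ 2 ≤ potential c y := by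
  have := hc.κ_pos
  have := hc.lam_pos
  have h1 : 0 ≤ c.κ / 4 * ‖y‖ ^ 4 := by positivity
  have h2 : 0 ≤ c.lam / 2 * (inner ℝ c.e y) ^ 2 := by positivity
  unfold potential; linarith

/-- Euler's identity for homogeneous functions: the quadratic terms give equality and the quartic
term would even allow the factor 4. -/
lemma two_mul_potential_le (hc : c.Admissible) (y : V3) :
    2 * potential c y ≤ inner ℝ (potentialGrad c y) y := by
  rw [inner_potentialGrad, real_inner_self_eq_norm_sq, potential]
  have := hc.κ_pos
  have : 0 ≤ c.κ * ‖y‖ ^ 4 := by positivity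
  nlinarith

lemma le_inner_potentialGrad (hc : c.Admissible) (y : V3) :
    c.κ * c.μ * ‖y‖ ^ 2 ≤ inner ℝ (potentialGrad c y) y := by
  have h1 := le_potential hc y
  have h2 := two_mul_potential_le hc y
  linarith

lemma norm_sq_eq_integral {α : Type*} [MeasurableSpace α] {μ : Measure α} (f : Lp V3 2 μ) :
    ‖f‖ ^ 2 = ∫ x, ‖f x‖ ^ 2 ∂μ := by
  rw [← real_inner_self_eq_norm_sq, L2.inner_def]
  simp only [real_inner_self_eq_norm_sq]

lemma integrable_norm_sq_weakDeriv {v : Sp d → V3} (hv : MemH1 D v) (i : Fin d) :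
    Integrable (fun x => ‖weakDeriv D i v x‖ ^ 2) (volume.restrict D) :=
  integrable_norm_sq (hv.memLp_deriv i)

lemma norm_gradLp_sq {v : Sp d → V3} (hv : MemH1 D v) (i : Fin d) :
    ‖gradLp D i v‖ ^ 2 = ∫ x in D, ‖weakDeriv D i v x‖ ^ 2 := by
  rw [norm_sq_eq_integral]
  refine integral_congr_ae ?_
  filter_upwards [hv.coeFn_gradLp i] with x hx
  rw [hx]

lemma energyDensity_eq (v : Sp d → V3) (x : Sp d) : energyDensity D c v x =
    c.σ / 2 * ∑ i : Fin d, ‖weakDeriv D i v x‖ ^ 2 + potential c (v x) := by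
  simp only [energyDensity, potential]; ring

variable [IsFiniteMeasure (volume.restrict D)]

lemma integrable_potential {v : Sp d → V3} (hv : MemH1 D v) {U : ℝ}
    (hU : ∀ᵐ x ∂(volume.restrict D), ‖v x‖ ≤ U) :
    Integrable (fun x => potential c (v x)) (volume.restrict D) :=
  (memLp_comp_of_norm_le hv.memLp.1 hU (continuous_potential c) 1).integrable le_rfl

lemma integrableOn_energyDensity {v : Sp d → V3} (hv : MemH1 D v) {U : ℝ}
    (hU : ∀ᵐ x ∂(volume.restrict D), ‖v x‖ ≤ U) : IntegrableOn (energyDensity D c v) D := by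
  rw [show energyDensity D c v = _ from funext (energyDensity_eq v)]
  exact ((integrable_finsetSum _ fun i _ => integrable_norm_sq_weakDeriv hv i).const_mul _).add
    (integrable_potential hv hU)

lemma energy_eq {v : Sp d → V3} (hv : MemH1 D v) {U : ℝ}
    (hU : ∀ᵐ x ∂(volume.restrict D), ‖v x‖ ≤ U) :
    energy D c v = c.σ / 2 * ∑ i, ‖gradLp D i v‖ ^ 2 + ∫ x in D, potential c (v x) := by
  simp only [energy, energyDensity_eq]
  rw [integral_add ((integrable_finsetSum _ fun i _ =>
    integrable_norm_sq_weakDeriv hv i).const_mul _) (integrable_potential hv hU),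
    integral_const_mul, integral_finsetSum _ fun i _ => integrable_norm_sq_weakDeriv hv i]
  simp only [norm_gradLp_sq hv]

lemma le_energy (hc : c.Admissible) {v : L2 D} (hv : MemH1 D v) {U : ℝ}
    (hU : ∀ᵐ x ∂(volume.restrict D), ‖v x‖ ≤ U) :
    c.σ / 2 * ∑ i, ‖gradLp D i v‖ ^ 2 + c.κ * c.μ / 2 * ‖v‖ ^ 2 ≤ energy D c v := by
  rw [energy_eq hv hU, norm_sq_eq_integral v, ← integral_const_mul]
  exact add_le_add le_rfl (integral_mono ((integrable_norm_sq (Lp.memLp v)).const_mul _)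
    (integrable_potential hv hU) fun x => le_potential hc _)

lemma continuousOn_energy (hc : c.Admissible) (hDo : IsOpen D) (hD : Bornology.IsBounded D)
    {M : NNReal} {U : ℝ}
    (hU : ∀ v ∈ closure (neumannBall D M), ∀ᵐ x ∂(volume.restrict D), ‖v x‖ ≤ U) :
    ContinuousOn (fun v : L2 D => energy D c v) (closure (neumannBall D M)) := by
  have h : ContinuousOn (fun v : L2 D => c.σ / 2 * ∑ i, ‖gradLp D i v‖ ^ 2
      + ∫ x in D, potential c (v x)) (closure (neumannBall D M)) := by
    refine ContinuousOn.add (ContinuousOn.const_mul (continuousOn_finsetSum _ fun i _ =>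
      (continuousOn_gradLp hDo hD M i).norm.pow 2) _) ?_
    exact continuousOn_integral_comp (continuous_potential c) (continuous_potentialGrad c)
      (potential_sub_le hc) hU
  exact h.congr fun v hv => energy_eq (memH1_of_mem_closure_neumannBall hDo hD hv) (hU v hv)

lemma memLp_effField {v : Sp d → V3} (hv : MemH2 D v) {U : ℝ}
    (hU : ∀ᵐ x ∂(volume.restrict D), ‖v x‖ ≤ U) :
    MemLp (effField D c v) 2 (volume.restrict D) := by
  rw [show effField D c v = _ from funext (effField_eq v)]
  exact (hv.memLp_laplacian.const_smul c.σ).sub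
    (memLp_comp_of_norm_le hv.memH1.memLp.1 hU (continuous_potentialGrad c) 2)

lemma toLp_effField {v : L2 D} (hv : MemH2 D v) {U : ℝ}
    (hU : ∀ᵐ x ∂(volume.restrict D), ‖v x‖ ≤ U) :
    (memLp_effField (c := c) hv hU).toLp _ = c.σ • hv.memLp_laplacian.toLp _ -
      (memLp_comp_of_norm_le (Lp.aestronglyMeasurable v) hU
        (continuous_potentialGrad c) 2).toLp _ := by
  rw [← MemLp.toLp_const_smul, ← MemLp.toLp_sub]
  exact MemLp.toLp_congr _ _ (Eventually.of_forall fun x => effField_eq _ x)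

lemma exists_norm_toLp_effField_le (hc : c.Admissible) (M : NNReal) (U : ℝ) :
    ∃ C : ℝ, 0 ≤ C ∧ ∀ v ∈ neumannBall D M, ∀ (hv : MemH2 D v)
      (hU : ∀ᵐ x ∂(volume.restrict D), ‖v x‖ ≤ U),
      ‖(memLp_effField (c := c) hv hU).toLp _‖ ≤ C := by
  obtain ⟨C, hC0, hC⟩ := exists_norm_toLp_comp_le (μ := volume.restrict D)
    (continuous_potentialGrad c) U
  have hσ := hc.σ_pos
  refine ⟨c.σ * (d * M) + C, by positivity, fun v hv h2 hU => ?_⟩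
  rw [toLp_effField h2 hU]
  refine (norm_sub_le _ _).trans (add_le_add ?_ (hC v hU))
  rw [norm_smul, Real.norm_of_nonneg hσ.le]
  gcongr
  exact norm_toLp_laplacian_le h2 hv.2.2

/-- The effective field is minus the gradient of the energy, which is convex. -/
lemma energy_sub_energy_le (hc : c.Admissible) (hD : Bornology.IsBounded D) {v w : L2 D}
    (hv : MemH2 D v) (hN : NeumannZero D v) (hw : MemH1 D w) {U : ℝ}
    (hvU : ∀ᵐ x ∂(volume.restrict D), ‖v x‖ ≤ U) (hwU : ∀ᵐ x ∂(volume.restrict D), ‖w x‖ ≤ U) :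
    energy D c v - energy D c w ≤
      inner ℝ (-(memLp_effField (c := c) hv hvU).toLp _) (v - w) := by
  have h1 := integral_sub_integral_le_inner (continuous_potential c) (continuous_potentialGrad c)
    (potential_sub_le hc) hvU hwU
  have h2 := inner_toLp_laplacian hD hv hN hv.memH1
  have h3 := inner_toLp_laplacian hD hv hN hw
  rw [energy_eq hv.memH1 hvU, energy_eq hw hwU, toLp_effField hv hvU, neg_sub, inner_sub_left,
    real_inner_smul_left, inner_sub_right (hv.memLp_laplacian.toLp _), h2, h3]
  -- Convexity of the Dirichlet part, with its tangent expressed through gradients so that Green's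
  -- formula applies with the merely H¹ function `w`.
  have h4 : ∑ i, ‖gradLp D i v‖ ^ 2 - ∑ i, ‖gradLp D i w‖ ^ 2 ≤ 2 *
      (∑ i, inner ℝ (gradLp D i v) (gradLp D i v) - ∑ i, inner ℝ (gradLp D i v) (gradLp D i w)) := by
    rw [← Finset.sum_sub_distrib, ← Finset.sum_sub_distrib, Finset.mul_sum]
    refine Finset.sum_le_sum fun i _ => ?_
    rw [real_inner_self_eq_norm_sq]
    have := norm_sub_sq_real (gradLp D i v) (gradLp D i w)
    nlinarith [sq_nonneg ‖gradLp D i v - gradLp D i w‖]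
  nlinarith [mul_le_mul_of_nonneg_left h4 hc.σ_pos.le]

lemma two_mul_energy_le (hc : c.Admissible) (hD : Bornology.IsBounded D) {v : L2 D}
    (hv : MemH2 D v) (hN : NeumannZero D v) {U : ℝ}
    (hU : ∀ᵐ x ∂(volume.restrict D), ‖v x‖ ≤ U) :
    2 * energy D c v ≤ inner ℝ (-(memLp_effField (c := c) hv hU).toLp _) v := by
  have mF := memLp_comp_of_norm_le (Lp.aestronglyMeasurable v) hU (continuous_potentialGrad c) 2
  have h1 : 2 * ∫ x in D, potential c (v x) ≤ inner ℝ (mF.toLp _) v := by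
    rw [L2.inner_def, ← integral_const_mul]
    refine integral_mono_ae ((integrable_potential hv.memH1 hU).const_mul _)
      (L2.integrable_inner _ _) ?_
    filter_upwards [mF.coeFn_toLp] with x hx
    rw [hx]
    exact two_mul_potential_le hc _
  rw [energy_eq hv.memH1 hU, toLp_effField hv hU, neg_sub, inner_sub_left, real_inner_smul_left,
    inner_toLp_laplacian hD hv hN hv.memH1]
  simp only [real_inner_self_eq_norm_sq]
  linarith

/-- The energy–dissipation inequality behind the decay rate. From 2E ≤ ‖H‖‖v‖ and κμ‖v‖² ≤ 2E,
Young's inequality in the form 2κμ‖H‖‖v‖ ≤ ‖H‖² + (κμ‖v‖)² gives the bound without dividing by E. -/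
lemma mul_energy_le_norm_sq (hc : c.Admissible) (hD : Bornology.IsBounded D) {v : L2 D}
    (hv : MemH2 D v) (hN : NeumannZero D v) {U : ℝ}
    (hU : ∀ᵐ x ∂(volume.restrict D), ‖v x‖ ≤ U) :
    2 * (c.κ * c.μ) * energy D c v ≤ ‖(memLp_effField (c := c) hv hU).toLp _‖ ^ 2 := by
  have h1 := two_mul_energy_le hc hD hv hN hU
  have h2 := le_energy hc hv.memH1 hU
  have hκμ := mul_pos hc.κ_pos hc.μ_pos
  have h3 : 0 ≤ c.σ / 2 * ∑ i, ‖gradLp D i v‖ ^ 2 := by have := hc.σ_pos; positivity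
  set H := (memLp_effField (c := c) hv hU).toLp
  have h4 : inner ℝ (-H) v ≤ ‖H‖ * ‖v‖ := by simpa using real_inner_le_norm (-H) v
  have h5 : c.κ * c.μ * ‖v‖ ^ 2 ≤ 2 * energy D c v := by linarith
  by_contra! hlt
  nlinarith [sq_nonneg (‖H‖ - c.κ * c.μ * ‖v‖)]

end Energy

end

end LLB

open MeasureTheory Filter Topology Set
open scoped ContDiff
set_option linter.unusedSectionVars false

namespace LLB

noncomputable section

/-! ### The convex truncation used in the maximum principle. -/

section Truncation

/-- A smooth monotone function vanishing exactly on `(-∞, k²]`, equal to one on `[k² + 1, ∞)`. -/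
def truncWeight (k s : ℝ) : ℝ := Real.smoothTransition (s - k ^ 2)

/-- A convex function of `y` that vanishes exactly on the ball of radius `k`. -/
def truncEnergy (k : ℝ) (y : V3) : ℝ := (∫ s in (k ^ 2)..(‖y‖ ^ 2), truncWeight k s) / 2

/-- The gradient of `truncEnergy`. -/
def truncGrad (k : ℝ) (y : V3) : V3 := truncWeight k (‖y‖ ^ 2) • y

lemma contDiff_truncWeight (k : ℝ) : ContDiff ℝ ∞ (truncWeight k) :=
  Real.smoothTransition.contDiff.comp (contDiff_id.sub contDiff_const)

lemma truncWeight_nonneg (k s : ℝ) : 0 ≤ truncWeight k s := Real.smoothTransition.nonneg _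

lemma truncWeight_mono (k : ℝ) : Monotone (truncWeight k) :=
  fun _ _ h => Real.smoothTransition.monotone (sub_le_sub_right h _)

lemma contDiff_truncGrad (k : ℝ) : ContDiff ℝ 1 (truncGrad k) :=
  (((contDiff_truncWeight k).of_le (by simp)).comp (contDiff_norm_sq ℝ)).smul contDiff_id

lemma intervalIntegrable_truncWeight (k a b : ℝ) :
    IntervalIntegrable (truncWeight k) volume a b :=
  (contDiff_truncWeight k).continuous.intervalIntegrable _ _

lemma continuous_truncEnergy (k : ℝ) : Continuous (truncEnergy k) := by
  have h := intervalIntegral.continuous_primitive (μ := volume)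
    (fun a b => intervalIntegrable_truncWeight k a b) (k ^ 2)
  exact (h.comp (continuous_norm.pow 2)).div_const 2

/-- A primitive of a monotone weight is convex, whichever order the endpoints have; this is combined
with |y|² - |z|² ≤ 2 y · (y - z) and nonnegativity of the weight. -/
lemma truncEnergy_sub_le (k : ℝ) (y z : V3) :
    truncEnergy k y - truncEnergy k z ≤ inner ℝ (truncGrad k y) (y - z) := by
  have key (a b : ℝ) : ∫ s in a..b, truncWeight k s ≤ truncWeight k b * (b - a) := by
    rcases le_total a b with h | h
    · have := intervalIntegral.integral_mono_on h (intervalIntegrable_truncWeight k a b)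
        (intervalIntegrable_const (c := truncWeight k b)) fun x hx => truncWeight_mono k hx.2
      rw [intervalIntegral.integral_const, smul_eq_mul] at this
      linarith
    · have := intervalIntegral.integral_mono_on h (intervalIntegrable_const (c := truncWeight k b))
        (intervalIntegrable_truncWeight k b a) fun x hx => truncWeight_mono k hx.1
      rw [intervalIntegral.integral_const, smul_eq_mul] at this
      rw [intervalIntegral.integral_symm]
      linarith
  have e : truncEnergy k y - truncEnergy k z =
      (∫ s in (‖z‖ ^ 2)..(‖y‖ ^ 2), truncWeight k s) / 2 := by
    rw [truncEnergy, truncEnergy, ← sub_div, intervalIntegral.integral_interval_sub_left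
      (intervalIntegrable_truncWeight _ _ _) (intervalIntegrable_truncWeight _ _ _)]
  rw [e, truncGrad, real_inner_smul_left, inner_sub_right, real_inner_self_eq_norm_sq]
  have h1 := key (‖z‖ ^ 2) (‖y‖ ^ 2)
  have h2 : 0 ≤ ‖y‖ ^ 2 - 2 * inner ℝ y z + ‖z‖ ^ 2 := by
    rw [← norm_sub_sq_real]; positivity
  nlinarith [truncWeight_nonneg k (‖y‖ ^ 2)]

lemma truncWeight_eq_zero {k s : ℝ} (h : s ≤ k ^ 2) : truncWeight k s = 0 :=
  Real.smoothTransition.zero_of_nonpos (sub_nonpos.2 h)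

lemma truncEnergy_eq_zero {k : ℝ} {y : V3} (h : ‖y‖ ≤ k) : truncEnergy k y = 0 := by
  have h2 : ‖y‖ ^ 2 ≤ k ^ 2 := pow_le_pow_left₀ (norm_nonneg _) h 2
  rw [truncEnergy, intervalIntegral.integral_congr (g := fun _ => 0)]
  · simp
  · intro s hs
    rw [uIcc_of_ge h2] at hs
    exact truncWeight_eq_zero hs.2

lemma truncEnergy_nonneg (k : ℝ) (y : V3) : 0 ≤ truncEnergy k y := by
  rcases le_total (k ^ 2) (‖y‖ ^ 2) with h | h
  · exact div_nonneg (intervalIntegral.integral_nonneg h fun s _ => truncWeight_nonneg k s)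
      zero_le_two
  · rw [show truncEnergy k y = truncEnergy |k| y by simp [truncEnergy, truncWeight]]
    exact (truncEnergy_eq_zero ((le_abs_self _).trans (sq_le_sq.1 h))).ge

lemma norm_le_of_truncEnergy_eq_zero {k : ℝ} (hk : 0 ≤ k) {y : V3} (h : truncEnergy k y = 0) :
    ‖y‖ ≤ k := by
  by_contra! hlt
  have h2 : k ^ 2 < ‖y‖ ^ 2 := pow_lt_pow_left₀ hlt hk two_ne_zero
  refine (div_pos ?_ two_pos).ne' h
  exact intervalIntegral.intervalIntegral_pos_of_pos_on (intervalIntegrable_truncWeight k _ _)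
    (fun s hs => Real.smoothTransition.pos_of_pos (sub_pos.2 hs.1)) h2

/-- Outside the ball of radius √(k² + 1) the field is the identity; inside, compactness suffices.
The bound is what the weak chain rule requires. -/
lemma exists_norm_fderiv_truncGrad_le (k : ℝ) : ∃ C : ℝ, ∀ y, ‖fderiv ℝ (truncGrad k) y‖ ≤ C := by
  obtain ⟨C, hC⟩ := (isCompact_closedBall (0 : V3) √(k ^ 2 + 1)).exists_bound_of_continuousOn
    ((contDiff_truncGrad k).continuous_fderiv one_ne_zero).continuousOn
  refine ⟨max C 1, fun y => ?_⟩
  by_cases hy : ‖y‖ ≤ √(k ^ 2 + 1)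
  · exact (hC y (by simpa using hy)).trans (le_max_left _ _)
  · rw [not_le] at hy
    have h1 : truncGrad k =ᶠ[𝓝 y] id := by
      filter_upwards [(continuous_norm.tendsto y).eventually (lt_mem_nhds hy)] with z hz
      have h2 := (Real.sqrt_lt' ((Real.sqrt_nonneg _).trans_lt hz)).1 hz
      rw [truncGrad, truncWeight, Real.smoothTransition.one_of_one_le (by linarith), one_smul, id]
    rw [h1.fderiv_eq, fderiv_id]
    exact (ContinuousLinearMap.norm_id_le).trans (le_max_right _ _)

/-- The derivative of a monotone vector field is positive semidefinite. -/
lemma inner_fderiv_nonneg {G : V3 → V3} (hG : Differentiable ℝ G) {q : V3 → ℝ}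
    (hq : ∀ y z, q y - q z ≤ inner ℝ (G y) (y - z)) (y ξ : V3) :
    0 ≤ inner ℝ ξ (fderiv ℝ G y ξ) := by
  -- Adding the tangent inequalities at two points of the line eliminates q and leaves monotonicity
  -- of G in the direction ξ.
  have hmono : Monotone fun t : ℝ => inner ℝ ξ (G (y + t • ξ)) := by
    intro s t hst
    have h1 := hq (y + t • ξ) (y + s • ξ)
    have h2 := hq (y + s • ξ) (y + t • ξ)
    rw [add_sub_add_left_eq_sub, ← sub_smul, real_inner_smul_right, real_inner_comm] at h1 h2
    rcases hst.eq_or_lt with rfl | hlt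
    · exact le_rfl
    · simp only
      have : 0 < t - s := sub_pos.2 hlt
      nlinarith
  have hl : HasDerivAt (fun t : ℝ => y + t • ξ) ξ 0 := by
    simpa using ((hasDerivAt_id (0 : ℝ)).smul_const ξ).const_add y
  have hd : HasDerivAt (fun t : ℝ => inner ℝ ξ (G (y + t • ξ))) (inner ℝ ξ (fderiv ℝ G y ξ)) 0 := by
    have hG' : HasFDerivAt G (fderiv ℝ G y) (y + (0 : ℝ) • ξ) := by
      simpa using (hG y).hasFDerivAt
    simpa using (hasDerivAt_const (0 : ℝ) ξ).inner ℝ (hG'.comp_hasDerivAt 0 hl)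
  rw [← hd.deriv]
  exact hmono.deriv_nonneg

variable {d : ℕ} {D : Set (Sp d)}

/-- Green's formula and the chain rule turn the integral into -r times a sum of integrals of ⟨∂ᵢv,
DG ∂ᵢv⟩, and DG is positive semidefinite. The factor r will be the exponential weight in time. -/
lemma integral_inner_laplacian_comp_nonpos (hDo : IsOpen D) (hD : Bornology.IsBounded D)
    {v : Sp d → V3} (hv : MemH2 D v) (hN : NeumannZero D v) {G : V3 → V3} (hG : ContDiff ℝ 1 G)
    {C : ℝ} (hC : ∀ y, ‖fderiv ℝ G y‖ ≤ C) {q : V3 → ℝ}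
    (hq : ∀ y z, q y - q z ≤ inner ℝ (G y) (y - z)) {r : ℝ} (hr : 0 ≤ r)
    (mG : MemLp (fun x => G (r • v x)) 2 (volume.restrict D)) :
    ∫ x in D, inner ℝ (laplacian D v x) (G (r • v x)) ≤ 0 := by
  have hW (i : Fin d) := (((hasWeakDeriv_weakDeriv (hv.memH1.exists_deriv i)).const_smul r).comp
    hDo hG hC)
  have hDG : Continuous (fderiv ℝ G) := hG.continuous_fderiv one_ne_zero
  have happ : Continuous fun p : V3 × V3 => fderiv ℝ G p.1 p.2 :=
    (hDG.comp continuous_fst).clm_apply continuous_snd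
  have mW (i : Fin d) : MemLp (fun x => fderiv ℝ G (r • v x) (r • weakDeriv D i v x)) 2
      (volume.restrict D) := by
    refine ((hv.memH1.memLp_deriv i).const_smul r).of_le_mul (c := C)
      (happ.comp_aestronglyMeasurable ((hv.memH1.memLp.1.const_smul r).prodMk
        ((hv.memH1.memLp_deriv i).1.const_smul r))) (Eventually.of_forall fun x => ?_)
    exact ((fderiv ℝ G (r • v x)).le_opNorm _).trans
      (mul_le_mul_of_nonneg_right (hC _) (norm_nonneg _))
  rw [green hD hv hN hW mG mW, neg_nonpos]
  refine Finset.sum_nonneg fun i _ => integral_nonneg fun x => ?_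
  simp only [map_smul, real_inner_smul_right]
  exact mul_nonneg hr (inner_fderiv_nonneg (hG.differentiable one_ne_zero) hq _ _)

end Truncation

/-! ### Decay estimates for strong solutions. -/

section Solution

variable {d : ℕ} {D : Set (Sp d)} {c : Coeffs}

/-- The precession term is invisible to both estimates: the maximum principle tests with a multiple
of u, the energy estimate with H. -/
lemma inner_cross_self_left (a b : V3) : inner ℝ (cross a b) a = 0 := by
  simp [cross, crossProduct, PiLp.inner_apply, Fin.sum_univ_three]; ring

lemma inner_cross_self_right (a b : V3) : inner ℝ (cross a b) b = 0 := by
  simp [cross, crossProduct, PiLp.inner_apply, Fin.sum_univ_three]; ring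

lemma cross_zero (a : V3) : cross a 0 = 0 := by
  ext i; fin_cases i <;> simp [cross, crossProduct]

lemma transport_zero (v : Sp d → V3) (x : Sp d) : transport D (fun _ => 0) v x = 0 := by
  simp [transport]

/-- The properties of a strong solution without current on which the decay estimates rest. -/
lemma IsStrongSolution.exists_regularity {T : ℝ} (hT : 0 < T) {u₀ : L2 D} {u : ℝ → L2 D}
    (h : IsStrongSolution D T c (fun _ _ => 0) u₀ u) : ∃ (M : NNReal) (u' : ℝ → L2 D),
      (∀ t ∈ Icc 0 T, u t ∈ closure (neumannBall D M)) ∧ HasH1TimeDeriv T u u' ∧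
      ∀ᵐ t ∂(volume.restrict (Ioo 0 T)), t ∈ Ioo 0 T ∧ u t ∈ neumannBall D M ∧
        HasDerivAt u (u' t) t ∧ ∀ χ : L2 D,
        (∀ᵐ x ∂(volume.restrict D), inner ℝ (cross (u t x) (effField D c (u t) x)) (χ x) = 0) →
        inner ℝ (u' t) χ = c.α * ∫ x in D, inner ℝ (effField D c (u t) x) (χ x) := by
  obtain ⟨u', hu', heq⟩ := h.equation
  obtain ⟨M, hM⟩ := h.memLinftyH2.bounded
  have hball : ∀ᵐ t ∂(volume.restrict (Ioo 0 T)), u t ∈ neumannBall D M := by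
    filter_upwards [hM, h.memLinftyH2.memH2, h.neumann] with t h1 h2 h3 using ⟨h2, h3, h1⟩
  refine ⟨M, u', fun t ht => ?_, hu', ?_⟩
  · refine ((h.continuousOn t ht).mono ?_).mem_closure (Icc_subset_closure_of_ae hT hball ht)
      fun s hs => hs.2
    exact fun s hs => Ioo_subset_Icc_self hs.1
  · filter_upwards [hball, hu'.ae_hasDerivAt hT h.continuousOn, heq,
      ae_restrict_mem measurableSet_Ioo] with t h1 h2 h3 h4
    refine ⟨h4, h1, h2, fun χ hχ => ?_⟩
    rw [L2.inner_def, h3 χ, integral_eq_zero_of_ae hχ]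
    simp [transport_zero, cross_zero]

lemma IsStrongSolution.norm_sub_le {T : ℝ} (hT : 0 < T) {u u' : ℝ → L2 D}
    (hu' : HasH1TimeDeriv T u u') (hu : ContinuousOn u (Icc 0 T)) {s t : ℝ} (hs : s ∈ Icc 0 T)
    (ht : t ∈ Icc 0 T) (hst : s ≤ t) : ‖u t - u s‖ ≤ ∫ r in s..t, ‖u' r‖ := by
  rw [hu'.sub_eq_integral hT hu hs ht]
  exact intervalIntegral.norm_integral_le_integral_norm hst

variable [IsFiniteMeasure (volume.restrict D)]

/-- Exponential decay of the energy. -/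
theorem IsStrongSolution.energy_le (hc : c.Admissible) (hd1 : 1 ≤ d) (hd3 : d ≤ 3)
    (hD : IsSmoothBoundedDomain D) {T : ℝ} (hT : 0 < T) {u₀ : L2 D} {u : ℝ → L2 D}
    (h : IsStrongSolution D T c (fun _ _ => 0) u₀ u) {t : ℝ} (ht : t ∈ Icc 0 T) :
    energy D c (u t) ≤ Real.exp (-(2 * c.α * c.κ * c.μ * t)) * energy D c u₀ := by
  obtain ⟨M, u', hcl, hu', hae⟩ := h.exists_regularity hT
  obtain ⟨U, -, hU⟩ := hD.exists_bound_closure_neumannBall hd1 hd3 M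
  obtain ⟨C, hC0, hC⟩ := exists_norm_toLp_effField_le (D := D) hc M U
  have key := le_exp_mul_of_subgradient (lam := 2 * c.α * c.κ * c.μ)
    (Φ := fun t => energy D c (u t)) (m := fun t => ‖u' t‖) (w := u) hT hC0
    ((continuousOn_energy hc hD.isOpen hD.isBounded hU).comp h.continuousOn hcl)
    hu'.integrableOn_deriv.norm
    (fun s hs t ht hst => IsStrongSolution.norm_sub_le hT hu' h.continuousOn hs ht hst) ?_ ht
  · rwa [h.initial] at key
  filter_upwards [hae] with t ⟨htT, hb, hd, heq⟩
  have hUt := hU _ (subset_closure hb)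
  have mH := memLp_effField (c := c) hb.1 hUt
  refine ⟨-mH.toLp _, u' t, ?_, fun s hs => ?_, hd, ?_⟩
  · rw [norm_neg]; exact hC _ hb hb.1 hUt
  · exact energy_sub_energy_le hc hD.isBounded hb.1 hb.2.1
      (memH1_of_mem_closure_neumannBall hD.isOpen hD.isBounded (hcl s hs)) hUt (hU _ (hcl s hs))
  -- Testing with H yields ⟨-H, u'⟩ = -α‖H‖², and `mul_energy_le_norm_sq` turns the dissipation into
  -- a multiple of the energy.
  · have h1 := heq (mH.toLp _) (by
      filter_upwards [mH.coeFn_toLp] with x hx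
      rw [hx, inner_cross_self_right])
    have h2 : ∫ x in D, inner ℝ (effField D c (u t) x) (mH.toLp _ x) = ‖mH.toLp _‖ ^ 2 := by
      rw [← real_inner_self_eq_norm_sq, L2.inner_def]
      refine integral_congr_ae ?_
      filter_upwards [mH.coeFn_toLp] with x hx
      rw [hx]
    have h3 := mul_energy_le_norm_sq hc hD.isBounded hb.1 hb.2.1 hUt
    rw [inner_neg_left, real_inner_comm, h1, h2]
    have := mul_le_mul_of_nonneg_left h3 hc.α_pos.le
    linarith

/-- The maximum principle, with exponential decay. -/
theorem IsStrongSolution.norm_le (hc : c.Admissible) (hd1 : 1 ≤ d) (hd3 : d ≤ 3)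
    (hD : IsSmoothBoundedDomain D) {T : ℝ} (hT : 0 < T) {u₀ : L2 D} {u : ℝ → L2 D}
    (h : IsStrongSolution D T c (fun _ _ => 0) u₀ u) {k : ℝ} (hk : 0 ≤ k)
    (hu₀ : ∀ᵐ x ∂(volume.restrict D), ‖u₀ x‖ ≤ k) {t : ℝ} (ht : t ∈ Icc 0 T) :
    ∀ᵐ x ∂(volume.restrict D), ‖u t x‖ ≤ Real.exp (-(c.α * c.κ * c.μ * t)) * k := by
  set a := c.α * c.κ * c.μ with ha
  have ha0 : 0 ≤ a := (mul_pos (mul_pos hc.α_pos hc.κ_pos) hc.μ_pos).le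
  obtain ⟨M, u', hcl, hu', hae⟩ := h.exists_regularity hT
  obtain ⟨U, hU0, hU⟩ := hD.exists_bound_closure_neumannBall hd1 hd3 M
  obtain ⟨B, hB⟩ := isCompact_Icc.exists_bound_of_continuousOn h.continuousOn
  have hz : (0 : ℝ) ∈ Icc 0 T := left_mem_Icc.2 hT.le
  have hB0 : 0 ≤ B := (norm_nonneg _).trans (hB 0 hz)
  -- The weight cancels the linear damping ακμ, so the claim for u becomes invariance of the fixed
  -- ball of radius k for w.
  set w : ℝ → L2 D := fun t => Real.exp (a * t) • u t with hw
  set S : Set (L2 D) := {v | ∀ᵐ x ∂(volume.restrict D), ‖v x‖ ≤ Real.exp (a * T) * U} with hS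
  have hexp {t : ℝ} (ht : t ≤ T) : Real.exp (a * t) ≤ Real.exp (a * T) :=
    Real.exp_le_exp.2 (mul_le_mul_of_nonneg_left ht ha0)
  have hwx (t : ℝ) : ∀ᵐ x ∂(volume.restrict D), w t x = Real.exp (a * t) • u t x :=
    Lp.coeFn_smul _ _
  have hwS : MapsTo w (Icc 0 T) S := by
    intro t ht
    rw [hS, mem_ofPred_eq]
    filter_upwards [hwx t, hU _ (hcl t ht)] with x h1 h2
    rw [h1, norm_smul, Real.norm_of_nonneg (Real.exp_pos _).le]
    exact mul_le_mul (hexp ht.2) h2 (norm_nonneg _) (Real.exp_pos _).le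
  have hSb : ∀ v ∈ S, ∀ᵐ x ∂(volume.restrict D), ‖v x‖ ≤ Real.exp (a * T) * U := fun v hv => hv
  have hwc : ContinuousOn w (Icc 0 T) :=
    (Real.continuous_exp.comp (continuous_const.mul continuous_id)).continuousOn.smul h.continuousOn
  have hGc := (contDiff_truncGrad k).continuous
  obtain ⟨C, hC0, hC⟩ := exists_norm_toLp_comp_le (μ := volume.restrict D) hGc
    (Real.exp (a * T) * U)
  obtain ⟨C', hC'⟩ := exists_norm_fderiv_truncGrad_le k
  -- Rate zero suffices: the truncated energy only has to be nonincreasing, since it vanishes at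
  -- time zero. The density `m` is the product rule bound for the variation of w.
  have key := le_exp_mul_of_subgradient (lam := 0)
    (Φ := fun t => ∫ x in D, truncEnergy k (w t x))
    (m := fun r => Real.exp (a * T) * ‖u' r‖ + B * (a * Real.exp (a * r))) (w := w) hT hC0
    ((continuousOn_integral_comp (continuous_truncEnergy k) hGc (truncEnergy_sub_le k) hSb).comp
      hwc hwS) ?_ ?_ ?_ ht
  · have h0 : ∫ x in D, truncEnergy k (w 0 x) = 0 := by
      refine integral_eq_zero_of_ae ?_
      filter_upwards [hwx 0, hu₀] with x h1 h2
      rw [h1, h.initial, mul_zero, Real.exp_zero, one_smul]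
      exact truncEnergy_eq_zero h2
    rw [h0, mul_zero] at key
    have h1 := (integral_eq_zero_iff_of_nonneg (fun x => truncEnergy_nonneg k (w t x))
      ((memLp_comp_of_norm_le (Lp.aestronglyMeasurable (w t)) (hSb _ (hwS ht))
        (continuous_truncEnergy k) 1).integrable le_rfl)).1
      (le_antisymm key (integral_nonneg fun x => truncEnergy_nonneg k _))
    filter_upwards [h1, hwx t] with x h2 h3
    have h4 := norm_le_of_truncEnergy_eq_zero hk h2
    rw [h3, norm_smul, Real.norm_of_nonneg (Real.exp_pos _).le] at h4
    rw [Real.exp_neg, inv_mul_eq_div, le_div_iff₀ (Real.exp_pos _)]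
    linarith
  · refine (hu'.integrableOn_deriv.norm.const_mul _).add ?_
    have : Continuous fun r : ℝ => B * (a * Real.exp (a * r)) := by fun_prop
    exact (this.continuousOn.integrableOn_Icc).mono_set Ioo_subset_Icc_self
  · intro s hs t ht hst
    have e : w t - w s = Real.exp (a * t) • (u t - u s)
        + (Real.exp (a * t) - Real.exp (a * s)) • u s := by
      simp only [hw, smul_sub, sub_smul]; abel
    have hder (x : ℝ) : HasDerivAt (fun x => Real.exp (a * x)) (a * Real.exp (a * x)) x := by
      have := ((hasDerivAt_id x).const_mul a).exp
      simpa [mul_comm] using this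
    have hec : Continuous fun r : ℝ => a * Real.exp (a * r) := by fun_prop
    have h1 : ∫ r in s..t, a * Real.exp (a * r) = Real.exp (a * t) - Real.exp (a * s) :=
      intervalIntegral.integral_eq_sub_of_hasDerivAt (fun x _ => hder x)
        (hec.intervalIntegrable _ _)
    have h2 : 0 ≤ Real.exp (a * t) - Real.exp (a * s) :=
      sub_nonneg.2 (Real.exp_le_exp.2 (mul_le_mul_of_nonneg_left hst ha0))
    rw [intervalIntegral.integral_add ((hu'.intervalIntegrable hs ht).norm.const_mul _)
      ((hec.intervalIntegrable _ _).const_mul _), intervalIntegral.integral_const_mul,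
      intervalIntegral.integral_const_mul, h1, e]
    refine (norm_add_le _ _).trans (add_le_add ?_ ?_)
    · rw [norm_smul, Real.norm_of_nonneg (Real.exp_pos _).le]
      exact mul_le_mul (hexp ht.2)
        (IsStrongSolution.norm_sub_le hT hu' h.continuousOn hs ht hst) (norm_nonneg _)
        (Real.exp_pos _).le
    · rw [norm_smul, Real.norm_of_nonneg h2, mul_comm]
      exact mul_le_mul_of_nonneg_right (hB s hs) h2
  filter_upwards [hae] with t ⟨htT, hb, hd, heq⟩
  have htI := Ioo_subset_Icc_self htT
  have hUt := hU _ (subset_closure hb)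
  have hwt := hSb _ (hwS htI)
  have mG := memLp_comp_of_norm_le (Lp.aestronglyMeasurable (w t)) hwt hGc 2
  set E := Real.exp (a * t) with hE
  have hE0 : 0 < E := Real.exp_pos _
  have hGx : ∀ᵐ x ∂(volume.restrict D), mG.toLp _ x = truncGrad k (E • u t x) := by
    filter_upwards [mG.coeFn_toLp, hwx t] with x h1 h2
    rw [h1, h2]
  have hwd : HasDerivAt w (E • u' t + (a * E) • u t) t := by
    have := ((hasDerivAt_id t).const_mul a).exp.smul hd
    simp only [id, mul_one] at this
    rw [mul_comm a]
    exact this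
  refine ⟨mG.toLp _, _, hC _ hwt, fun s hs => ?_, hwd, ?_⟩
  · exact integral_sub_integral_le_inner (continuous_truncEnergy k) hGc (truncEnergy_sub_le k)
      hwt (hSb _ (hwS hs))
  · have mG' : MemLp (fun x => truncGrad k (E • u t x)) 2 (volume.restrict D) :=
      (memLp_congr_ae hGx).1 (Lp.memLp _)
    have mF := memLp_comp_of_norm_le (Lp.aestronglyMeasurable (u t)) hUt
      (continuous_potentialGrad c) 2
    have h1 := heq (mG.toLp _) (by
      filter_upwards [hGx] with x hx
      rw [hx, truncGrad, real_inner_smul_right, real_inner_smul_right, inner_cross_self_left,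
        mul_zero, mul_zero])
    have h2 : ∫ x in D, inner ℝ (effField D c (u t) x) (mG.toLp _ x) =
        c.σ * (∫ x in D, inner ℝ (laplacian D (u t) x) (truncGrad k (E • u t x)))
        - ∫ x in D, inner ℝ (potentialGrad c (u t x)) (truncGrad k (E • u t x)) := by
      rw [← integral_const_mul, ← integral_sub
        ((integrable_inner hb.1.memLp_laplacian mG').const_mul _) (integrable_inner mF mG')]
      refine integral_congr_ae ?_
      filter_upwards [hGx] with x hx
      rw [hx, effField_eq, inner_sub_left, real_inner_smul_left]
    have h3 := integral_inner_laplacian_comp_nonpos hD.isOpen hD.isBounded hb.1 hb.2.1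
      (contDiff_truncGrad k) hC' (truncEnergy_sub_le k) hE0.le mG'
    -- The potential damps at least at rate κμ in the direction of u. Multiplied by α this
    -- compensates the term a⟨G, u⟩ coming from differentiating the exponential.
    have h4 : c.κ * c.μ * inner ℝ (mG.toLp _) (u t) ≤
        ∫ x in D, inner ℝ (potentialGrad c (u t x)) (truncGrad k (E • u t x)) := by
      rw [L2.inner_def, ← integral_const_mul]
      refine integral_mono_ae ((L2.integrable_inner _ _).const_mul _) (integrable_inner mF mG') ?_
      filter_upwards [hGx] with x hx
      rw [hx, truncGrad, real_inner_smul_left, real_inner_smul_right, real_inner_smul_left,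
        real_inner_smul_right, real_inner_self_eq_norm_sq]
      have h5 := le_inner_potentialGrad hc (u t x)
      have h6 := mul_nonneg (truncWeight_nonneg k (‖E • u t x‖ ^ 2)) hE0.le
      nlinarith [mul_le_mul_of_nonneg_left h5 h6]
    rw [zero_mul, neg_zero, inner_add_right, real_inner_smul_right, real_inner_smul_right,
      real_inner_comm (u' t), h1, h2]
    have h5 := mul_le_mul_of_nonneg_left h4 hc.α_pos.le
    have h6 := mul_nonpos_of_nonneg_of_nonpos (mul_pos hc.α_pos hc.σ_pos).le h3
    rw [ha]
    nlinarith [mul_le_mul_of_nonneg_left h5 hE0.le, mul_nonneg hE0.le (neg_nonneg.2 h6)]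

end Solution

end

end LLB

open MeasureTheory Filter Topology Set
open scoped ContDiff
set_option linter.unusedSectionVars false

namespace LLB

noncomputable section

/-! ### Passage to norms and limits in time. -/

section Decay

variable {d : ℕ} {D : Set (Sp d)} {c : Coeffs}

lemma IsSmoothBoundedDomain.isFiniteMeasure (hD : IsSmoothBoundedDomain D) :
    IsFiniteMeasure (volume.restrict D) :=
  ⟨by rw [Measure.restrict_apply_univ]; exact hD.isBounded.measure_lt_top⟩

lemma IsStrongSolution.memH1_and_bounded (hd1 : 1 ≤ d) (hd3 : d ≤ 3)
    (hD : IsSmoothBoundedDomain D) {T : ℝ} (hT : 0 < T) {u₀ : L2 D} {u : ℝ → L2 D}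
    (h : IsStrongSolution D T c (fun _ _ => 0) u₀ u) : ∃ U : ℝ, ∀ t ∈ Icc 0 T,
      MemH1 D (u t) ∧ ∀ᵐ x ∂(volume.restrict D), ‖u t x‖ ≤ U := by
  obtain ⟨M, u', hcl, -, -⟩ := h.exists_regularity hT
  obtain ⟨U, -, hU⟩ := hD.exists_bound_closure_neumannBall hd1 hd3 M
  exact ⟨U, fun t ht => ⟨memH1_of_mem_closure_neumannBall hD.isOpen hD.isBounded (hcl t ht),
    hU _ (hcl t ht)⟩⟩

lemma IsStrongSolution.memLp_top (hd1 : 1 ≤ d) (hd3 : d ≤ 3)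
    (hD : IsSmoothBoundedDomain D) {T : ℝ} (hT : 0 < T) {u₀ : L2 D} {u : ℝ → L2 D}
    (h : IsStrongSolution D T c (fun _ _ => 0) u₀ u) {t : ℝ} (ht : t ∈ Icc 0 T) :
    MemLp (u t) ⊤ (volume.restrict D) := by
  obtain ⟨U, hU⟩ := h.memH1_and_bounded hd1 hd3 hD hT
  exact memLp_top_of_bound (Lp.aestronglyMeasurable _) U (hU t ht).2

lemma IsStrongSolution.eLpNorm_top_le (hc : c.Admissible) (hd1 : 1 ≤ d) (hd3 : d ≤ 3)
    (hD : IsSmoothBoundedDomain D) {T : ℝ} (hT : 0 < T) {u₀ : L2 D} {u : ℝ → L2 D}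
    (h : IsStrongSolution D T c (fun _ _ => 0) u₀ u) {t : ℝ} (ht : t ∈ Icc 0 T) :
    eLpNorm (u t) ⊤ (volume.restrict D) ≤
      ENNReal.ofReal (Real.exp (-(c.α * c.κ * c.μ * t))) *
        eLpNorm u₀ ⊤ (volume.restrict D) := by
  have := hD.isFiniteMeasure
  -- The initial datum is bounded because it is the value u(0), which lies in the L² closure of a
  -- Neumann ball.
  have h0 : eLpNorm u₀ ⊤ (volume.restrict D) ≠ ⊤ := by
    rw [← h.initial]
    exact (h.memLp_top hd1 hd3 hD hT (left_mem_Icc.2 hT.le)).2.ne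
  set k := (eLpNorm u₀ ⊤ (volume.restrict D)).toReal with hk
  have hu₀ : ∀ᵐ x ∂(volume.restrict D), ‖u₀ x‖ ≤ k := by
    filter_upwards [ae_le_eLpNormEssSup (f := u₀) (μ := volume.restrict D)] with x hx
    rw [← eLpNorm_exponent_top] at hx
    rw [← toReal_enorm]
    exact ENNReal.toReal_mono h0 hx
  have key := h.norm_le hc hd1 hd3 hD hT ENNReal.toReal_nonneg hu₀ ht
  rw [eLpNorm_exponent_top]
  refine (eLpNormEssSup_le_of_ae_bound key).trans_eq ?_
  rw [ENNReal.ofReal_mul (Real.exp_pos _).le, ENNReal.ofReal_toReal h0]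

/-- Coercivity: the terms κμ/2 ‖v‖² and σ/2 ‖∇v‖² are each bounded by the energy, which explains the
two summands of the constant. -/
lemma h1Norm_le (hc : c.Admissible) [IsFiniteMeasure (volume.restrict D)] {v : L2 D}
    (hv : MemH1 D v) {U : ℝ} (hU : ∀ᵐ x ∂(volume.restrict D), ‖v x‖ ≤ U) :
    h1Norm D v ≤
      ENNReal.ofReal ((2 / (c.κ * c.μ) + 2 / c.σ) * energy D c v) ^ (1 / 2 : ℝ) := by
  refine ENNReal.rpow_le_rpow ?_ (by norm_num)
  have e : ∑ i : Fin d, eLpNorm (weakDeriv D i v) 2 (volume.restrict D) ^ 2 =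
      ENNReal.ofReal (∑ i, ‖gradLp D i v‖ ^ 2) := by
    rw [ENNReal.ofReal_sum_of_nonneg fun _ _ => by positivity]
    refine Finset.sum_congr rfl fun i _ => ?_
    rw [eLpNorm_two_sq (hv.memLp_deriv i), norm_gradLp_sq hv]
  rw [e, eLpNorm_two_sq (Lp.memLp v), ← norm_sq_eq_integral,
    ← ENNReal.ofReal_add (by positivity) (Finset.sum_nonneg fun _ _ => by positivity)]
  refine ENNReal.ofReal_le_ofReal ?_
  have h1 := le_energy hc hv hU
  have hκμ := mul_pos hc.κ_pos hc.μ_pos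
  have hσ := hc.σ_pos
  have h2 : 0 ≤ c.σ / 2 * ∑ i, ‖gradLp D i v‖ ^ 2 := by positivity
  have h3 : 0 ≤ c.κ * c.μ / 2 * ‖v‖ ^ 2 := by positivity
  have h4 : ‖v‖ ^ 2 ≤ 2 / (c.κ * c.μ) * energy D c v := by
    rw [div_mul_eq_mul_div, le_div_iff₀ hκμ]; linarith
  have h5 : ∑ i, ‖gradLp D i v‖ ^ 2 ≤ 2 / c.σ * energy D c v := by
    rw [div_mul_eq_mul_div, le_div_iff₀ hσ]; linarith
  rw [add_mul]
  exact add_le_add h4 h5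

lemma tendsto_exp_neg_mul {a : ℝ} (ha : 0 < a) :
    Tendsto (fun t : ℝ => Real.exp (-(a * t))) atTop (𝓝 0) :=
  Real.tendsto_exp_neg_atTop_nhds_zero.comp (tendsto_id.const_mul_atTop ha)

end Decay

end

end LLB

/-! ### The main theorem. -/

theorem theorem3p2 (d : ℕ) (hd1 : 1 ≤ d) (hd3 : d ≤ 3)
    (D : Set (LLB.Sp d)) (hD : LLB.IsSmoothBoundedDomain D)
    (c : LLB.Coeffs) (hc : c.Admissible)
    (u₀ : LLB.L2 D) (hu₀ : LLB.MemH2 D u₀) :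
    (∀ (T : ℝ), 0 < T → ∀ u : ℝ → LLB.L2 D,
      LLB.IsStrongSolution D T c (fun _ _ => 0) u₀ u →
      ∀ t ∈ Set.Icc 0 T,
        MeasureTheory.MemLp (u t) ⊤ (MeasureTheory.volume.restrict D) ∧
        MeasureTheory.eLpNorm (u t) ⊤ (MeasureTheory.volume.restrict D) ≤
          ENNReal.ofReal (Real.exp (-(c.α * c.κ * c.μ * t))) *
            MeasureTheory.eLpNorm u₀ ⊤ (MeasureTheory.volume.restrict D) ∧
        LLB.MemH1 D (u t) ∧
        MeasureTheory.IntegrableOn (LLB.energyDensity D c (u t)) D MeasureTheory.volume ∧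
        LLB.energy D c (u t) ≤
          Real.exp (-(2 * c.α * c.κ * c.μ * t)) * LLB.energy D c u₀) ∧
    (∀ u : ℝ → LLB.L2 D,
      (∀ T : ℝ, 0 < T → LLB.IsStrongSolution D T c (fun _ _ => 0) u₀ u) →
        Filter.Tendsto
          (fun t => MeasureTheory.eLpNorm (u t) ⊤ (MeasureTheory.volume.restrict D))
          Filter.atTop (nhds 0) ∧
        Filter.Tendsto (fun t => LLB.energy D c (u t)) Filter.atTop (nhds 0) ∧
        Filter.Tendsto (fun t => LLB.h1Norm D (u t)) Filter.atTop (nhds 0)) := by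
  have key : ∀ (T : ℝ), 0 < T → ∀ u : ℝ → LLB.L2 D,
      LLB.IsStrongSolution D T c (fun _ _ => 0) u₀ u → ∀ t ∈ Set.Icc 0 T,
        MeasureTheory.MemLp (u t) ⊤ (MeasureTheory.volume.restrict D) ∧
        MeasureTheory.eLpNorm (u t) ⊤ (MeasureTheory.volume.restrict D) ≤
          ENNReal.ofReal (Real.exp (-(c.α * c.κ * c.μ * t))) *
            MeasureTheory.eLpNorm u₀ ⊤ (MeasureTheory.volume.restrict D) ∧
        LLB.MemH1 D (u t) ∧
        MeasureTheory.IntegrableOn (LLB.energyDensity D c (u t)) D MeasureTheory.volume ∧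
        LLB.energy D c (u t) ≤
          Real.exp (-(2 * c.α * c.κ * c.μ * t)) * LLB.energy D c u₀ := by
    intro T hT u h t ht
    have := hD.isFiniteMeasure
    obtain ⟨U, hU⟩ := h.memH1_and_bounded hd1 hd3 hD hT
    exact ⟨h.memLp_top hd1 hd3 hD hT ht, h.eLpNorm_top_le hc hd1 hd3 hD hT ht, (hU t ht).1,
      LLB.integrableOn_energyDensity (hU t ht).1 (hU t ht).2, h.energy_le hc hd1 hd3 hD hT ht⟩
  refine ⟨key, fun u h => ?_⟩
  have := hD.isFiniteMeasure
  have ha : 0 < c.α * c.κ * c.μ := mul_pos (mul_pos hc.α_pos hc.κ_pos) hc.μ_pos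
  have ha2 : 0 < 2 * c.α * c.κ * c.μ := by linarith
  -- A horizon beyond t keeps the time interval nondegenerate even for t = 0. The constant U may
  -- depend on t, since the decay bounds do not involve it.
  have hmem {t : ℝ} (ht : 0 ≤ t) : t ∈ Set.Icc 0 (t + 1) := ⟨ht, by linarith⟩
  have hbd {t : ℝ} (ht : 0 ≤ t) : ∃ U : ℝ, LLB.MemH1 D (u t) ∧
      ∀ᵐ x ∂(MeasureTheory.volume.restrict D), ‖u t x‖ ≤ U := by
    obtain ⟨U, hU⟩ := (h (t + 1) (by linarith)).memH1_and_bounded hd1 hd3 hD (by linarith)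
    exact ⟨U, hU t (hmem ht)⟩
  have hE : Filter.Tendsto (fun t => LLB.energy D c (u t)) Filter.atTop (nhds 0) := by
    have h1 := (LLB.tendsto_exp_neg_mul ha2).mul_const (LLB.energy D c u₀)
    rw [zero_mul] at h1
    refine squeeze_zero' ?_ ?_ h1
    · filter_upwards [Filter.eventually_ge_atTop 0] with t ht
      obtain ⟨U, h2, h3⟩ := hbd ht
      refine le_trans ?_ (LLB.le_energy hc h2 h3)
      have := hc.σ_pos
      have := hc.κ_pos
      have := hc.μ_pos
      positivity
    · filter_upwards [Filter.eventually_ge_atTop 0] with t ht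
      exact (key (t + 1) (by linarith) u (h _ (by linarith)) t (hmem ht)).2.2.2.2
  refine ⟨?_, hE, ?_⟩
  · have h0 : MeasureTheory.eLpNorm u₀ ⊤ (MeasureTheory.volume.restrict D) ≠ ⊤ := by
      have := (key 1 one_pos u (h 1 one_pos) 0 (by simp)).1.2
      rw [(h 1 one_pos).initial] at this
      exact this.ne
    have h1 := ENNReal.Tendsto.mul_const (b := MeasureTheory.eLpNorm u₀ ⊤
      (MeasureTheory.volume.restrict D)) (ENNReal.tendsto_ofReal (LLB.tendsto_exp_neg_mul ha))
      (Or.inr h0)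
    rw [ENNReal.ofReal_zero, zero_mul] at h1
    refine tendsto_of_tendsto_of_tendsto_of_le_of_le' tendsto_const_nhds h1
      (Filter.Eventually.of_forall fun _ => zero_le) ?_
    filter_upwards [Filter.eventually_ge_atTop 0] with t ht
    exact (key (t + 1) (by linarith) u (h _ (by linarith)) t (hmem ht)).2.1
  · have h1 := (ENNReal.tendsto_ofReal (hE.const_mul (2 / (c.κ * c.μ) + 2 / c.σ))).ennrpow_const
      (1 / 2 : ℝ)
    rw [mul_zero, ENNReal.ofReal_zero, ENNReal.zero_rpow_of_pos (by norm_num)] at h1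
    refine tendsto_of_tendsto_of_tendsto_of_le_of_le' tendsto_const_nhds h1
      (Filter.Eventually.of_forall fun _ => zero_le) ?_
    filter_upwards [Filter.eventually_ge_atTop 0] with t ht
    obtain ⟨U, h2, h3⟩ := hbd ht
    exact LLB.h1Norm_le hc h2 h3
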